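/- Write $\widehat g(\xi)=(2\pi)^{-1/2}\int_{\mathbb R} e^{-ix\xi}g(x)\,dx$ (extended to $L^2(\mathbb R)$ by Plancherel), $\langle x\rangle=(1+x^2)^{1/2}$, $\|\varphi\|_{H^{1,0}}=\|\langle\xi\rangle\widehat\varphi\|_{L^2}$, $\|\varphi\|_{H^{0,1}}=\|\langle x\rangle\varphi\|_{L^2}$, and let $e^{it\partial_x^2/2}$ be the Fourier multiplier with symbol $e^{-it\xi^2/2}$. There are constants $\varepsilon_0>0$, $C>0$ and $0<\delta<\tfrac12$ such that the following holds for all $0<\varepsilon\le\varepsilon_0$ and all $u_*\in H^{1,0}\cap H^{0,1}$ with $\|u_*\|_{H^{1,0}}+\|u_*\|_{H^{0,1}}\le\varepsilon$. There is a unique global solution $u\in C(\mathbb R;H^{1,0}(\mathbb R)\cap H^{0,1}(\mathbb R))$ of $$ i\,\partial_t u+\tfrac12\,\partial_x^2u=|u|^2u \quad\text{on } \mathbb R\times\mathbb R,\qquad u|_{t=1}=e^{i\partial_x^2/2}u_*, $$ understood as the integral equation $$u(t)=e^{i(t-1)\partial_x^2/2}u(1)-i\int_1^te^{i(t-s)\partial_x^2/2}\,|u(s)|^2u(s)\,ds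 ,\qquad t\in\mathbb R,$$ and it satisfies $$\|u(t)\|_{L^\infty}\le C\,\varepsilon\,(1+|t|)^{-1/2}\qquad\text{for all } t\in\mathbb R.$$ Furthermore, with $f(t)=e^{-it\partial_x^2/2}u(t)$, there is a function $W\in L^\infty(\mathbb R)$ such that $$\left\|\widehat f(t,\xi)\,\exp\left(i\int_1^t|\widehat u(s,\xi)|^2\,\frac{ds}{s}\right)-W(\xi)\right\|_{L^\infty_\xi}\le C\,t^{-\delta}\qquad\text{for all } t\ge1,$$ and $W$ is the only element of $L^\infty(\mathbb R)$ for which such a bound holds on $t\ge 1$ with some constant $C'$ and some exponent $\delta'>0$ in place of $C$ and $\delta$. -/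

import Mathlib

open MeasureTheory Filter Topology FourierTransform
open scoped ENNReal

noncomputable section

/-- The complex Lebesgue space `L²(ℝ)`. -/
abbrev L2R : Type := Lp ℂ 2 (volume : Measure ℝ)

/-- The Fourier transform `ĝ(ξ) = (2π)^{-1/2} ∫ e^{-ixξ} g(x) dx` of an integrable function `g`. -/
def fourierInt (g : ℝ → ℂ) (ξ : ℝ) : ℂ :=
  ((Real.sqrt (2 * Real.pi))⁻¹ : ℂ) * ∫ x : ℝ, Complex.exp (-(Complex.I * x * ξ)) * g x

/-- The Fourier transform of `φ ∈ L²(ℝ)`, in the same normalization as `fourierInt`, obtained from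
Mathlib's Plancherel transform `𝓕` (whose kernel is `e^{-2πixk}`) by the substitution
`k = ξ / (2π)`. -/
def fourierL2 (φ : L2R) (ξ : ℝ) : ℂ :=
  ((Real.sqrt (2 * Real.pi))⁻¹ : ℂ) * (𝓕 φ : L2R) (ξ / (2 * Real.pi))

/-- The norm of `H^{1,0}`, that is `‖⟨∇⟩ φ‖_{L²} = ‖⟨ξ⟩ φ̂‖_{L²}`; it is `∞` if `φ ∉ H^{1,0}`. -/
def normH10 (φ : L2R) : ℝ≥0∞ :=
  eLpNorm (fun ξ : ℝ => (Real.sqrt (1 + ξ ^ 2) : ℂ) * fourierL2 φ ξ) 2 volume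

/-- The norm of `H^{0,1}`, that is `‖⟨x⟩ φ‖_{L²}`; it is `∞` if `φ ∉ H^{0,1}`. -/
def normH01 (φ : L2R) : ℝ≥0∞ :=
  eLpNorm (fun x : ℝ => (Real.sqrt (1 + x ^ 2) : ℂ) * φ x) 2 volume

/-- The norm of `H^{1,0} ∩ H^{0,1}`. -/
def normSigma (φ : L2R) : ℝ≥0∞ := normH10 φ + normH01 φ

/-- The symbol `e^{-itξ²/2}` of `e^{it∂ₓ²/2}`, at the frequency `ξ = 2πk`. -/
def schrodingerSymbol (t k : ℝ) : ℂ :=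
  Complex.exp (-(Complex.I * t * (2 * Real.pi * k) ^ 2 / 2))

theorem memLp_schrodingerSymbol_mul (t : ℝ) (ψ : L2R) :
    MemLp (fun k : ℝ => schrodingerSymbol t k * ψ k) 2 volume := by
  have hc : Continuous (fun k : ℝ => schrodingerSymbol t k) := by
    unfold schrodingerSymbol
    fun_prop
  refine (Lp.memLp ψ).of_le (hc.aestronglyMeasurable.mul (Lp.aestronglyMeasurable ψ)) ?_
  refine Eventually.of_forall fun k => ?_
  have h : ‖schrodingerSymbol t k‖ = 1 := by
    have e : schrodingerSymbol t k
        = Complex.exp (((-(t * (2 * Real.pi * k) ^ 2 / 2) : ℝ) : ℂ) * Complex.I) := by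
      unfold schrodingerSymbol
      congr 1
      push_cast
      ring
    rw [e, Complex.norm_exp_ofReal_mul_I]
  rw [norm_mul, h, one_mul]

/-- The free Schrödinger group `e^{it∂ₓ²/2}` on `L²(ℝ)`, as a Fourier multiplier. -/
def schrodinger (t : ℝ) (φ : L2R) : L2R :=
  𝓕⁻ ((memLp_schrodingerSymbol_mul t (𝓕 φ)).toLp
    (fun k : ℝ => schrodingerSymbol t k * (𝓕 φ : L2R) k))

open scoped Classical in
/-- The nonlinearity `|φ|²φ` as an element of `L²(ℝ)`. It is used only for `φ ∈ H^{1,0}`, where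
`|φ|²φ` is square integrable because `H^{1,0} ⊆ L^∞`; elsewhere the value is `0` by convention. -/
def cubic (φ : L2R) : L2R :=
  if h : MemLp (fun x : ℝ => ((‖φ x‖ ^ 2 : ℝ) : ℂ) * φ x) 2 volume then h.toLp _ else 0

/-- `u ∈ C(ℝ; H^{1,0} ∩ H^{0,1})` solves `i u_t + ½ u_xx = |u|²u` with `u|_{t=1} = e^{i∂ₓ²/2} u_*`,
in the sense of the associated integral equation. The integral is an integral of a
continuous `L²(ℝ)`-valued function. -/
structure IsGlobalSolution (uStar : L2R) (u : ℝ → L2R) : Prop where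
  mem : ∀ t : ℝ, normSigma (u t) < ∞
  continuous : ∀ t₀ : ℝ, Tendsto (fun t => normSigma (u t - u t₀)) (𝓝 t₀) (𝓝 0)
  init : u 1 = schrodinger 1 uStar
  duhamel : ∀ t : ℝ, u t = schrodinger (t - 1) (u 1)
    - Complex.I • ∫ s in (1 : ℝ)..t, schrodinger (t - s) (cubic (u s))

/-- The profile `f(t) = e^{-it∂ₓ²/2} u(t)`. -/
def profile (u : ℝ → L2R) (t : ℝ) : L2R := schrodinger (-t) (u t)

/-- The phase-corrected profile `f̂(t,ξ) exp(i ∫₁ᵗ |û(s,ξ)|² ds/s)`. For a solution `u` as above both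
`u(t)` and `f(t)` lie in `H^{0,1} ⊆ L¹`, and the integral formula for the Fourier transform
gives representatives that are continuous in time and frequency, so that the time integral at a
fixed frequency `ξ` is meaningful. -/
def correctedProfile (u : ℝ → L2R) (t ξ : ℝ) : ℂ :=
  fourierInt (profile u t) ξ *
    Complex.exp (Complex.I * ((∫ s in (1 : ℝ)..t, ‖fourierInt (u s) ξ‖ ^ 2 / s : ℝ) : ℂ))

/-- `‖f̂ exp(i ∫₁ᵗ |û(s)|² ds/s) - W‖_{L^∞} ≤ C t^{-δ}` for all `t ≥ 1`. -/
def ConvergesAtRate (u : ℝ → L2R) (W : Lp ℂ ∞ (volume : Measure ℝ)) (C δ : ℝ) : Prop :=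
  ∀ t : ℝ, 1 ≤ t →
    eLpNorm (fun ξ : ℝ => correctedProfile u t ξ - W ξ) ∞ volume
      ≤ ENNReal.ofReal (C * t ^ (-δ))

end

/-! Work with the profile `f(t) = e^{-it∂²/2} u(t)`, whose equation is `f' = nlsField`. The cubic
term is truncated at modulus `M`, which makes the field globally Lipschitz on `L²`. A global flow
then exists without any smallness, and the a priori bound shows afterwards that the truncation at `M
= 1` is never active for small data.

The norm of `H^{1,0} ∩ H^{0,1}` is encoded by difference quotients `R f - f`, with `R` a sign
change, a translation or a modulation. After conjugation by the free group these become gauge,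
translation and Galilean symmetries of the equation, so `R f` solves the same equation. Gronwall for
`R f - f` replaces the commutation of the equation with `∂ₓ` and `x + it∂ₓ` (`IsFlow.sigmaBound`,
`IsFlow.sigmaBound_growth`). If `|u| ≤ q s^{-1/2}`, the rate is `3q²/s`, so the norm grows at most
like a small power of `s`.

The decay itself comes from the factorization of the free group into chirp, dilation, Fourier
transform and chirp (`freeGroup_ae_eq`). Dropping the inner chirp costs `|t|^{-1/8}` times the
weighted norm, so `|u(t)|` is at most `|t|^{-1/2}` times `sup |f̂|` plus a lower-order term. The
same factorization applied to the nonlinearity shows that at each fixed frequency `k` of the kernel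
`e^{-2πixk}` one has `∂ₜ f̂ = -i (2π|t|)⁻¹ |f̂|² f̂` up to an error of size `|t|^{-1-1/8}` times the
cube of the norm (`SigmaBound.fourier_nlsField`). The leading term only rotates the phase. With norm
growth `s^{1/48}` the error is `s^{-17/16}`, which is integrable. Hence `|f̂|` stays small, the
bootstrap closes (`IsFlow.decay`), and the phase-corrected transform is Cauchy at rate `s^{-1/16}`,
which gives `W`.

Negative times are covered by running the argument along the two rays `σ s`, `σ = ±1`, `s ≥ 1`.
Uniqueness of the solution holds because any solution is bounded on compact time intervals, so there
it solves a truncated Lipschitz equation. Uniqueness of `W` is uniqueness of limits in `L^∞`. -/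

open scoped NNReal

noncomputable section

/-! ### The Plancherel transform as a Fourier integral -/

/-- On `L¹ ∩ L²` the Plancherel transform is given by the Fourier integral. -/
theorem coeFn_fourier_ae_eq (φ : L2R) (h1 : Integrable φ) :
    (𝓕 φ : L2R) =ᵐ[volume] 𝓕 (φ : ℝ → ℂ) := by
  have hcont : Continuous (𝓕 (φ : ℝ → ℂ)) :=
    VectorFourier.fourierIntegral_continuous Real.continuous_fourierChar
      (innerSL ℝ).continuous₂ h1
  -- Both sides are locally integrable, so it suffices to test against smooth compactly supported
  -- functions. There the left side is the distributional transform and the right side is Parseval's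
  -- formula for integrable functions.
  refine ae_eq_of_integral_contDiff_smul_eq
    ((Lp.memLp (𝓕 φ : L2R)).locallyIntegrable one_le_two) hcont.locallyIntegrable ?_
  intro g hg hgc
  have hg₁ : HasCompactSupport (Complex.ofRealCLM ∘ g) := hgc.comp_left rfl
  have hg₂ : ContDiff ℝ ((⊤ : ℕ∞) : WithTop ℕ∞) (Complex.ofRealCLM ∘ g) :=
    Complex.ofRealCLM.contDiff.comp hg
  set G := hg₁.toSchwartzMap hg₂ with hG
  have e1 : ∫ x, g x • (𝓕 φ : L2R) x = ∫ x, G x • (𝓕 φ : L2R) x := by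
    simp [hG]
  have e2 : ∫ x, g x • 𝓕 (φ : ℝ → ℂ) x = ∫ x, G x • 𝓕 (φ : ℝ → ℂ) x := by
    simp [hG]
  rw [e1, e2]
  rw [← Lp.toTemperedDistribution_apply, ← Lp.fourier_toTemperedDistribution_eq,
    TemperedDistribution.fourier_apply, Lp.toTemperedDistribution_apply]
  have h := VectorFourier.integral_fourierIntegral_smul_eq_flip (μ := (volume : Measure ℝ))
    (ν := (volume : Measure ℝ)) (L := innerₗ ℝ) Real.continuous_fourierChar
    (by exact (innerSL ℝ).continuous₂) (G.integrable (μ := volume)) h1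
  rw [flip_innerₗ] at h
  exact h

/-- On `L¹ ∩ L²` the inverse Plancherel transform is given by the inverse Fourier integral. -/
theorem coeFn_fourierInv_ae_eq (φ : L2R) (h1 : Integrable φ) :
    (𝓕⁻ φ : L2R) =ᵐ[volume] 𝓕⁻ (φ : ℝ → ℂ) := by
  have h1' : Integrable (fun x => φ (-x)) := h1.comp_neg
  have hcont : Continuous (𝓕⁻ (φ : ℝ → ℂ)) := by
    rw [Real.fourierInv_eq_fourier_comp_neg]
    exact VectorFourier.fourierIntegral_continuous Real.continuous_fourierChar
      (innerSL ℝ).continuous₂ h1'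
  refine ae_eq_of_integral_contDiff_smul_eq
    ((Lp.memLp (𝓕⁻ φ : L2R)).locallyIntegrable one_le_two) hcont.locallyIntegrable ?_
  intro g hg hgc
  have hg₁ : HasCompactSupport (Complex.ofRealCLM ∘ g) := hgc.comp_left rfl
  have hg₂ : ContDiff ℝ ((⊤ : ℕ∞) : WithTop ℕ∞) (Complex.ofRealCLM ∘ g) :=
    Complex.ofRealCLM.contDiff.comp hg
  set G := hg₁.toSchwartzMap hg₂ with hG
  have e1 : ∫ x, g x • (𝓕⁻ φ : L2R) x = ∫ x, G x • (𝓕⁻ φ : L2R) x := by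
    simp [hG]
  have e2 : ∫ x, g x • 𝓕⁻ (φ : ℝ → ℂ) x = ∫ x, G x • 𝓕⁻ (φ : ℝ → ℂ) x := by
    simp [hG]
  rw [e1, e2]
  rw [← Lp.toTemperedDistribution_apply, ← Lp.fourierInv_toTemperedDistribution_eq,
    TemperedDistribution.fourierInv_apply, Lp.toTemperedDistribution_apply]
  have h := VectorFourier.integral_fourierIntegral_smul_eq_flip (μ := (volume : Measure ℝ))
    (ν := (volume : Measure ℝ)) (L := innerₗ ℝ) Real.continuous_fourierChar
    (by exact (innerSL ℝ).continuous₂) (G.integrable (μ := volume)) h1'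
  rw [flip_innerₗ] at h
  rw [Real.fourierInv_eq_fourier_comp_neg]
  refine Eq.trans ?_ h
  rw [← integral_neg_eq_self]
  congr 1
  ext x
  congr 1
  rw [SchwartzMap.fourierInv_coe, Real.fourierInv_eq_fourier_neg, neg_neg]
  rfl

/-! ### Phase multiplications and translations on `L²` -/

theorem memLp_phase_mul (θ : C(ℝ, ℝ)) (φ : L2R) :
    MemLp (fun x => Complex.exp (θ x * Complex.I) * φ x) 2 volume :=
  (Lp.memLp φ).of_le ((Continuous.aestronglyMeasurable (by fun_prop)).mul
    (Lp.aestronglyMeasurable φ))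
    (Eventually.of_forall fun x => by rw [norm_mul, Complex.norm_exp_ofReal_mul_I, one_mul])

/-- Multiplication by the unimodular function `e^{iθ}`. -/
def phaseMul (θ : C(ℝ, ℝ)) : L2R →ₗᵢ[ℂ] L2R where
  toFun φ := (memLp_phase_mul θ φ).toLp _
  map_add' φ ψ := by
    apply Lp.ext
    refine (MemLp.coeFn_toLp _).trans ?_
    refine EventuallyEq.trans ?_ (Lp.coeFn_add _ _).symm
    filter_upwards [Lp.coeFn_add φ ψ, (memLp_phase_mul θ φ).coeFn_toLp,
      (memLp_phase_mul θ ψ).coeFn_toLp] with x h1 h2 h3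
    rw [h1, Pi.add_apply, Pi.add_apply, h2, h3, mul_add]
  map_smul' c φ := by
    apply Lp.ext
    refine (MemLp.coeFn_toLp _).trans ?_
    refine EventuallyEq.trans ?_ (Lp.coeFn_smul _ _).symm
    filter_upwards [Lp.coeFn_smul c φ, (memLp_phase_mul θ φ).coeFn_toLp] with x h1 h2
    rw [h1, Pi.smul_apply, Pi.smul_apply, RingHom.id_apply, h2, smul_eq_mul, smul_eq_mul]
    ring
  norm_map' φ := by
    change ‖(memLp_phase_mul θ φ).toLp _‖ = _
    rw [Lp.norm_toLp, Lp.norm_def]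
    congr 1
    refine eLpNorm_congr_norm_ae (Eventually.of_forall fun x => ?_)
    rw [norm_mul, Complex.norm_exp_ofReal_mul_I, one_mul]

theorem coeFn_phaseMul (θ : C(ℝ, ℝ)) (φ : L2R) :
    phaseMul θ φ =ᵐ[volume] fun x => Complex.exp (θ x * Complex.I) * φ x :=
  (memLp_phase_mul θ φ).coeFn_toLp

theorem phaseMul_phaseMul (θ η : C(ℝ, ℝ)) (φ : L2R) :
    phaseMul θ (phaseMul η φ) = phaseMul (θ + η) φ := by
  apply Lp.ext
  filter_upwards [coeFn_phaseMul θ (phaseMul η φ), coeFn_phaseMul η φ, coeFn_phaseMul (θ + η) φ]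
    with x h1 h2 h3
  rw [h1, h2, h3, ← mul_assoc, ← Complex.exp_add, ContinuousMap.add_apply]
  push_cast
  ring_nf

theorem phaseMul_zero (φ : L2R) : phaseMul 0 φ = φ := by
  apply Lp.ext
  filter_upwards [coeFn_phaseMul 0 φ] with x h1
  simp [h1]

/-- The translation `φ ↦ φ(· + h)`. -/
def transl (h : ℝ) : L2R →ₗᵢ[ℂ] L2R :=
  Lp.compMeasurePreservingₗᵢ ℂ (fun x : ℝ => x + h) (measurePreserving_add_right volume h)

theorem coeFn_transl (h : ℝ) (φ : L2R) : transl h φ =ᵐ[volume] fun x => φ (x + h) :=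
  Lp.coeFn_compMeasurePreserving φ (measurePreserving_add_right volume h)

theorem ae_comp_add_right {p : ℝ → Prop} (h : ℝ) (hp : ∀ᵐ x : ℝ, p x) : ∀ᵐ x : ℝ, p (x + h) :=
  (measurePreserving_add_right volume h).quasiMeasurePreserving.ae hp

theorem transl_phaseMul (h : ℝ) (θ : C(ℝ, ℝ)) (φ : L2R) :
    transl h (phaseMul θ φ) = phaseMul (θ.comp ⟨fun x => x + h, by fun_prop⟩) (transl h φ) := by
  apply Lp.ext
  filter_upwards [coeFn_transl h (phaseMul θ φ), ae_comp_add_right h (coeFn_phaseMul θ φ),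
    coeFn_phaseMul (θ.comp ⟨fun x => x + h, by fun_prop⟩) (transl h φ), coeFn_transl h φ]
    with x h1 h2 h3 h4
  rw [h1, h2, h3, h4]
  rfl

/-- The linear phase `x ↦ a x`. -/
def linPhase (a : ℝ) : C(ℝ, ℝ) := ⟨fun x => a * x, by fun_prop⟩

/-- The phase of the Schrödinger symbol. -/
def quadPhase (t : ℝ) : C(ℝ, ℝ) := ⟨fun k => -(t * (2 * Real.pi * k) ^ 2 / 2), by fun_prop⟩

theorem schrodinger_eq (t : ℝ) (φ : L2R) :
    schrodinger t φ = 𝓕⁻ (phaseMul (quadPhase t) (𝓕 φ)) := by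
  unfold schrodinger
  congr 1
  apply Lp.ext
  refine (MemLp.coeFn_toLp _).trans ?_
  filter_upwards [coeFn_phaseMul (quadPhase t) (𝓕 φ)] with k hk
  rw [hk]
  unfold schrodingerSymbol quadPhase
  simp only [ContinuousMap.coe_mk]
  push_cast
  ring_nf

theorem integrable_schwartz_toLp (f : SchwartzMap ℝ ℂ) : Integrable (f.toLp 2 : L2R) :=
  (f.integrable (μ := volume)).congr (f.coeFn_toLp 2 volume).symm

/-- Schwartz functions are dense and integrable, so an identity between continuous operators need
only be checked where the Plancherel transform is an actual integral. -/
theorem L2R_induction {p : L2R → Prop} (hc : IsClosed {φ | p φ}) (h : ∀ φ : L2R, Integrable φ → p φ)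
    (φ : L2R) : p φ :=
  DenseRange.induction_on (p := p)
    (SchwartzMap.denseRange_toLpCLM (F := ℂ) (E := ℝ) (μ := volume) (p := 2) ENNReal.ofNat_ne_top) φ hc
    fun f => h _ (integrable_schwartz_toLp f)

theorem fourier_transl (h : ℝ) (φ : L2R) :
    𝓕 (transl h φ) = phaseMul (linPhase (2 * Real.pi * h)) (𝓕 φ) := by
  refine L2R_induction (p := fun φ => 𝓕 (transl h φ) = phaseMul (linPhase (2 * Real.pi * h)) (𝓕 φ))
    (isClosed_eq ?_ ?_) ?_ φ
  · exact (Lp.fourierTransformₗᵢ ℝ ℂ).continuous.comp (transl h).continuous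
  · exact (phaseMul _).continuous.comp (Lp.fourierTransformₗᵢ ℝ ℂ).continuous
  intro φ hφ
  apply Lp.ext
  have hi : Integrable (transl h φ) := (hφ.comp_add_right h).congr (coeFn_transl h φ).symm
  filter_upwards [coeFn_fourier_ae_eq _ hi, coeFn_fourier_ae_eq _ hφ,
    coeFn_phaseMul (linPhase (2 * Real.pi * h)) (𝓕 φ)] with k h1 h2 h3
  rw [h1, h3, h2, Real.fourier_congr_ae (coeFn_transl h φ)]
  have := congrFun (VectorFourier.fourierIntegral_comp_add_right Real.fourierChar volume
    (innerₗ ℝ) φ h) k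
  refine Eq.trans this ?_
  rw [Circle.smul_def, Real.fourierChar_apply, smul_eq_mul]
  congr 2
  simp [linPhase]
  ring

theorem fourier_phaseMul_lin (a : ℝ) (φ : L2R) :
    𝓕 (phaseMul (linPhase (2 * Real.pi * a)) φ) = transl (-a) (𝓕 φ) := by
  refine L2R_induction (p := fun φ => 𝓕 (phaseMul (linPhase (2 * Real.pi * a)) φ) = transl (-a) (𝓕 φ))
    (isClosed_eq ?_ ?_) ?_ φ
  · exact (Lp.fourierTransformₗᵢ ℝ ℂ).continuous.comp (phaseMul _).continuous
  · exact (transl _).continuous.comp (Lp.fourierTransformₗᵢ ℝ ℂ).continuous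
  intro φ hφ
  apply Lp.ext
  have hi : Integrable (phaseMul (linPhase (2 * Real.pi * a)) φ) :=
    hφ.mono (Lp.aestronglyMeasurable _) (by
      filter_upwards [coeFn_phaseMul (linPhase (2 * Real.pi * a)) φ] with x hx
      rw [hx, norm_mul, Complex.norm_exp_ofReal_mul_I, one_mul])
  filter_upwards [coeFn_fourier_ae_eq _ hi, ae_comp_add_right (-a) (coeFn_fourier_ae_eq _ hφ),
    coeFn_transl (-a) (𝓕 φ)] with k h1 h2 h3
  rw [h1, h3, h2, Real.fourier_congr_ae (coeFn_phaseMul _ φ), Real.fourier_real_eq_integral_exp_smul,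
    Real.fourier_real_eq_integral_exp_smul]
  congr 1
  ext x
  rw [smul_eq_mul, smul_eq_mul, ← mul_assoc, ← Complex.exp_add]
  congr 2
  simp [linPhase]
  ring

/-! ### Norms and dominated convergence in `L²` -/

theorem L2R_norm_sq (φ : L2R) : ‖φ‖ ^ 2 = ∫ x, ‖φ x‖ ^ 2 := by
  have h := L2.inner_def (𝕜 := ℂ) φ φ
  rw [inner_self_eq_norm_sq_to_K] at h
  have h2 : ∀ x, inner ℂ (φ x) (φ x) = ((‖φ x‖ ^ 2 : ℝ) : ℂ) := fun x => by
    rw [inner_self_eq_norm_sq_to_K]; norm_cast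
  simp_rw [h2] at h
  rw [integral_complex_ofReal] at h
  apply Complex.ofReal_injective
  rw [← h]
  norm_cast

theorem L2R_integrable_sq (φ : L2R) : Integrable (fun x => ‖φ x‖ ^ 2) :=
  (memLp_two_iff_integrable_sq_norm (Lp.aestronglyMeasurable φ)).1 (Lp.memLp φ)

theorem L2R_eLpNorm (φ : L2R) : eLpNorm φ 2 volume = ENNReal.ofReal ‖φ‖ := by
  rw [Lp.norm_def, ENNReal.ofReal_toReal (Lp.eLpNorm_ne_top φ)]

/-- Dominated convergence in `L²`. -/
theorem L2R_tendsto_of_dominated {ι : Type*} {l : Filter ι} [l.IsCountablyGenerated]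
    {F : ι → L2R} {G : L2R} (a : ι → ℝ → ℂ) (b : ℝ → ℂ) (g : ℝ → ℝ) (hg : Integrable g)
    (ha : ∀ i, F i =ᵐ[volume] a i) (hGb : G =ᵐ[volume] b)
    (hb : ∀ᶠ i in l, ∀ᵐ x, ‖a i x - b x‖ ^ 2 ≤ g x)
    (hl : ∀ᵐ x, Tendsto (fun i => a i x) l (𝓝 (b x))) : Tendsto F l (𝓝 G) := by
  rw [tendsto_iff_norm_sub_tendsto_zero]
  have key : Tendsto (fun i => ‖F i - G‖ ^ 2) l (𝓝 0) := by
    have e : ∀ i, ‖F i - G‖ ^ 2 = ∫ x, ‖a i x - b x‖ ^ 2 := fun i => by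
      rw [L2R_norm_sq]
      refine integral_congr_ae ?_
      filter_upwards [Lp.coeFn_sub (F i) G, ha i, hGb] with x hx h1 h2
      rw [hx, Pi.sub_apply, h1, h2]
    simp_rw [e]
    have : (0 : ℝ) = ∫ _x : ℝ, (0 : ℝ) := by simp
    rw [this]
    refine tendsto_integral_filter_of_dominated_convergence g ?_ ?_ hg ?_
    · exact Eventually.of_forall fun i =>
        (((Lp.aestronglyMeasurable (F i)).congr (ha i)).sub
          ((Lp.aestronglyMeasurable G).congr hGb)).norm.pow 2
    · filter_upwards [hb] with i hi
      filter_upwards [hi] with x hx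
      rwa [Real.norm_of_nonneg (by positivity)]
    · filter_upwards [hl] with x hx
      have := ((hx.sub_const (b x)).norm).pow 2
      simpa using this
  have h2 := key.sqrt
  simpa [Real.sqrt_sq] using h2

theorem tendsto_phaseMul {ι : Type*} {l : Filter ι} [l.IsCountablyGenerated]
    {θ : ι → C(ℝ, ℝ)} {η : C(ℝ, ℝ)} (h : ∀ x, Tendsto (fun i => θ i x) l (𝓝 (η x))) (φ : L2R) :
    Tendsto (fun i => phaseMul (θ i) φ) l (𝓝 (phaseMul η φ)) := by
  refine L2R_tendsto_of_dominated _ _ (fun x => (2 * ‖φ x‖) ^ 2) ?_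
    (fun i => coeFn_phaseMul (θ i) φ) (coeFn_phaseMul η φ) ?_ ?_
  · simp_rw [mul_pow]
    exact (L2R_integrable_sq φ).const_mul _
  · refine Eventually.of_forall fun i => Eventually.of_forall fun x => ?_
    gcongr
    refine (norm_sub_le _ _).trans (le_of_eq ?_)
    simp_rw [norm_mul, Complex.norm_exp_ofReal_mul_I]
    ring
  · refine Eventually.of_forall fun x => ?_
    have : Tendsto (fun i => ((θ i x : ℝ) : ℂ)) l (𝓝 (η x : ℂ)) :=
      (Complex.continuous_ofReal.tendsto _).comp (h x)
    exact ((Complex.continuous_exp.tendsto _).comp (this.mul_const _)).mul_const _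

/-! ### The free Schrödinger group and its commutation relations -/

/-- The Schrödinger group as a family of linear isometries. -/
def freeGroup (t : ℝ) : L2R →ₗᵢ[ℂ] L2R :=
  ((Lp.fourierTransformₗᵢ ℝ ℂ).symm.toLinearIsometry.comp (phaseMul (quadPhase t))).comp
    (Lp.fourierTransformₗᵢ ℝ ℂ).toLinearIsometry

theorem schrodinger_eq_freeGroup (t : ℝ) : schrodinger t = freeGroup t := by
  ext1 φ
  exact schrodinger_eq t φ

theorem fourier_freeGroup (t : ℝ) (φ : L2R) :
    𝓕 (freeGroup t φ) = phaseMul (quadPhase t) (𝓕 φ) :=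
  (Lp.fourierTransformₗᵢ ℝ ℂ).apply_symm_apply _

theorem fourier_L2_injective : Function.Injective (fun φ : L2R => (𝓕 φ : L2R)) :=
  (Lp.fourierTransformₗᵢ ℝ ℂ).injective

theorem norm_fourier_L2 (φ : L2R) : ‖(𝓕 φ : L2R)‖ = ‖φ‖ :=
  (Lp.fourierTransformₗᵢ ℝ ℂ).norm_map φ

theorem fourier_L2_sub (φ ψ : L2R) : (𝓕 (φ - ψ) : L2R) = 𝓕 φ - 𝓕 ψ :=
  (Lp.fourierTransformₗᵢ ℝ ℂ).map_sub φ ψ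

theorem fourier_L2_smul (c : ℂ) (φ : L2R) : (𝓕 (c • φ) : L2R) = c • 𝓕 φ :=
  (Lp.fourierTransformₗᵢ ℝ ℂ).map_smul c φ

theorem freeGroup_freeGroup (s t : ℝ) (φ : L2R) :
    freeGroup s (freeGroup t φ) = freeGroup (s + t) φ := by
  apply fourier_L2_injective
  simp only [fourier_freeGroup, phaseMul_phaseMul]
  congr 2
  ext k
  simp [quadPhase]
  ring

theorem freeGroup_zero (φ : L2R) : freeGroup 0 φ = φ := by
  apply fourier_L2_injective
  simp only [fourier_freeGroup]
  have : quadPhase 0 = 0 := by ext k; simp [quadPhase]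
  rw [this, phaseMul_zero]

theorem freeGroup_neg_apply (t : ℝ) (φ : L2R) : freeGroup (-t) (freeGroup t φ) = φ := by
  rw [freeGroup_freeGroup, neg_add_cancel, freeGroup_zero]

theorem freeGroup_apply_neg (t : ℝ) (φ : L2R) : freeGroup t (freeGroup (-t) φ) = φ := by
  rw [freeGroup_freeGroup, add_neg_cancel, freeGroup_zero]

theorem tendsto_freeGroup (t : ℝ) (φ : L2R) :
    Tendsto (fun s => freeGroup s φ) (𝓝 t) (𝓝 (freeGroup t φ)) := by
  refine ((Lp.fourierTransformₗᵢ ℝ ℂ).symm.continuous.tendsto _).comp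
    (tendsto_phaseMul (fun x => ?_) _)
  have : Continuous fun s => quadPhase s x := by
    change Continuous fun s : ℝ => -(s * (2 * Real.pi * x) ^ 2 / 2)
    fun_prop
  exact this.tendsto t

/-- Joint continuity follows from strong continuity because every operator of the group is an
isometry. -/
theorem freeGroup_tendsto {ι : Type*} {l : Filter ι} {t : ι → ℝ} {g : ι → L2R} {t₀ : ℝ} {g₀ : L2R}
    (ht : Tendsto t l (𝓝 t₀)) (hg : Tendsto g l (𝓝 g₀)) :
    Tendsto (fun i => freeGroup (t i) (g i)) l (𝓝 (freeGroup t₀ g₀)) := by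
  have h1 : Tendsto (fun i => freeGroup (t i) (g i - g₀)) l (𝓝 0) := by
    rw [tendsto_zero_iff_norm_tendsto_zero]
    simp_rw [LinearIsometry.norm_map]
    exact tendsto_iff_norm_sub_tendsto_zero.1 hg
  have h2 := h1.add ((tendsto_freeGroup t₀ g₀).comp ht)
  simpa using h2

theorem continuous_freeGroup {X : Type*} [TopologicalSpace X] {t : X → ℝ} {g : X → L2R}
    (ht : Continuous t) (hg : Continuous g) : Continuous fun x => freeGroup (t x) (g x) :=
  continuous_iff_continuousAt.2 fun x => freeGroup_tendsto (ht.tendsto x) (hg.tendsto x)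

theorem freeGroup_transl (t h : ℝ) (φ : L2R) :
    freeGroup t (transl h φ) = transl h (freeGroup t φ) := by
  apply fourier_L2_injective
  simp only [fourier_freeGroup, fourier_transl, phaseMul_phaseMul, add_comm]

/-- The Galilean commutation relation between the free group and the modulations. -/
theorem freeGroup_modulation (t h : ℝ) (φ : L2R) :
    freeGroup t (phaseMul (linPhase h) φ) = phaseMul (linPhase h)
      (transl (-(t * h)) (phaseMul (ContinuousMap.const ℝ (-(t * h ^ 2 / 2))) (freeGroup t φ))) := by
  obtain ⟨a, rfl⟩ : ∃ a, h = 2 * Real.pi * a := ⟨h / (2 * Real.pi), by field_simp⟩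
  have hconst : ∀ (c : ℝ) (ψ : L2R),
      phaseMul (ContinuousMap.const ℝ c) ψ = Complex.exp (c * Complex.I) • ψ := fun c ψ => by
    apply Lp.ext
    filter_upwards [coeFn_phaseMul (ContinuousMap.const ℝ c) ψ,
      Lp.coeFn_smul (Complex.exp (c * Complex.I)) ψ] with x h1 h2
    rw [h1, h2]
    rfl
  -- On the Fourier side the modulation is a shift by `a = h / (2π)`. Expanding the shifted
  -- quadratic phase leaves a linear phase, which is the translation by `-th`, and a constant one.
  apply fourier_L2_injective
  simp only [fourier_freeGroup, fourier_phaseMul_lin, fourier_transl]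
  rw [hconst, fourier_L2_smul, fourier_freeGroup, ← hconst, phaseMul_phaseMul, phaseMul_phaseMul,
    transl_phaseMul]
  have e : ∀ θ ψ, phaseMul θ (transl (-a) ψ) = transl (-a) (phaseMul (θ.comp ⟨fun x => x + a, by fun_prop⟩) ψ) := by
    intro θ ψ
    rw [transl_phaseMul]
    congr 2
    ext x
    simp
  rw [e, transl_phaseMul]
  congr 2
  ext x
  simp [quadPhase, linPhase]
  ring

/-! ### The truncated cubic nonlinearity -/

/-- The cubic nonlinearity `min(|z|, M)² z`, truncated so as to be globally Lipschitz. -/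
def truncCubic (M : ℝ≥0) (z : ℂ) : ℂ := (((min ‖z‖ M) ^ 2 : ℝ) : ℂ) * z

/-- Write the difference so that the change of the coefficient multiplies the smaller argument `a`.
This term vanishes once `‖a‖ ≥ M`; otherwise the difference of squares factors and costs `2M²`. The
remaining term costs `M²`, whence the constant `3M²`. -/
theorem truncCubic_lipschitz (M : ℝ≥0) : LipschitzWith (3 * M ^ 2) (truncCubic M) := by
  have key : ∀ a b : ℂ, ‖a‖ ≤ ‖b‖ → ‖truncCubic M a - truncCubic M b‖ ≤ 3 * M ^ 2 * ‖a - b‖ := by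
    intro a b hab
    have hM : (0 : ℝ) ≤ M := M.2
    have e : truncCubic M a - truncCubic M b = (((min ‖b‖ M) ^ 2 : ℝ) : ℂ) * (a - b)
        - (((min ‖b‖ M) ^ 2 - (min ‖a‖ M) ^ 2 : ℝ) : ℂ) * a := by
      unfold truncCubic; push_cast; ring
    rw [e]
    refine (norm_sub_le _ _).trans ?_
    rw [norm_mul, norm_mul, Complex.norm_real, Complex.norm_real, Real.norm_eq_abs, Real.norm_eq_abs,
      abs_of_nonneg (sq_nonneg _)]
    have h0 : 0 ≤ min ‖b‖ (M : ℝ) := le_min (norm_nonneg _) hM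
    have h0' : 0 ≤ min ‖a‖ (M : ℝ) := le_min (norm_nonneg _) hM
    have h1 : min ‖b‖ (M : ℝ) ^ 2 ≤ M ^ 2 := by gcongr; exact min_le_right _ _
    have h3 : min ‖a‖ (M : ℝ) ≤ min ‖b‖ M := min_le_min_right _ hab
    have h2 : |min ‖b‖ (M : ℝ) ^ 2 - min ‖a‖ (M : ℝ) ^ 2| * ‖a‖ ≤ 2 * M ^ 2 * ‖a - b‖ := by
      rw [abs_of_nonneg (by nlinarith)]
      rcases le_total (M : ℝ) ‖a‖ with h | h
      · rw [min_eq_right h, min_eq_right (h.trans hab), sub_self, zero_mul]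
        positivity
      · rw [min_eq_left h] at h3 ⊢
        have h4 : min ‖b‖ (M : ℝ) - ‖a‖ ≤ ‖a - b‖ := by
          have h5 := norm_sub_norm_le b a
          rw [norm_sub_rev] at h5
          have := min_le_left ‖b‖ (M : ℝ)
          linarith
        have h6 := min_le_right ‖b‖ (M : ℝ)
        have h7 := norm_nonneg a
        have h8 : (min ‖b‖ (M : ℝ) + ‖a‖) * ‖a‖ ≤ 2 * M ^ 2 := by nlinarith
        calc (min ‖b‖ (M : ℝ) ^ 2 - ‖a‖ ^ 2) * ‖a‖
            = (min ‖b‖ (M : ℝ) - ‖a‖) * ((min ‖b‖ (M : ℝ) + ‖a‖) * ‖a‖) := by ring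
          _ ≤ ‖a - b‖ * (2 * M ^ 2) := by
              apply mul_le_mul h4 h8 (by positivity) (norm_nonneg _)
          _ = _ := by ring
    have h4 : min ‖b‖ (M : ℝ) ^ 2 * ‖a - b‖ ≤ M ^ 2 * ‖a - b‖ := by gcongr
    linarith
  refine LipschitzWith.of_dist_le_mul fun a b => ?_
  rw [dist_eq_norm, dist_eq_norm]
  push_cast
  rcases le_total ‖a‖ ‖b‖ with h | h
  · exact key a b h
  · rw [norm_sub_rev, norm_sub_rev a b]
    exact key b a h

theorem truncCubic_zero (M : ℝ≥0) : truncCubic M 0 = 0 := by simp [truncCubic]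

theorem truncCubic_of_le {M : ℝ≥0} {z : ℂ} (h : ‖z‖ ≤ M) :
    truncCubic M z = ((‖z‖ ^ 2 : ℝ) : ℂ) * z := by
  rw [truncCubic, min_eq_left h]

theorem truncCubic_phase (M : ℝ≥0) {c : ℂ} (hc : ‖c‖ = 1) (z : ℂ) :
    truncCubic M (c * z) = c * truncCubic M z := by
  unfold truncCubic
  rw [norm_mul, hc, one_mul]
  ring

/-- On the ball of radius `q` truncating at `M` is the same as truncating at `min q M`. The constant
thus depends on the actual size `q`, so that a decaying `q` makes the Gronwall rate decay too. -/
theorem norm_truncCubic_sub_le (M : ℝ≥0) {q : ℝ} {a b : ℂ} (ha : ‖a‖ ≤ q) (hb : ‖b‖ ≤ q) :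
    ‖truncCubic M a - truncCubic M b‖ ≤ 3 * q ^ 2 * ‖a - b‖ := by
  have hq : 0 ≤ q := (norm_nonneg a).trans ha
  lift q to ℝ≥0 using hq
  have e : ∀ z : ℂ, ‖z‖ ≤ q → truncCubic M z = truncCubic (min q M) z := fun z hz => by
    unfold truncCubic
    rw [NNReal.coe_min, ← min_assoc, min_eq_left hz]
  rw [e a ha, e b hb]
  have h := (truncCubic_lipschitz (min q M)).dist_le_mul a b
  rw [dist_eq_norm, dist_eq_norm] at h
  refine h.trans ?_
  push_cast
  gcongr
  exact min_le_left _ _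

/-- The truncated cubic nonlinearity on `L²`. -/
def nl (M : ℝ≥0) (φ : L2R) : L2R := (truncCubic_lipschitz M).compLp (truncCubic_zero M) φ

theorem coeFn_nl (M : ℝ≥0) (φ : L2R) : nl M φ =ᵐ[volume] fun x => truncCubic M (φ x) :=
  (truncCubic_lipschitz M).coeFn_compLp (truncCubic_zero M) φ

theorem nl_lipschitz (M : ℝ≥0) : LipschitzWith (3 * M ^ 2) (nl M) :=
  (truncCubic_lipschitz M).lipschitzWith_compLp (truncCubic_zero M)

theorem nl_zero (M : ℝ≥0) : nl M 0 = 0 :=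
  (truncCubic_lipschitz M).compLp_zero (truncCubic_zero M)

theorem nl_phaseMul (M : ℝ≥0) (θ : C(ℝ, ℝ)) (φ : L2R) :
    nl M (phaseMul θ φ) = phaseMul θ (nl M φ) := by
  apply Lp.ext
  filter_upwards [coeFn_nl M (phaseMul θ φ), coeFn_phaseMul θ φ, coeFn_phaseMul θ (nl M φ),
    coeFn_nl M φ] with x h1 h2 h3 h4
  rw [h1, h2, h3, h4, truncCubic_phase M (Complex.norm_exp_ofReal_mul_I _)]

theorem nl_transl (M : ℝ≥0) (h : ℝ) (φ : L2R) : nl M (transl h φ) = transl h (nl M φ) := by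
  apply Lp.ext
  filter_upwards [coeFn_nl M (transl h φ), coeFn_transl h φ, coeFn_transl h (nl M φ),
    ae_comp_add_right h (coeFn_nl M φ)] with x h1 h2 h3 h4
  rw [h1, h2, h3, h4]

theorem nl_neg (M : ℝ≥0) (φ : L2R) : nl M (-φ) = -nl M φ := by
  apply Lp.ext
  filter_upwards [coeFn_nl M (-φ), Lp.coeFn_neg φ, Lp.coeFn_neg (nl M φ), coeFn_nl M φ]
    with x h1 h2 h3 h4
  rw [h1, h2, h3, Pi.neg_apply, Pi.neg_apply, h4, truncCubic, truncCubic, norm_neg, mul_neg]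

theorem norm_nl_sub_le (M : ℝ≥0) {q : ℝ} {φ ψ : L2R} (hφ : ∀ᵐ x, ‖φ x‖ ≤ q)
    (hψ : ∀ᵐ x, ‖ψ x‖ ≤ q) : ‖nl M φ - nl M ψ‖ ≤ 3 * q ^ 2 * ‖φ - ψ‖ := by
  refine Lp.norm_le_mul_norm_of_ae_le_mul ?_
  filter_upwards [hφ, hψ, Lp.coeFn_sub (nl M φ) (nl M ψ), Lp.coeFn_sub φ ψ, coeFn_nl M φ,
    coeFn_nl M ψ] with x h1 h2 h3 h4 h5 h6
  rw [h3, h4, Pi.sub_apply, Pi.sub_apply, h5, h6]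
  exact norm_truncCubic_sub_le M h1 h2

/-! ### Symmetries and the vector field of the interaction picture -/

/-- Symmetries of the nonlinear Schrödinger flow in the interaction picture. -/
def IsSymm (R : L2R →ₗᵢ[ℂ] L2R) : Prop :=
  ∀ t, ∃ U : L2R →ₗᵢ[ℂ] L2R, (∀ φ, freeGroup t (R φ) = U (freeGroup t φ)) ∧
    (∀ M φ, nl M (U φ) = U (nl M φ)) ∧ ∀ φ q, (∀ᵐ x, ‖φ x‖ ≤ q) → ∀ᵐ x, ‖U φ x‖ ≤ q

theorem ae_bound_phaseMul (θ : C(ℝ, ℝ)) {φ : L2R} {q : ℝ} (h : ∀ᵐ x, ‖φ x‖ ≤ q) :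
    ∀ᵐ x, ‖phaseMul θ φ x‖ ≤ q := by
  filter_upwards [h, coeFn_phaseMul θ φ] with x h1 h2
  rwa [h2, norm_mul, Complex.norm_exp_ofReal_mul_I, one_mul]

theorem ae_bound_transl (a : ℝ) {φ : L2R} {q : ℝ} (h : ∀ᵐ x, ‖φ x‖ ≤ q) :
    ∀ᵐ x, ‖transl a φ x‖ ≤ q := by
  filter_upwards [ae_comp_add_right a h, coeFn_transl a φ] with x h1 h2
  rwa [h2]

/-- The isometry `φ ↦ -φ`. -/
def negIsom : L2R →ₗᵢ[ℂ] L2R := (LinearIsometryEquiv.neg ℂ).toLinearIsometry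

theorem negIsom_apply (φ : L2R) : negIsom φ = -φ := rfl

theorem isSymm_neg : IsSymm negIsom := fun t =>
  ⟨negIsom, fun φ => by simp [negIsom_apply], fun M φ => by simp [negIsom_apply, nl_neg],
    fun φ q h => by
      filter_upwards [h, Lp.coeFn_neg φ] with x h1 h2
      rwa [negIsom_apply, h2, Pi.neg_apply, norm_neg]⟩

theorem isSymm_transl (h : ℝ) : IsSymm (transl h) := fun t =>
  ⟨transl h, fun φ => freeGroup_transl t h φ, fun M φ => nl_transl M h φ,
    fun _ _ hφ => ae_bound_transl h hφ⟩

theorem isSymm_modulation (h : ℝ) : IsSymm (phaseMul (linPhase h)) := fun t =>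
  ⟨(phaseMul (linPhase h)).comp ((transl (-(t * h))).comp
      (phaseMul (ContinuousMap.const ℝ (-(t * h ^ 2 / 2))))),
    fun φ => freeGroup_modulation t h φ,
    fun M φ => by simp [nl_phaseMul, nl_transl],
    fun _ _ hφ => ae_bound_phaseMul _ (ae_bound_transl _ (ae_bound_phaseMul _ hφ))⟩

/-- The nonlinear Schrödinger vector field in the interaction picture. -/
def nlsField (M : ℝ≥0) (t : ℝ) (φ : L2R) : L2R :=
  (-Complex.I) • freeGroup (-t) (nl M (freeGroup t φ))

theorem nlsField_lipschitz (M : ℝ≥0) (t : ℝ) : LipschitzWith (3 * M ^ 2) (nlsField M t) := by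
  refine LipschitzWith.of_dist_le_mul fun φ ψ => ?_
  have h := (nl_lipschitz M).dist_le_mul (freeGroup t φ) (freeGroup t ψ)
  rw [dist_eq_norm, dist_eq_norm, ← map_sub, LinearIsometry.norm_map] at h
  rw [dist_eq_norm, dist_eq_norm, nlsField, nlsField, ← smul_sub, ← map_sub, norm_smul, norm_neg,
    Complex.norm_I, one_mul, LinearIsometry.norm_map]
  exact h

theorem nlsField_zero (M : ℝ≥0) (t : ℝ) : nlsField M t 0 = 0 := by
  simp [nlsField, nl_zero]

theorem continuous_nlsField (M : ℝ≥0) {g : ℝ → L2R} (hg : Continuous g) :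
    Continuous fun t => nlsField M t (g t) :=
  Continuous.const_smul (continuous_freeGroup continuous_neg
    ((nl_lipschitz M).continuous.comp (continuous_freeGroup continuous_id hg))) (-Complex.I)

theorem nlsField_symm {R : L2R →ₗᵢ[ℂ] L2R} (hR : IsSymm R) (M : ℝ≥0) (t : ℝ) (φ : L2R) :
    nlsField M t (R φ) = R (nlsField M t φ) := by
  obtain ⟨U, h1, h2, -⟩ := hR t
  have h3 : R (freeGroup (-t) (nl M (freeGroup t φ))) = freeGroup (-t) (U (nl M (freeGroup t φ))) := by
    rw [← freeGroup_neg_apply t (R _), h1, freeGroup_apply_neg]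
  rw [nlsField, nlsField, map_smul, h3, h1, h2]

/-- The symmetry moves `R` inside the field. The free evolutions of `R φ` and `φ` are then both
bounded by `q`, so the local Lipschitz constant `3q²` applies. -/
theorem norm_nlsField_symm_sub_le {R : L2R →ₗᵢ[ℂ] L2R} (hR : IsSymm R) (M : ℝ≥0) (t : ℝ) {φ : L2R}
    {q : ℝ} (hq : ∀ᵐ x, ‖freeGroup t φ x‖ ≤ q) :
    ‖R (nlsField M t φ) - nlsField M t φ‖ ≤ 3 * q ^ 2 * ‖R φ - φ‖ := by
  rw [← nlsField_symm hR]
  obtain ⟨U, h1, h2, h3⟩ := hR t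
  have h := norm_nl_sub_le M (h3 _ q hq) hq
  rw [nlsField, nlsField, ← smul_sub, ← map_sub, norm_smul, norm_neg, Complex.norm_I, one_mul,
    LinearIsometry.norm_map, h1]
  refine h.trans (le_of_eq ?_)
  rw [← h1, ← map_sub, LinearIsometry.norm_map]

theorem norm_nlsField_symm_sub_le' {R : L2R →ₗᵢ[ℂ] L2R} (hR : IsSymm R) (M : ℝ≥0) (t : ℝ) (φ : L2R) :
    ‖R (nlsField M t φ) - nlsField M t φ‖ ≤ 3 * M ^ 2 * ‖R φ - φ‖ := by
  rw [← nlsField_symm hR]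
  simpa [dist_eq_norm] using (nlsField_lipschitz M t).dist_le_mul (R φ) φ

/-! ### The norm of `H^{1,0} ∩ H^{0,1}` through difference quotients -/

/-- The symmetries that generate the norm of `H^{1,0} ∩ H^{0,1}`, with their sizes. -/
inductive SigmaSymm : (L2R →ₗᵢ[ℂ] L2R) → ℝ → Prop
  | neg : SigmaSymm negIsom 2
  | transl (h : ℝ) : SigmaSymm (transl h) |h|
  | modulation (h : ℝ) : SigmaSymm (phaseMul (linPhase h)) |h|

theorem SigmaSymm.isSymm {R : L2R →ₗᵢ[ℂ] L2R} {w : ℝ} (h : SigmaSymm R w) : IsSymm R := by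
  cases h
  · exact isSymm_neg
  · exact isSymm_transl _
  · exact isSymm_modulation _

theorem SigmaSymm.nonneg {R : L2R →ₗᵢ[ℂ] L2R} {w : ℝ} (h : SigmaSymm R w) : 0 ≤ w := by
  cases h
  · norm_num
  · exact abs_nonneg _
  · exact abs_nonneg _

/-- `φ` is bounded by `K` in `H^{1,0} ∩ H^{0,1}`, expressed by difference quotients. -/
def SigmaBound (φ : L2R) (K : ℝ) : Prop := ∀ R w, SigmaSymm R w → ‖R φ - φ‖ ≤ w * K

theorem SigmaBound.norm_le {φ : L2R} {K : ℝ} (h : SigmaBound φ K) : ‖φ‖ ≤ K := by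
  have := h _ _ SigmaSymm.neg
  rw [negIsom_apply, ← norm_neg, neg_sub, sub_neg_eq_add, ← two_smul ℝ, norm_smul] at this
  norm_num at this
  exact this

theorem SigmaBound.nonneg {φ : L2R} {K : ℝ} (h : SigmaBound φ K) : 0 ≤ K :=
  (norm_nonneg _).trans h.norm_le

theorem SigmaBound.mono {φ : L2R} {K K' : ℝ} (h : SigmaBound φ K) (hK : K ≤ K') :
    SigmaBound φ K' := fun R w hR =>
  (h R w hR).trans (mul_le_mul_of_nonneg_left hK hR.nonneg)

theorem norm_exp_mul_I_sub_one_le (y : ℝ) : ‖Complex.exp (y * Complex.I) - 1‖ ≤ |y| := by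
  rw [mul_comm]
  exact Real.norm_exp_I_mul_ofReal_sub_one_le

theorem norm_modulation_sub_le {φ : L2R} {K : ℝ} (hK : 0 ≤ K)
    (h : eLpNorm (fun x : ℝ => (x : ℂ) * φ x) 2 volume ≤ ENNReal.ofReal K) (a : ℝ) :
    ‖phaseMul (linPhase a) φ - φ‖ ≤ |a| * K := by
  have h1 : eLpNorm (phaseMul (linPhase a) φ - φ : L2R) 2 volume
      ≤ ENNReal.ofReal |a| * eLpNorm (fun x : ℝ => (x : ℂ) * φ x) 2 volume := by
    refine eLpNorm_le_mul_eLpNorm_of_ae_le_mul ?_ 2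
    filter_upwards [Lp.coeFn_sub (phaseMul (linPhase a) φ) φ, coeFn_phaseMul (linPhase a) φ]
      with x h1 h2
    rw [h1, Pi.sub_apply, h2, norm_mul, ← mul_assoc]
    have e : Complex.exp (linPhase a x * Complex.I) * φ x - φ x
        = (Complex.exp (linPhase a x * Complex.I) - 1) * φ x := by ring
    rw [e, norm_mul, Complex.norm_real, Real.norm_eq_abs, ← abs_mul]
    gcongr
    exact norm_exp_mul_I_sub_one_le _
  rw [L2R_eLpNorm] at h1
  have h2 := h1.trans (mul_le_mul_right h (ENNReal.ofReal |a|))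
  rw [← ENNReal.ofReal_mul (abs_nonneg a)] at h2
  exact (ENNReal.ofReal_le_ofReal_iff (by positivity)).1 h2

theorem tendsto_modulation_quotient (x : ℝ) {ι : Type*} {l : Filter ι} {h : ι → ℝ}
    (hl : Tendsto h l (𝓝[≠] 0)) :
    Tendsto (fun i => ((h i : ℝ) : ℂ)⁻¹ * (Complex.exp (linPhase (h i) x * Complex.I) - 1)) l
      (𝓝 (Complex.I * x)) := by
  have hd : HasDerivAt (fun h : ℝ => Complex.exp ((h : ℂ) * (x * Complex.I)))
      (Complex.exp (((0 : ℝ) : ℂ) * (x * Complex.I)) * (1 * (x * Complex.I))) 0 :=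
    (HasDerivAt.mul_const (Complex.ofRealCLM.hasDerivAt (x := (0 : ℝ))) _).cexp
  have h2 := hd.tendsto_slope_zero.comp hl
  simp only [Complex.ofReal_zero, zero_mul, Complex.exp_zero, one_mul, zero_add] at h2
  rw [mul_comm Complex.I]
  refine h2.congr fun i => ?_
  simp only [Function.comp_apply, linPhase, ContinuousMap.coe_mk, Complex.real_smul,
    Complex.ofReal_inv]
  push_cast
  ring_nf

/-- The quotients `(e^{iax} - 1) φ / a` tend to `ixφ` pointwise, and Fatou's lemma passes the bound
to the limit. The bounds `b n` may vary because commuting a modulation with the free group leaves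
errors that vanish only as the step tends to zero. -/
theorem eLpNorm_id_mul_le_of_tendsto {φ : L2R} {K : ℝ} {b : ℕ → ℝ} (hb : Tendsto b atTop (𝓝 K))
    (h : ∀ n : ℕ, ‖phaseMul (linPhase (1 / ((n : ℝ) + 1))) φ - φ‖ ≤ 1 / ((n : ℝ) + 1) * b n) :
    eLpNorm (fun x : ℝ => (x : ℂ) * φ x) 2 volume ≤ ENNReal.ofReal K := by
  set s : ℕ → ℝ := fun n => 1 / ((n : ℝ) + 1) with hs
  have hs0 : ∀ n, 0 < s n := fun n => by positivity
  have hsl : Tendsto s atTop (𝓝[≠] 0) :=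
    tendsto_nhdsWithin_iff.2 ⟨tendsto_one_div_add_atTop_nhds_zero_nat,
      Eventually.of_forall fun n => (hs0 n).ne'⟩
  set F : ℕ → L2R := fun n => ((s n : ℝ) : ℂ)⁻¹ • (phaseMul (linPhase (s n)) φ - φ) with hF
  have hlim : ∀ᵐ x, Tendsto (fun n => F n x) atTop (𝓝 (Complex.I * x * φ x)) := by
    have h1 : ∀ᵐ x, ∀ n, F n x
        = ((s n : ℝ) : ℂ)⁻¹ * (Complex.exp (linPhase (s n) x * Complex.I) - 1) * φ x := by
      refine ae_all_iff.2 fun n => ?_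
      filter_upwards [Lp.coeFn_smul ((s n : ℝ) : ℂ)⁻¹ (phaseMul (linPhase (s n)) φ - φ),
        Lp.coeFn_sub (phaseMul (linPhase (s n)) φ) φ, coeFn_phaseMul (linPhase (s n)) φ]
        with x h1 h2 h3
      rw [hF, h1, Pi.smul_apply, h2, Pi.sub_apply, h3, smul_eq_mul]
      ring
    filter_upwards [h1] with x hx
    simp_rw [hx]
    exact (tendsto_modulation_quotient x hsl).mul_const _
  have h2 := Lp.eLpNorm_lim_le_liminf_eLpNorm (p := 2) (fun n => Lp.aestronglyMeasurable (F n)) _ hlim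
  have h3 : eLpNorm (fun x : ℝ => (x : ℂ) * φ x) 2 volume
      = eLpNorm (fun x : ℝ => Complex.I * x * φ x) 2 volume := by
    refine eLpNorm_congr_norm_ae (Eventually.of_forall fun x => ?_)
    simp
  rw [h3]
  refine h2.trans ?_
  have h4 : ∀ n, eLpNorm (F n) 2 volume ≤ ENNReal.ofReal (b n) := fun n => by
    rw [L2R_eLpNorm]
    apply ENNReal.ofReal_le_ofReal
    rw [hF, norm_smul, norm_inv, Complex.norm_real, Real.norm_of_nonneg (hs0 n).le,
      inv_mul_le_iff₀ (hs0 n)]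
    exact h n
  calc liminf (fun n => eLpNorm (F n) 2 volume) atTop
      ≤ liminf (fun n => ENNReal.ofReal (b n)) atTop :=
        liminf_le_liminf (Eventually.of_forall h4)
    _ = _ := ((ENNReal.continuous_ofReal.tendsto K).comp hb).liminf_eq

theorem eLpNorm_id_mul_le {φ : L2R} {K : ℝ}
    (h : ∀ a, ‖phaseMul (linPhase a) φ - φ‖ ≤ |a| * K) :
    eLpNorm (fun x : ℝ => (x : ℂ) * φ x) 2 volume ≤ ENNReal.ofReal K := by
  refine eLpNorm_id_mul_le_of_tendsto (b := fun _ => K) tendsto_const_nhds fun n => ?_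
  have := h (1 / ((n : ℝ) + 1))
  rwa [abs_of_pos (by positivity)] at this

theorem phaseMul_fourier_sub (a : ℝ) (φ : L2R) :
    ‖phaseMul (linPhase (2 * Real.pi * a)) (𝓕 φ) - 𝓕 φ‖ = ‖transl a φ - φ‖ := by
  rw [← fourier_transl, ← fourier_L2_sub, norm_fourier_L2]

theorem SigmaBound.eLpNorm_id_mul_le {φ : L2R} {K : ℝ} (h : SigmaBound φ K) :
    eLpNorm (fun x : ℝ => (x : ℂ) * φ x) 2 volume ≤ ENNReal.ofReal K :=
  _root_.eLpNorm_id_mul_le fun a => h _ _ (SigmaSymm.modulation a)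

theorem eLpNorm_id_mul_fourier_le {φ : L2R} {K : ℝ} (h : ∀ a, ‖transl a φ - φ‖ ≤ |a| * K) :
    eLpNorm (fun x : ℝ => (x : ℂ) * (𝓕 φ : L2R) x) 2 volume
      ≤ ENNReal.ofReal (K / (2 * Real.pi)) := by
  refine eLpNorm_id_mul_le fun a => ?_
  obtain ⟨b, rfl⟩ : ∃ b, a = 2 * Real.pi * b := ⟨a / (2 * Real.pi), by field_simp⟩
  rw [phaseMul_fourier_sub]
  refine (h b).trans (le_of_eq ?_)
  rw [abs_mul, abs_of_pos Real.two_pi_pos]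
  field_simp

theorem SigmaBound.eLpNorm_id_mul_fourier_le {φ : L2R} {K : ℝ} (h : SigmaBound φ K) :
    eLpNorm (fun x : ℝ => (x : ℂ) * (𝓕 φ : L2R) x) 2 volume
      ≤ ENNReal.ofReal (K / (2 * Real.pi)) :=
  _root_.eLpNorm_id_mul_fourier_le fun a => h _ _ (SigmaSymm.transl a)

theorem SigmaBound.of_eLpNorm {φ : L2R} {K : ℝ} (h0 : ‖φ‖ ≤ K)
    (h1 : eLpNorm (fun x : ℝ => (x : ℂ) * φ x) 2 volume ≤ ENNReal.ofReal K)
    (h2 : eLpNorm (fun x : ℝ => (x : ℂ) * (𝓕 φ : L2R) x) 2 volume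
      ≤ ENNReal.ofReal (K / (2 * Real.pi))) : SigmaBound φ K := by
  have hK : 0 ≤ K := (norm_nonneg _).trans h0
  intro R w hR
  cases hR with
  | neg =>
    rw [negIsom_apply, ← norm_neg, neg_sub, sub_neg_eq_add, ← two_smul ℝ, norm_smul,
      Real.norm_of_nonneg zero_le_two]
    gcongr
  | transl a =>
    rw [← phaseMul_fourier_sub]
    refine (norm_modulation_sub_le (by positivity) h2 _).trans (le_of_eq ?_)
    rw [abs_mul, abs_of_pos Real.two_pi_pos]
    field_simp
  | modulation a => exact norm_modulation_sub_le hK h1 a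

/-- The `L²`-invariant dilation passes between the frequency `ξ` and the Plancherel variable `k = ξ
/ (2π)`. -/
theorem eLpNorm_comp_div (g : ℝ → ℂ) {a : ℝ} (ha : 0 < a) :
    eLpNorm (fun ξ => ((Real.sqrt a)⁻¹ : ℂ) * g (ξ / a)) 2 volume = eLpNorm g 2 volume := by
  have hemb : MeasurableEmbedding (fun ξ : ℝ => ξ / a) :=
    (Homeomorph.mulRight₀ a⁻¹ (inv_ne_zero ha.ne')).measurableEmbedding
  have h1 : eLpNorm (fun ξ => g (ξ / a)) 2 volume
      = ENNReal.ofReal (Real.sqrt a) * eLpNorm g 2 volume := by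
    have := hemb.eLpNorm_map_measure (g := g) (p := 2) (μ := volume)
    rw [Function.comp_def] at this
    rw [← this]
    have e : Measure.map (fun ξ : ℝ => ξ / a) volume = ENNReal.ofReal a • volume := by
      have := Real.map_volume_mul_right (inv_ne_zero ha.ne')
      simp_rw [div_eq_mul_inv]
      rw [this, inv_inv, abs_of_pos ha]
    rw [e, eLpNorm_smul_measure_of_ne_top ENNReal.ofNat_ne_top, smul_eq_mul]
    congr 1
    rw [Real.sqrt_eq_rpow, ← ENNReal.ofReal_rpow_of_pos ha]
    norm_num
  have h2 : (fun ξ => ((Real.sqrt a)⁻¹ : ℂ) * g (ξ / a))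
      = ((Real.sqrt a)⁻¹ : ℂ) • (fun ξ => g (ξ / a)) := rfl
  rw [h2, eLpNorm_const_smul, h1, ← mul_assoc]
  have h3 : ‖((Real.sqrt a)⁻¹ : ℂ)‖ₑ = ENNReal.ofReal (Real.sqrt a)⁻¹ := by
    rw [← ofReal_norm, norm_inv, Complex.norm_real,
      Real.norm_of_nonneg (Real.sqrt_nonneg _)]
  rw [h3, ← ENNReal.ofReal_mul (by positivity), inv_mul_cancel₀ (Real.sqrt_pos.2 ha).ne']
  simp

theorem normH10_eq (φ : L2R) : normH10 φ
    = eLpNorm (fun k : ℝ => (Real.sqrt (1 + (2 * Real.pi * k) ^ 2) : ℂ) * (𝓕 φ : L2R) k) 2 volume := by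
  rw [← eLpNorm_comp_div _ Real.two_pi_pos, normH10]
  congr 1
  ext ξ
  unfold fourierL2
  have : 2 * Real.pi * (ξ / (2 * Real.pi)) = ξ := by field_simp
  rw [this]
  ring

theorem norm_sqrt_weight (y : ℝ) : ‖(Real.sqrt (1 + y ^ 2) : ℂ)‖ = Real.sqrt (1 + y ^ 2) := by
  rw [Complex.norm_real, Real.norm_of_nonneg (Real.sqrt_nonneg _)]

theorem eLpNorm_weight_le (φ : L2R) (c : ℝ) (hc : 0 ≤ c) :
    eLpNorm (fun x : ℝ => (Real.sqrt (1 + (c * x) ^ 2) : ℂ) * φ x) 2 volume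
      ≤ eLpNorm φ 2 volume + ENNReal.ofReal c * eLpNorm (fun x : ℝ => (x : ℂ) * φ x) 2 volume := by
  have hm : AEStronglyMeasurable (fun x : ℝ => (x : ℂ) * φ x) volume :=
    (Continuous.aestronglyMeasurable (by fun_prop)).mul (Lp.aestronglyMeasurable φ)
  have e1 : ENNReal.ofReal c * eLpNorm (fun x : ℝ => (x : ℂ) * φ x) 2 volume
      = eLpNorm ((c : ℂ) • fun x : ℝ => (x : ℂ) * φ x) 2 volume := by
    rw [eLpNorm_const_smul, ← ofReal_norm, Complex.norm_real, Real.norm_of_nonneg hc]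
  rw [e1, ← eLpNorm_norm φ, ← eLpNorm_norm ((c : ℂ) • fun x : ℝ => (x : ℂ) * φ x)]
  refine le_trans (eLpNorm_mono_real (g := fun x => ‖φ x‖ + ‖((c : ℂ) • fun x : ℝ => (x : ℂ) * φ x) x‖)
    fun x => ?_) (eLpNorm_add_le (Lp.aestronglyMeasurable φ).norm (hm.const_smul _).norm one_le_two)
  rw [norm_mul, norm_sqrt_weight, Pi.smul_apply, smul_eq_mul, norm_mul, norm_mul, Complex.norm_real,
    Complex.norm_real, ← mul_assoc, ← norm_mul, ← one_add_mul]
  gcongr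
  refine Real.sqrt_le_iff.2 ⟨by positivity, ?_⟩
  have := sq_abs (c * x)
  rw [Real.norm_eq_abs]
  nlinarith [abs_nonneg (c * x)]

theorem SigmaBound.normSigma_le {φ : L2R} {K : ℝ} (h : SigmaBound φ K) :
    normSigma φ ≤ ENNReal.ofReal (4 * K) := by
  have hK := h.nonneg
  have hn : eLpNorm φ 2 volume ≤ ENNReal.ofReal K := by
    rw [L2R_eLpNorm]; exact ENNReal.ofReal_le_ofReal h.norm_le
  have h1 : normH10 φ ≤ ENNReal.ofReal K + ENNReal.ofReal K := by
    rw [normH10_eq]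
    refine (eLpNorm_weight_le (𝓕 φ) (2 * Real.pi) Real.two_pi_pos.le).trans ?_
    refine add_le_add ?_ ?_
    · rwa [L2R_eLpNorm, norm_fourier_L2, ← L2R_eLpNorm]
    · refine (mul_le_mul_right h.eLpNorm_id_mul_fourier_le _).trans (le_of_eq ?_)
      rw [← ENNReal.ofReal_mul Real.two_pi_pos.le]
      congr 1
      field_simp
  have h2 : normH01 φ ≤ ENNReal.ofReal K + ENNReal.ofReal K := by
    have := eLpNorm_weight_le φ 1 zero_le_one
    simp only [one_mul, ENNReal.ofReal_one] at this
    exact this.trans (add_le_add hn h.eLpNorm_id_mul_le)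
  refine (add_le_add h1 h2).trans (le_of_eq ?_)
  rw [← ENNReal.ofReal_add hK hK, ← ENNReal.ofReal_add (by positivity) (by positivity)]
  ring_nf

theorem eLpNorm_le_weight (φ : L2R) (c : ℝ) : eLpNorm φ 2 volume
    ≤ eLpNorm (fun x : ℝ => (Real.sqrt (1 + (c * x) ^ 2) : ℂ) * φ x) 2 volume := by
  refine eLpNorm_mono fun x => ?_
  rw [norm_mul, norm_sqrt_weight]
  exact le_mul_of_one_le_left (norm_nonneg _) (Real.one_le_sqrt.2 (by nlinarith [sq_nonneg (c * x)]))

theorem eLpNorm_id_mul_le_weight (φ : L2R) (c : ℝ) (hc : 0 ≤ c) :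
    ENNReal.ofReal c * eLpNorm (fun x : ℝ => (x : ℂ) * φ x) 2 volume
    ≤ eLpNorm (fun x : ℝ => (Real.sqrt (1 + (c * x) ^ 2) : ℂ) * φ x) 2 volume := by
  have e1 : ENNReal.ofReal c * eLpNorm (fun x : ℝ => (x : ℂ) * φ x) 2 volume
      = eLpNorm ((c : ℂ) • fun x : ℝ => (x : ℂ) * φ x) 2 volume := by
    rw [eLpNorm_const_smul, ← ofReal_norm, Complex.norm_real, Real.norm_of_nonneg hc]
  rw [e1]
  refine eLpNorm_mono fun x => ?_
  rw [norm_mul, norm_sqrt_weight, Pi.smul_apply, smul_eq_mul, norm_mul, norm_mul, Complex.norm_real,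
    Complex.norm_real, ← mul_assoc, ← norm_mul]
  gcongr
  refine Real.le_sqrt_of_sq_le ?_
  rw [Real.norm_eq_abs, sq_abs]
  linarith

theorem normH01_eq (φ : L2R) : normH01 φ
    = eLpNorm (fun x : ℝ => (Real.sqrt (1 + (1 * x) ^ 2) : ℂ) * φ x) 2 volume := by
  simp only [one_mul]; rfl

theorem eLpNorm_le_normH01 (φ : L2R) : eLpNorm φ 2 volume ≤ normH01 φ := by
  rw [normH01_eq]; exact eLpNorm_le_weight φ 1

theorem SigmaBound.of_normSigma {φ : L2R} {ε : ℝ} (hε : 0 ≤ ε)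
    (h : normSigma φ ≤ ENNReal.ofReal ε) : SigmaBound φ ε := by
  have h1 : normH10 φ ≤ ENNReal.ofReal ε := (self_le_add_right _ _).trans h
  have h2 : normH01 φ ≤ ENNReal.ofReal ε := (self_le_add_left _ _).trans h
  refine SigmaBound.of_eLpNorm ?_ ?_ ?_
  · have := (eLpNorm_le_normH01 φ).trans h2
    rw [L2R_eLpNorm] at this
    exact (ENNReal.ofReal_le_ofReal_iff hε).1 this
  · rw [normH01_eq] at h2
    have := (eLpNorm_id_mul_le_weight φ 1 zero_le_one).trans h2
    simpa using this
  · rw [normH10_eq] at h1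
    have := (eLpNorm_id_mul_le_weight (𝓕 φ) (2 * Real.pi) Real.two_pi_pos.le).trans h1
    rw [ENNReal.ofReal_div_of_pos Real.two_pi_pos, ENNReal.le_div_iff_mul_le (by simp [Real.pi_pos])
      (by simp), mul_comm]
    exact this

/-! ### The weighted `L¹` bound -/

/-- The constant in the weighted `L¹` bound. -/
def weightConst : ℝ :=
  1 + 2 * (eLpNorm (fun x : ℝ => (1 + x ^ 2 : ℝ) ^ (-3 / 8 : ℝ)) 2 volume).toReal

theorem one_le_weightConst : 1 ≤ weightConst := by
  unfold weightConst
  have : 0 ≤ (eLpNorm (fun x : ℝ => (1 + x ^ 2 : ℝ) ^ (-3 / 8 : ℝ)) 2 volume).toReal :=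
    ENNReal.toReal_nonneg
  linarith

/-- The square decays like `|x|^{-3/2}`. In Cauchy–Schwarz against `⟨x⟩φ` the exponent `-3/8` leaves
the spare weight `(1 + x²)^{1/8}`, which later pays for every factor `|t|^{-1/8}`. -/
theorem memLp_weight : MemLp (fun x : ℝ => (1 + x ^ 2 : ℝ) ^ (-3 / 8 : ℝ)) 2 volume := by
  rw [memLp_two_iff_integrable_sq]
  · have h := integrable_rpow_neg_one_add_norm_sq (E := ℝ) (μ := volume) (r := 3 / 2) (by
      rw [Module.finrank_self]; norm_num)
    refine h.congr (Eventually.of_forall fun x => ?_)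
    simp only [Real.norm_eq_abs, sq_abs]
    rw [← Real.rpow_mul_natCast (by positivity)]
    norm_num
  · refine Continuous.aestronglyMeasurable ?_
    refine Continuous.rpow_const (by fun_prop) fun x => Or.inl (by positivity)

/-- Weighted `L¹` bound for functions in `H^{0,1}`. -/
theorem weighted_L1 {φ : L2R} {K : ℝ} (h0 : ‖φ‖ ≤ K)
    (h1 : eLpNorm (fun x : ℝ => (x : ℂ) * φ x) 2 volume ≤ ENNReal.ofReal K) :
    Integrable (fun x : ℝ => (1 + x ^ 2 : ℝ) ^ (1 / 8 : ℝ) * ‖φ x‖) ∧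
    ∫ x : ℝ, (1 + x ^ 2 : ℝ) ^ (1 / 8 : ℝ) * ‖φ x‖ ≤ weightConst * K := by
  have hK : 0 ≤ K := (norm_nonneg _).trans h0
  set g : ℝ → ℂ := fun x => (Real.sqrt (1 + (1 * x) ^ 2) : ℂ) * φ x with hg
  set ω : ℝ → ℝ := fun x : ℝ => (1 + x ^ 2 : ℝ) ^ (-3 / 8 : ℝ) with hω
  have hgm : AEStronglyMeasurable g volume :=
    (Continuous.aestronglyMeasurable (by fun_prop)).mul (Lp.aestronglyMeasurable φ)
  have hgn : eLpNorm g 2 volume ≤ ENNReal.ofReal (2 * K) := by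
    refine (eLpNorm_weight_le φ 1 zero_le_one).trans ?_
    rw [two_mul, ENNReal.ofReal_add hK hK, ENNReal.ofReal_one, one_mul]
    refine add_le_add ?_ h1
    rw [L2R_eLpNorm]
    exact ENNReal.ofReal_le_ofReal h0
  have hgL : MemLp g 2 volume := ⟨hgm, hgn.trans_lt ENNReal.ofReal_lt_top⟩
  have hmul : ∀ x, ‖(ω • g) x‖ = (1 + x ^ 2 : ℝ) ^ (1 / 8 : ℝ) * ‖φ x‖ := fun x => by
    have hp : (0 : ℝ) < 1 + x ^ 2 := by positivity
    rw [Pi.smul_apply', norm_smul, hg]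
    simp only
    rw [norm_mul, norm_sqrt_weight, one_mul, ← mul_assoc, Real.norm_of_nonneg (by positivity),
      Real.sqrt_eq_rpow, ← Real.rpow_add hp]
    norm_num
  have hi : Integrable (ω • g) := by
    have := hgL.smul (r := 1) memLp_weight
    exact memLp_one_iff_integrable.1 this
  refine ⟨hi.norm.congr (Eventually.of_forall hmul), ?_⟩
  have e : ∫ x : ℝ, (1 + x ^ 2 : ℝ) ^ (1 / 8 : ℝ) * ‖φ x‖ = (eLpNorm (ω • g) 1 volume).toReal := by
    rw [← integral_congr_ae (Eventually.of_forall hmul), eLpNorm_one_eq_lintegral_enorm,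
      integral_norm_eq_lintegral_enorm hi.1]
  rw [e]
  have h2 := eLpNorm_smul_le_mul_eLpNorm (p := 2) (q := 2) (r := 1) hgm memLp_weight.1
  have hne : eLpNorm ω 2 volume ≠ ∞ := memLp_weight.2.ne
  refine (ENNReal.toReal_mono (ENNReal.mul_ne_top hne hgL.2.ne) h2).trans ?_
  rw [ENNReal.toReal_mul]
  have h3 : (eLpNorm g 2 volume).toReal ≤ 2 * K := ENNReal.toReal_le_of_le_ofReal (by positivity) hgn
  have h4 : 0 ≤ (eLpNorm ω 2 volume).toReal := ENNReal.toReal_nonneg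
  change _ ≤ (1 + 2 * (eLpNorm ω 2 volume).toReal) * K
  nlinarith [mul_le_mul_of_nonneg_left h3 h4]

theorem continuous_fourierIntegral {f : ℝ → ℂ} (hf : Integrable f) : Continuous (𝓕 f) :=
  VectorFourier.fourierIntegral_continuous Real.continuous_fourierChar (innerSL ℝ).continuous₂ hf

theorem integral_fourier_mul {f g : ℝ → ℂ} (hf : Integrable f) (hg : Integrable g) :
    ∫ k, 𝓕 f k * g k = ∫ y, f y * 𝓕 g y := by
  have h := VectorFourier.integral_fourierIntegral_smul_eq_flip (μ := (volume : Measure ℝ))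
    (ν := (volume : Measure ℝ)) (L := innerₗ ℝ) Real.continuous_fourierChar
    (by exact (innerSL ℝ).continuous₂) hf hg
  rw [flip_innerₗ] at h
  exact h

/-! ### The explicit Schrödinger kernel -/

/-- The constant `(2πit)^{-1/2}` of the Schrödinger kernel. -/
def kernelConst (t : ℝ) : ℂ := 1 / ((2 * Real.pi * t : ℝ) * Complex.I) ^ (1 / 2 : ℂ)

/-- The explicit kernel of the free Schrödinger group. -/
theorem schrodinger_kernel {f : ℝ → ℂ} (hf : Integrable f) (hf' : Integrable (𝓕 f)) {t : ℝ}
    (ht : t ≠ 0) (x : ℝ) :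
    ∫ k, Complex.exp (linPhase (2 * Real.pi * x) k * Complex.I) *
        (Complex.exp (quadPhase t k * Complex.I) * 𝓕 f k)
      = kernelConst t * ∫ y, Complex.exp (((x - y) ^ 2 / (2 * t) : ℝ) * Complex.I) * f y := by
  -- The oscillating symbol is the value at `ε = 0` of the Gaussian `e^{-π b k²}`. For `ε > 0` the
  -- Gaussian is integrable and its Fourier transform is explicit. Parseval is applied there, and `ε
  -- → 0` follows by dominated convergence on both sides.
  set b : ℝ → ℂ := fun ε => ε + (2 * Real.pi * t : ℝ) * Complex.I with hb
  have hbre : ∀ ε, (b ε).re = ε := fun ε => by simp [hb]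
  have hb0 : b 0 = (2 * Real.pi * t : ℝ) * Complex.I := by simp [hb]
  have hbim : (b 0).im = 2 * Real.pi * t := by rw [hb0]; simp
  have hbne : (b 0).im ≠ 0 := by
    rw [hbim]; exact mul_ne_zero Real.two_pi_pos.ne' ht
  have hb0ne : b 0 ≠ 0 := fun h => hbne (by rw [h]; rfl)
  have hbt : Tendsto b (𝓝[>] 0) (𝓝 (b 0)) :=
    (Continuous.tendsto (by fun_prop) 0).mono_left nhdsWithin_le_nhds
  set g : ℝ → ℝ → ℂ := fun ε k => Complex.exp (-Real.pi * b ε * k ^ 2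
    + 2 * Real.pi * (Complex.I * x) * k) with hg
  have hgk : ∀ k, g 0 k = Complex.exp (linPhase (2 * Real.pi * x) k * Complex.I) *
      Complex.exp (quadPhase t k * Complex.I) := fun k => by
    rw [← Complex.exp_add, hg]
    simp only
    rw [hb0]
    congr 1
    simp [linPhase, quadPhase]
    ring
  have hid : ∀ ε > 0, ∫ k, 𝓕 f k * g ε k = (1 / (b ε) ^ (1 / 2 : ℂ)) *
      ∫ y : ℝ, Complex.exp (-Real.pi / b ε * (y + Complex.I * (Complex.I * x)) ^ 2) * f y := by
    intro ε hε
    have hre : 0 < (b ε).re := by rw [hbre]; exact hε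
    have hgi : Integrable (g ε) := by
      have := integrable_cexp_quadratic (b := Real.pi * b ε) (by
        rw [Complex.re_ofReal_mul]; exact mul_pos Real.pi_pos hre) (2 * Real.pi * (Complex.I * x)) 0
      refine this.congr (Eventually.of_forall fun k => ?_)
      simp only [hg]
      congr 1
      ring
    rw [integral_fourier_mul hf hgi, hg, fourier_gaussian_pi' hre, ← integral_const_mul]
    congr 1
    ext y
    ring
  have hL : Tendsto (fun ε => ∫ k, 𝓕 f k * g ε k) (𝓝[>] 0) (𝓝 (∫ k, 𝓕 f k * g 0 k)) := by
    refine tendsto_integral_filter_of_dominated_convergence (fun k => ‖𝓕 f k‖) ?_ ?_ hf'.norm ?_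
    · exact Eventually.of_forall fun ε => hf'.1.mul (Continuous.aestronglyMeasurable (by fun_prop))
    · filter_upwards [self_mem_nhdsWithin] with ε (hε : 0 < ε)
      refine Eventually.of_forall fun k => ?_
      rw [norm_mul]
      refine mul_le_of_le_one_right (norm_nonneg _) ?_
      rw [hg, Complex.norm_exp, Real.exp_le_one_iff]
      have e : (-Real.pi * b ε * (k : ℂ) ^ 2 + 2 * Real.pi * (Complex.I * x) * k).re
          = -(Real.pi * ε * k ^ 2) := by
        have : -Real.pi * b ε * (k : ℂ) ^ 2 + 2 * Real.pi * (Complex.I * x) * k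
          = ((-(Real.pi * ε * k ^ 2) : ℝ) : ℂ) +
            ((2 * Real.pi * x * k - Real.pi * (2 * Real.pi * t) * k ^ 2 : ℝ) : ℂ) * Complex.I := by
          simp only [hb]; push_cast; ring
        rw [this, Complex.add_re, Complex.re_ofReal_mul, Complex.ofReal_re, Complex.I_re, mul_zero,
          add_zero]
      rw [e]
      have := Real.pi_pos
      have : 0 ≤ Real.pi * ε * k ^ 2 := by positivity
      linarith
    · refine Eventually.of_forall fun k => Tendsto.const_mul _ ?_
      refine (Complex.continuous_exp.tendsto _).comp (Tendsto.add_const _ ?_)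
      exact (hbt.const_mul _).mul_const _
  have hR : Tendsto (fun ε => (1 / (b ε) ^ (1 / 2 : ℂ)) *
      ∫ y : ℝ, Complex.exp (-Real.pi / b ε * (y + Complex.I * (Complex.I * x)) ^ 2) * f y) (𝓝[>] 0)
      (𝓝 ((1 / (b 0) ^ (1 / 2 : ℂ)) *
      ∫ y : ℝ, Complex.exp (-Real.pi / b 0 * (y + Complex.I * (Complex.I * x)) ^ 2) * f y)) := by
    refine Tendsto.mul ?_ ?_
    · refine Tendsto.div tendsto_const_nhds ((continuousAt_cpow_const (Or.inr hbne)).tendsto.comp hbt) ?_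
      rw [Complex.cpow_def_of_ne_zero hb0ne]
      exact Complex.exp_ne_zero _
    · refine tendsto_integral_filter_of_dominated_convergence (fun y => ‖f y‖) ?_ ?_ hf.norm ?_
      · exact Eventually.of_forall fun ε =>
          (Continuous.aestronglyMeasurable (by fun_prop)).mul hf.1
      · filter_upwards [self_mem_nhdsWithin] with ε (hε : 0 < ε)
        refine Eventually.of_forall fun y => ?_
        rw [norm_mul]
        refine mul_le_of_le_one_left (norm_nonneg _) ?_
        rw [Complex.norm_exp, Real.exp_le_one_iff]
        have e : -(Real.pi : ℂ) / b ε * (y + Complex.I * (Complex.I * x)) ^ 2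
            = ((-(Real.pi * (y - x) ^ 2) : ℝ) : ℂ) * (b ε)⁻¹ := by
          rw [← mul_assoc Complex.I, Complex.I_mul_I]
          push_cast
          ring
        rw [e, Complex.re_ofReal_mul, Complex.inv_re, hbre]
        have := Real.pi_pos
        have h1 : 0 ≤ Real.pi * (y - x) ^ 2 := by positivity
        have h2 : 0 ≤ ε / Complex.normSq (b ε) := div_nonneg hε.le (Complex.normSq_nonneg _)
        nlinarith
      · refine Eventually.of_forall fun y => Tendsto.mul_const _ ?_
        refine (Complex.continuous_exp.tendsto _).comp (Tendsto.mul_const _ ?_)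
        exact Tendsto.div tendsto_const_nhds hbt hb0ne
  have hfin := tendsto_nhds_unique (hL.congr' (by
    filter_upwards [self_mem_nhdsWithin] with ε hε using hid ε hε)) hR
  calc _ = ∫ k, 𝓕 f k * g 0 k := by
        congr 1; ext k; rw [hgk]; ring
    _ = _ := hfin
    _ = _ := by
        rw [hb0]
        congr 1
        congr 1
        ext y
        congr 2
        have hpi : (Real.pi : ℂ) ≠ 0 := Complex.ofReal_ne_zero.2 Real.pi_ne_zero
        have ht' : (t : ℂ) ≠ 0 := Complex.ofReal_ne_zero.2 ht
        have hI := Complex.I_ne_zero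
        push_cast
        rw [← mul_assoc Complex.I, Complex.I_mul_I, div_mul_eq_mul_div, div_eq_iff (by
          simp [hpi, ht'])]
        field_simp
        rw [show Complex.I ^ 2 = -1 from Complex.I_sq]
        ring

theorem norm_kernelConst (t : ℝ) (ht : t ≠ 0) :
    ‖kernelConst t‖ ^ 2 = (2 * Real.pi * |t|)⁻¹ := by
  have h0 : ((2 * Real.pi * t : ℝ) * Complex.I) ≠ 0 :=
    mul_ne_zero (Complex.ofReal_ne_zero.2 (mul_ne_zero Real.two_pi_pos.ne' ht)) Complex.I_ne_zero
  have h1 : (((2 * Real.pi * t : ℝ) * Complex.I) ^ (1 / 2 : ℂ)) ^ 2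
      = (2 * Real.pi * t : ℝ) * Complex.I := by
    rw [← Complex.cpow_nat_mul]
    simp
  rw [kernelConst, norm_div, norm_one, div_pow, one_pow, ← norm_pow, h1, norm_mul, Complex.norm_I,
    mul_one, Complex.norm_real, Real.norm_eq_abs, abs_mul, abs_of_pos Real.two_pi_pos, one_div]

/-- Relation between the kernel constants at the times `t` and `1 / (4π²t)`. -/
theorem kernelConst_dual (t : ℝ) (ht : t ≠ 0) :
    kernelConst t = ((2 * Real.pi * |t|)⁻¹ : ℝ) * kernelConst (1 / (4 * Real.pi ^ 2 * t)) := by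
  have h0 : ((2 * Real.pi * t : ℝ) * Complex.I) ≠ 0 :=
    mul_ne_zero (Complex.ofReal_ne_zero.2 (mul_ne_zero Real.two_pi_pos.ne' ht)) Complex.I_ne_zero
  have hr : 0 < (2 * Real.pi * |t|)⁻¹ := by positivity
  have e : ((2 * Real.pi * (1 / (4 * Real.pi ^ 2 * t)) : ℝ) * Complex.I)
      = (((2 * Real.pi * |t|)⁻¹ ^ 2 : ℝ) : ℂ) * ((2 * Real.pi * t : ℝ) * Complex.I) := by
    rw [← mul_assoc, ← Complex.ofReal_mul]
    congr 2
    rw [inv_pow, mul_pow, sq_abs]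
    field_simp
    ring
  have e2 : ((((2 * Real.pi * |t|)⁻¹ ^ 2 : ℝ) : ℂ) * ((2 * Real.pi * t : ℝ) * Complex.I)) ^ (1 / 2 : ℂ)
      = ((2 * Real.pi * |t|)⁻¹ : ℝ) * ((2 * Real.pi * t : ℝ) * Complex.I) ^ (1 / 2 : ℂ) := by
    have hp : (0 : ℝ) < (2 * Real.pi * |t|)⁻¹ ^ 2 := by positivity
    rw [Complex.cpow_def_of_ne_zero (mul_ne_zero (Complex.ofReal_ne_zero.2 hp.ne') h0),
      Complex.cpow_def_of_ne_zero h0, Complex.log_ofReal_mul hp h0, add_mul, Complex.exp_add]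
    congr 1
    rw [Real.log_pow]
    have : ((((2 : ℕ) : ℝ) * Real.log (2 * Real.pi * |t|)⁻¹ : ℝ) : ℂ) * (1 / 2)
        = (Real.log (2 * Real.pi * |t|)⁻¹ : ℝ) := by push_cast; ring
    rw [this, ← Complex.ofReal_exp, Real.exp_log hr]
  have h3 : ((2 * Real.pi * t : ℝ) * Complex.I) ^ (1 / 2 : ℂ) ≠ 0 := by
    rw [Complex.cpow_def_of_ne_zero h0]; exact Complex.exp_ne_zero _
  rw [kernelConst, kernelConst, e, e2]
  have h4 : (((2 * Real.pi * |t|)⁻¹ : ℝ) : ℂ) ≠ 0 := Complex.ofReal_ne_zero.2 hr.ne'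
  rw [mul_one_div, mul_comm (((2 * Real.pi * |t|)⁻¹ : ℝ) : ℂ) (_ ^ _), ← div_div, div_right_comm,
    div_self h4]

/-! ### Oscillating phases, `L¹` bounds and the Sobolev bound -/

theorem one_le_weight (x : ℝ) : (1 : ℝ) ≤ (1 + x ^ 2) ^ (1 / 8 : ℝ) :=
  Real.one_le_rpow (by nlinarith [sq_nonneg x]) (by norm_num)

theorem L1_of_weight {φ : L2R} {K : ℝ} (h0 : ‖φ‖ ≤ K)
    (h1 : eLpNorm (fun x : ℝ => (x : ℂ) * φ x) 2 volume ≤ ENNReal.ofReal K) :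
    Integrable φ ∧ ∫ x : ℝ, ‖φ x‖ ≤ weightConst * K := by
  obtain ⟨hi, hb⟩ := weighted_L1 h0 h1
  have hi' : Integrable φ := hi.mono' (Lp.aestronglyMeasurable φ) (Eventually.of_forall fun x =>
    le_mul_of_one_le_left (norm_nonneg _) (one_le_weight x))
  exact ⟨hi', (integral_mono hi'.norm hi fun x =>
    le_mul_of_one_le_left (norm_nonneg _) (one_le_weight x)).trans hb⟩

/-- An interpolation between the bounds `|y|` and `2`, with the exponent chosen so that a quadratic
phase fits the spare weight. -/
theorem norm_exp_mul_I_sub_one_le_rpow (y : ℝ) :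
    ‖Complex.exp (y * Complex.I) - 1‖ ≤ 2 * |y| ^ (1 / 8 : ℝ) := by
  rcases le_total |y| 1 with h | h
  · have h1 : |y| ≤ |y| ^ (1 / 8 : ℝ) := by
      simpa using Real.rpow_le_rpow_of_exponent_ge_of_imp (abs_nonneg y) h
        (by norm_num : (1 / 8 : ℝ) ≤ 1) (by norm_num)
    have := norm_exp_mul_I_sub_one_le y
    have := Real.rpow_nonneg (abs_nonneg y) (1 / 8)
    linarith
  · have h1 : (1 : ℝ) ≤ |y| ^ (1 / 8 : ℝ) := Real.one_le_rpow h (by norm_num)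
    have h2 : ‖Complex.exp (y * Complex.I) - 1‖ ≤ 1 + 1 := by
      refine (norm_sub_le _ _).trans ?_
      rw [Complex.norm_exp_ofReal_mul_I, norm_one]
    linarith

/-- A slowly varying phase changes the Fourier integral by a small amount. -/
theorem integral_phase_sub_one_le {φ : ℝ → ℂ} {B : ℝ}
    (hi : Integrable (fun x : ℝ => (1 + x ^ 2 : ℝ) ^ (1 / 8 : ℝ) * ‖φ x‖))
    (hb : ∫ x : ℝ, (1 + x ^ 2 : ℝ) ^ (1 / 8 : ℝ) * ‖φ x‖ ≤ B) {a : ℝ}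
    (ha : 0 ≤ a) (θ : C(ℝ, ℝ)) (hθ : ∀ x, |θ x| ≤ a * x ^ 2) (c : ℝ → ℂ) (hc : ∀ x, ‖c x‖ = 1) :
    ‖∫ x, c x * ((Complex.exp (θ x * Complex.I) - 1) * φ x)‖
      ≤ 2 * a ^ (1 / 8 : ℝ) * B := by
  have hpt : ∀ x, ‖c x * ((Complex.exp (θ x * Complex.I) - 1) * φ x)‖
      ≤ 2 * a ^ (1 / 8 : ℝ) * ((1 + x ^ 2 : ℝ) ^ (1 / 8 : ℝ) * ‖φ x‖) := fun x => by
    rw [norm_mul, hc, one_mul, norm_mul, ← mul_assoc]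
    gcongr
    refine (norm_exp_mul_I_sub_one_le_rpow _).trans ?_
    rw [mul_assoc, ← Real.mul_rpow ha (by positivity)]
    gcongr
    exact (hθ x).trans (by gcongr; linarith)
  refine (norm_integral_le_of_norm_le (hi.const_mul (2 * a ^ (1 / 8 : ℝ)))
    (Eventually.of_forall hpt)).trans ?_
  rw [integral_const_mul]
  gcongr

theorem fourier_eq_integral (f : ℝ → ℂ) (k : ℝ) :
    𝓕 f k = ∫ x, Complex.exp (linPhase (-(2 * Real.pi * k)) x * Complex.I) * f x := by
  rw [Real.fourier_real_eq_integral_exp_smul]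
  congr 1
  ext x
  rw [smul_eq_mul]
  congr 3
  simp [linPhase]
  ring

theorem fourierInv_eq_integral (f : ℝ → ℂ) (x : ℝ) :
    𝓕⁻ f x = ∫ k, Complex.exp (linPhase (2 * Real.pi * x) k * Complex.I) * f k := by
  rw [Real.fourierInv_eq_fourier_neg, fourier_eq_integral]
  simp

theorem norm_fourier_le_integral (f : ℝ → ℂ) (k : ℝ) : ‖𝓕 f k‖ ≤ ∫ x, ‖f x‖ := by
  rw [fourier_eq_integral]
  refine (norm_integral_le_integral_norm _).trans (le_of_eq ?_)
  congr 1
  ext x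
  rw [norm_mul, Complex.norm_exp_ofReal_mul_I, one_mul]

theorem integrable_phaseMul (θ : C(ℝ, ℝ)) {φ : L2R} (h : Integrable φ) :
    Integrable (phaseMul θ φ) :=
  h.mono (Lp.aestronglyMeasurable _) (by
    filter_upwards [coeFn_phaseMul θ φ] with x hx
    rw [hx, norm_mul, Complex.norm_exp_ofReal_mul_I, one_mul])

/-- The Sobolev bound `‖φ‖_∞ ≤ C ‖φ‖_{H¹}`, in terms of translation difference quotients. -/
theorem ae_bound_of_transl {φ : L2R} {K : ℝ} (h0 : ‖φ‖ ≤ K)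
    (h1 : ∀ a, ‖transl a φ - φ‖ ≤ |a| * K) : ∀ᵐ x, ‖φ x‖ ≤ weightConst * K := by
  have hK : 0 ≤ K := (norm_nonneg _).trans h0
  have hw : eLpNorm (fun x : ℝ => (x : ℂ) * (𝓕 φ : L2R) x) 2 volume ≤ ENNReal.ofReal K :=
    (eLpNorm_id_mul_fourier_le h1).trans (ENNReal.ofReal_le_ofReal
      (div_le_self hK (by linarith [Real.pi_gt_three])))
  obtain ⟨hi, hb⟩ := L1_of_weight (φ := 𝓕 φ) (by rwa [norm_fourier_L2]) hw
  have h2 := coeFn_fourierInv_ae_eq (𝓕 φ) hi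
  rw [show (𝓕⁻ (𝓕 φ : L2R) : L2R) = φ from (Lp.fourierTransformₗᵢ ℝ ℂ).symm_apply_apply φ] at h2
  filter_upwards [h2] with x hx
  rw [hx, Real.fourierInv_eq_fourier_neg]
  exact (norm_fourier_le_integral _ _).trans hb

theorem SigmaBound.weight {φ : L2R} {K : ℝ} (h : SigmaBound φ K) :
    Integrable φ ∧ ∫ x : ℝ, ‖φ x‖ ≤ weightConst * K :=
  L1_of_weight h.norm_le h.eLpNorm_id_mul_le

theorem SigmaBound.weight_fourier {φ : L2R} {K : ℝ} (h : SigmaBound φ K) :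
    Integrable (𝓕 φ : L2R) := by
  refine (L1_of_weight (K := K) ?_ (h.eLpNorm_id_mul_fourier_le.trans
    (ENNReal.ofReal_le_ofReal (div_le_self h.nonneg (by linarith [Real.pi_gt_three]))))).1
  rw [norm_fourier_L2]; exact h.norm_le

theorem SigmaBound.norm_fourier_le {φ : L2R} {K : ℝ} (h : SigmaBound φ K) (k : ℝ) :
    ‖𝓕 (φ : ℝ → ℂ) k‖ ≤ weightConst * K :=
  (norm_fourier_le_integral _ _).trans h.weight.2

/-- The free group is isometric and commutes with translations, so the `H^{1,0}` part of the bound,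
and with it the Sobolev bound, does not grow in time. -/
theorem SigmaBound.ae_bound_freeGroup {φ : L2R} {K : ℝ} (h : SigmaBound φ K) (t : ℝ) :
    ∀ᵐ x, ‖freeGroup t φ x‖ ≤ weightConst * K := by
  refine ae_bound_of_transl ?_ fun a => ?_
  · rw [LinearIsometry.norm_map]; exact h.norm_le
  · rw [← freeGroup_transl, ← map_sub, LinearIsometry.norm_map]
    exact h _ _ (SigmaSymm.transl a)

/-! ### Factorization of the free group and pointwise decay -/

/-- The Fourier integral of the free evolution, at every frequency. -/
theorem fourier_freeGroup_apply {φ : L2R} (h1 : Integrable φ) {t : ℝ}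
    (h2 : Integrable (freeGroup t φ)) (k : ℝ) :
    𝓕 (freeGroup t φ : ℝ → ℂ) k = Complex.exp (quadPhase t k * Complex.I) * 𝓕 (φ : ℝ → ℂ) k := by
  have hc1 := continuous_fourierIntegral h1
  have hc2 := continuous_fourierIntegral h2
  have hae : 𝓕 (freeGroup t φ : ℝ → ℂ) =ᵐ[volume]
      fun k => Complex.exp (quadPhase t k * Complex.I) * 𝓕 (φ : ℝ → ℂ) k := by
    filter_upwards [coeFn_fourier_ae_eq _ h1, coeFn_fourier_ae_eq _ h2,
      coeFn_phaseMul (quadPhase t) (𝓕 φ)] with k e1 e2 e3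
    rw [← e2, fourier_freeGroup, e3, e1]
  exact congrFun ((hc2.ae_eq_iff_eq volume (by fun_prop)).1 hae) k

/-- The phase `y ↦ y² / (2t)`. -/
def chirp (t : ℝ) : C(ℝ, ℝ) := ⟨fun y => y ^ 2 / (2 * t), by fun_prop⟩

theorem integrable_fourier_of_L2 {φ : L2R} (h : Integrable φ) (h' : Integrable (𝓕 φ : L2R)) :
    Integrable (𝓕 (φ : ℝ → ℂ)) := h'.congr (coeFn_fourier_ae_eq φ h)

/-- The factorization of the free evolution. -/
theorem freeGroup_ae_eq {φ : L2R} {K : ℝ} (h : SigmaBound φ K) {t : ℝ} (ht : t ≠ 0) :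
    freeGroup t φ =ᵐ[volume] fun x => kernelConst t * (Complex.exp (chirp t x * Complex.I) *
      𝓕 (phaseMul (chirp t) φ : ℝ → ℂ) (x / (2 * Real.pi * t))) := by
  have hi := h.weight.1
  have hi' := integrable_fourier_of_L2 hi h.weight_fourier
  have h1 : freeGroup t φ = 𝓕⁻ (phaseMul (quadPhase t) (𝓕 φ)) := rfl
  rw [h1]
  refine (coeFn_fourierInv_ae_eq _ (integrable_phaseMul _ h.weight_fourier)).trans
    (Eventually.of_forall fun x => ?_)
  have e1 : ∀ᵐ k, phaseMul (quadPhase t) (𝓕 φ) k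
      = Complex.exp (quadPhase t k * Complex.I) * 𝓕 (φ : ℝ → ℂ) k := by
    filter_upwards [coeFn_phaseMul (quadPhase t) (𝓕 φ), coeFn_fourier_ae_eq φ hi] with k h1 h2
    rw [h1, h2]
  rw [fourierInv_eq_integral]
  have e2 := integral_congr_ae (e1.mono fun k hk =>
    congrArg (fun z => Complex.exp (linPhase (2 * Real.pi * x) k * Complex.I) * z) hk)
  refine e2.trans ?_
  rw [schrodinger_kernel hi hi' ht x]
  congr 1
  -- Expanding `(x - y)² / (2t)`: the `x²` term is the outer chirp, the `y²` term the inner chirp,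
  -- and the cross term is the Fourier kernel at frequency `x / (2πt)`.
  rw [Real.fourier_congr_ae (coeFn_phaseMul _ φ), fourier_eq_integral, ← integral_const_mul]
  congr 1
  ext y
  rw [← mul_assoc, ← mul_assoc, ← Complex.exp_add, ← Complex.exp_add]
  congr 2
  rw [← add_mul, ← add_mul, ← Complex.ofReal_add, ← Complex.ofReal_add]
  congr 2
  simp only [chirp, linPhase, ContinuousMap.coe_mk]
  have := Real.pi_ne_zero
  field_simp
  ring

theorem SigmaBound.norm_fourier_chirp_le {φ : L2R} {K : ℝ} (h : SigmaBound φ K) (t k : ℝ) :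
    ‖𝓕 (phaseMul (chirp t) φ : ℝ → ℂ) k‖ ≤ weightConst * K := by
  refine (norm_fourier_le_integral _ _).trans (le_trans (le_of_eq ?_) h.weight.2)
  refine integral_congr_ae ?_
  filter_upwards [coeFn_phaseMul (chirp t) φ] with x hx
  rw [hx, norm_mul, Complex.norm_exp_ofReal_mul_I, one_mul]

theorem inv_abs_rpow (t : ℝ) : (|t|⁻¹) ^ (1 / 8 : ℝ) = |t| ^ (-(1 / 8) : ℝ) := by
  rw [Real.rpow_neg (abs_nonneg t), Real.inv_rpow (abs_nonneg t)]

/-- The chirp phase is at most `|t|⁻¹ x²`, so removing it costs `|t|^{-1/8}` against the spare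
weight. This is what relates the factorized evolution to `f̂` itself. -/
theorem SigmaBound.fourier_chirp_sub_le {φ : L2R} {K : ℝ} (h : SigmaBound φ K) (t k : ℝ) :
    ‖𝓕 (phaseMul (chirp t) φ : ℝ → ℂ) k - 𝓕 (φ : ℝ → ℂ) k‖
      ≤ 2 * |t| ^ (-(1 / 8) : ℝ) * (weightConst * K) := by
  obtain ⟨hi, hb⟩ := weighted_L1 h.norm_le h.eLpNorm_id_mul_le
  have h1 := h.weight.1
  have h2 := integrable_phaseMul (chirp t) h1
  have e : 𝓕 (phaseMul (chirp t) φ : ℝ → ℂ) k - 𝓕 (φ : ℝ → ℂ) k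
      = ∫ x, Complex.exp (linPhase (-(2 * Real.pi * k)) x * Complex.I) *
        ((Complex.exp (chirp t x * Complex.I) - 1) * φ x) := by
    rw [fourier_eq_integral, fourier_eq_integral, ← integral_sub]
    · refine integral_congr_ae ?_
      filter_upwards [coeFn_phaseMul (chirp t) φ] with x hx
      rw [hx]; ring
    · exact (integrable_phaseMul (linPhase _) h2).congr (coeFn_phaseMul _ _)
    · exact (integrable_phaseMul (linPhase _) h1).congr (coeFn_phaseMul _ _)
  rw [e, ← inv_abs_rpow]
  refine integral_phase_sub_one_le hi hb (by positivity) _ (fun x => ?_) _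
    fun x => Complex.norm_exp_ofReal_mul_I _
  simp only [chirp, ContinuousMap.coe_mk]
  rw [abs_div, abs_mul, abs_of_nonneg (sq_nonneg x), abs_two]
  rw [div_eq_mul_inv, mul_comm, mul_inv]
  gcongr
  rw [inv_mul_le_iff₀ two_pos]
  have : 0 ≤ |t|⁻¹ := by positivity
  linarith

/-- Pointwise decay of the free evolution. -/
theorem SigmaBound.freeGroup_decay {φ : L2R} {K : ℝ} (h : SigmaBound φ K) {t : ℝ} (ht : t ≠ 0)
    {B : ℝ} (hB : ∀ k, ‖𝓕 (φ : ℝ → ℂ) k‖ ≤ B) :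
    ∀ᵐ x, ‖freeGroup t φ x‖
      ≤ |t| ^ (-(1 / 2) : ℝ) * (B + 2 * |t| ^ (-(1 / 8) : ℝ) * (weightConst * K)) := by
  filter_upwards [freeGroup_ae_eq h ht] with x hx
  rw [hx, norm_mul, norm_mul, Complex.norm_exp_ofReal_mul_I, one_mul]
  have hc : ‖kernelConst t‖ ≤ |t| ^ (-(1 / 2) : ℝ) := by
    have h1 := norm_kernelConst t ht
    have htp := abs_pos.2 ht
    refine le_of_sq_le_sq ?_ (by positivity)
    have h2 : (|t| ^ (-(1 / 2) : ℝ)) ^ 2 = |t|⁻¹ := by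
      rw [← Real.rpow_mul_natCast htp.le, ← Real.rpow_neg_one]
      norm_num
    rw [h1, h2]
    gcongr
    have := Real.pi_gt_three
    nlinarith
  gcongr
  set k := x / (2 * Real.pi * t)
  have := norm_add_le (𝓕 (φ : ℝ → ℂ) k) (𝓕 (phaseMul (chirp t) φ : ℝ → ℂ) k - 𝓕 (φ : ℝ → ℂ) k)
  rw [add_sub_cancel] at this
  exact this.trans (add_le_add (hB k) (h.fourier_chirp_sub_le t k))

/-! ### The asymptotic equation for the transform of the profile -/

theorem continuous_truncCubic (M : ℝ≥0) : Continuous (truncCubic M) :=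
  (truncCubic_lipschitz M).continuous

/-- The nonlinearity is integrable if the argument is bounded and square integrable. -/
theorem integrable_nl (M : ℝ≥0) {φ : L2R} : Integrable (nl M φ) := by
  by_cases hM : M = 0
  · have : nl M φ =ᵐ[volume] (fun _ => (0 : ℂ)) := by
      filter_upwards [coeFn_nl M φ] with x hx
      rw [hx, truncCubic, hM]
      simp
    exact (integrable_zero _ _ _).congr this.symm
  refine ((L2R_integrable_sq φ).const_mul M).mono' (Lp.aestronglyMeasurable _) ?_
  filter_upwards [coeFn_nl M φ] with x hx
  rw [hx, truncCubic, norm_mul, Complex.norm_real, Real.norm_of_nonneg (by positivity)]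
  have h1 := min_le_left ‖φ x‖ (M : ℝ)
  have h2 := min_le_right ‖φ x‖ (M : ℝ)
  have h3 : 0 ≤ min ‖φ x‖ (M : ℝ) := le_min (norm_nonneg _) M.2
  have h4 := norm_nonneg (φ x)
  have h5 : min ‖φ x‖ (M : ℝ) ^ 2 ≤ M * ‖φ x‖ := by
    rw [sq]; exact mul_le_mul h2 h1 h3 M.2
  nlinarith

/-- This places the field in the weighted space, hence in `L¹`, so that its Fourier integral is
meaningful at each single frequency. -/
theorem nlsField_sigmaBound {φ : L2R} {K q : ℝ} (h : SigmaBound φ K) (M : ℝ≥0) (t : ℝ)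
    (hq : ∀ᵐ x, ‖freeGroup t φ x‖ ≤ q) : SigmaBound (nlsField M t φ) (3 * q ^ 2 * K) := by
  intro R w hR
  refine (norm_nlsField_symm_sub_le hR.isSymm M t hq).trans ?_
  have := mul_le_mul_of_nonneg_left (h R w hR) (by positivity : 0 ≤ 3 * q ^ 2)
  linarith

theorem nlsField_sigmaBound' {φ : L2R} {K : ℝ} (h : SigmaBound φ K) (M : ℝ≥0) (t : ℝ) :
    SigmaBound (nlsField M t φ) (3 * M ^ 2 * K) := by
  intro R w hR
  refine (norm_nlsField_symm_sub_le' hR.isSymm M t φ).trans ?_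
  have := mul_le_mul_of_nonneg_left (h R w hR) (by positivity : (0 : ℝ) ≤ 3 * M ^ 2)
  linarith

theorem fourier_integral_smul (c : ℂ) (φ : L2R) (k : ℝ) :
    𝓕 ((c • φ : L2R) : ℝ → ℂ) k = c * 𝓕 (φ : ℝ → ℂ) k := by
  rw [Real.fourier_congr_ae (Lp.coeFn_smul c φ), fourier_eq_integral, fourier_eq_integral,
    ← integral_const_mul]
  congr 1
  ext x
  rw [Pi.smul_apply, smul_eq_mul]
  ring

/-- The Fourier transform of the vector field in terms of the factorized profile. -/
theorem fourier_nlsField_eq {φ : L2R} {K : ℝ} (h : SigmaBound φ K) {M : ℝ≥0} {t : ℝ} (ht : t ≠ 0)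
    (hM : ∀ᵐ x, ‖freeGroup t φ x‖ ≤ M) (k : ℝ) :
    𝓕 (nlsField M t φ : ℝ → ℂ) k = -Complex.I * (kernelConst t *
      ∫ y, Complex.exp (((k - y) ^ 2 / (2 * (1 / (4 * Real.pi ^ 2 * t))) : ℝ) * Complex.I) *
        (((‖𝓕 (phaseMul (chirp t) φ : ℝ → ℂ) y‖ ^ 2 : ℝ) : ℂ) *
          𝓕 (phaseMul (chirp t) φ : ℝ → ℂ) y)) := by
  set v := 𝓕 (phaseMul (chirp t) φ : ℝ → ℂ) with hv
  set w := nl M (freeGroup t φ) with hw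
  have hwi : Integrable w := integrable_nl M
  have hFi : Integrable (freeGroup (-t) w) := by
    have h1 := (nlsField_sigmaBound h M t hM).weight.1
    have h2 : freeGroup (-t) w = Complex.I • nlsField M t φ := by
      rw [nlsField, smul_smul]
      simp [hw]
    rw [h2]
    exact (h1.smul Complex.I).congr (Lp.coeFn_smul _ _).symm
  rw [nlsField, fourier_integral_smul, fourier_freeGroup_apply hwi hFi]
  congr 1
  -- Gauge invariance lets the unimodular outer chirp pass through the cubic term.
  have hwv : w =ᵐ[volume] fun x => (((‖kernelConst t‖ ^ 2 : ℝ) : ℂ) * kernelConst t) *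
      (Complex.exp (chirp t x * Complex.I) *
        (((‖v (x / (2 * Real.pi * t))‖ ^ 2 : ℝ) : ℂ) * v (x / (2 * Real.pi * t)))) := by
    filter_upwards [coeFn_nl M (freeGroup t φ), hM, freeGroup_ae_eq h ht] with x h1 h2 h3
    rw [hw, h1, truncCubic_of_le h2, h3, norm_mul, norm_mul, Complex.norm_exp_ofReal_mul_I, one_mul]
    push_cast
    ring
  rw [Real.fourier_congr_ae hwv, fourier_eq_integral, ← integral_const_mul]
  set c := kernelConst t with hc
  set G : ℝ → ℂ := fun y => (2 * Real.pi * |t| : ℝ)⁻¹ • (c * (Complex.exp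
    (((k - y) ^ 2 / (2 * (1 / (4 * Real.pi ^ 2 * t))) : ℝ) * Complex.I) *
      (((‖v y‖ ^ 2 : ℝ) : ℂ) * v y))) with hG
  have e1 : ∀ x, Complex.exp (quadPhase (-t) k * Complex.I) *
      (Complex.exp (linPhase (-(2 * Real.pi * k)) x * Complex.I) *
        ((((‖c‖ ^ 2 : ℝ) : ℂ) * c) * (Complex.exp (chirp t x * Complex.I) *
        (((‖v (x / (2 * Real.pi * t))‖ ^ 2 : ℝ) : ℂ) * v (x / (2 * Real.pi * t))))))
      = G (x / (2 * Real.pi * t)) := by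
    intro x
    have h1 : Complex.exp (quadPhase (-t) k * Complex.I) *
        (Complex.exp (linPhase (-(2 * Real.pi * k)) x * Complex.I) *
          Complex.exp (chirp t x * Complex.I))
        = Complex.exp (((k - x / (2 * Real.pi * t)) ^ 2 / (2 * (1 / (4 * Real.pi ^ 2 * t))) : ℝ)
          * Complex.I) := by
      rw [← Complex.exp_add, ← Complex.exp_add, ← add_mul, ← add_mul, ← Complex.ofReal_add,
        ← Complex.ofReal_add]
      congr 3
      simp only [chirp, linPhase, quadPhase, ContinuousMap.coe_mk]
      field_simp
      ring
    rw [hG]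
    simp only
    rw [← h1, norm_kernelConst t ht, Complex.real_smul]
    push_cast
    ring
  simp_rw [e1]
  -- The Jacobian `2π|t|` of the dilation cancels the factor `‖kernelConst t‖²` produced by the
  -- cubic term.
  rw [Measure.integral_comp_div, hG, integral_smul, smul_smul, integral_const_mul,
    abs_mul, abs_of_pos Real.two_pi_pos, mul_inv_cancel₀ (by positivity), one_smul]

/-- The asymptotic equation satisfied by the Fourier transform of the profile. -/
theorem SigmaBound.fourier_nlsField {φ : L2R} {K : ℝ} (h : SigmaBound φ K) {M : ℝ≥0} {t : ℝ}
    (ht : t ≠ 0) (hM : ∀ᵐ x, ‖freeGroup t φ x‖ ≤ M) (k : ℝ) :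
    ‖𝓕 (nlsField M t φ : ℝ → ℂ) k + Complex.I * (((2 * Real.pi * |t|)⁻¹ *
      ‖𝓕 (φ : ℝ → ℂ) k‖ ^ 2 : ℝ) : ℂ) * 𝓕 (φ : ℝ → ℂ) k‖
      ≤ (2 * Real.pi * |t|)⁻¹ * (12 * (weightConst * K) ^ 3 * |t| ^ (-(1 / 8) : ℝ)) := by
  have hK := h.nonneg
  have hC1 := one_le_weightConst
  have hB0 : 0 ≤ weightConst * K := by positivity
  set B := weightConst * K with hB
  set V : L2R := 𝓕 (phaseMul (chirp t) φ) with hV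
  set v := 𝓕 (phaseMul (chirp t) φ : ℝ → ℂ) with hv
  have hpi1 := integrable_phaseMul (chirp t) h.weight.1
  have hvc : Continuous v := continuous_fourierIntegral hpi1
  have hVv : V =ᵐ[volume] v := coeFn_fourier_ae_eq _ hpi1
  have hvB : ∀ y, ‖v y‖ ≤ B := fun y => h.norm_fourier_chirp_le t y
  -- Since `‖v‖ ≤ B` everywhere, truncating at `B` changes nothing and makes the Lipschitz estimates
  -- for `nl` available for `|v|² v`.
  set N : ℝ≥0 := ⟨B, hB0⟩ with hN
  have hNB : (N : ℝ) = B := rfl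
  set G : L2R := nl N V with hG
  set g : ℝ → ℂ := fun y => truncCubic N (v y) with hg
  have hgeq : ∀ y, g y = ((‖v y‖ ^ 2 : ℝ) : ℂ) * v y := fun y => truncCubic_of_le (hvB y)
  have hgc : Continuous g := (continuous_truncCubic N).comp hvc
  have hGg : G =ᵐ[volume] g := by
    filter_upwards [coeFn_nl N V, hVv] with y h1 h2
    rw [hG, h1, h2]
  have hGi : Integrable G := integrable_nl N
  have hgi : Integrable g := hGi.congr hGg
  have hVB : ∀ᵐ y, ‖V y‖ ≤ B := hVv.mono fun y hy => by rw [hy]; exact hvB y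
  have hVn : ‖V‖ ≤ K := by
    rw [hV, norm_fourier_L2, LinearIsometry.norm_map]; exact h.norm_le
  have hGn : ‖G‖ ≤ 3 * B ^ 2 * K := by
    have h1 := norm_nl_sub_le N (φ := V) (ψ := 0) hVB (by
      filter_upwards [Lp.coeFn_zero ℂ 2 (volume : Measure ℝ)] with y hy
      rw [hy, Pi.zero_apply, norm_zero]; exact hB0)
    rw [nl_zero, sub_zero, sub_zero] at h1
    exact h1.trans (by gcongr)
  -- Translating `V` amounts to modulating `φ`, because modulations commute with the chirp. The
  -- weight bound on `φ` thus becomes an `H^{1,0}` bound for `G`, that is, a weight bound for its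
  -- transform.
  have hGt : ∀ a, ‖transl a G - G‖ ≤ |a| * (3 * B ^ 2 * (2 * Real.pi * K)) := by
    intro a
    have h1 := norm_nl_sub_le N (ae_bound_transl a hVB) hVB
    rw [hG, ← nl_transl]
    refine h1.trans ?_
    have h2 : transl a V = 𝓕 (phaseMul (linPhase (2 * Real.pi * -a)) (phaseMul (chirp t) φ)) := by
      rw [fourier_phaseMul_lin, neg_neg]
    have h3 : ‖transl a V - V‖ ≤ 2 * Real.pi * |a| * K := by
      rw [h2, hV, ← fourier_L2_sub, norm_fourier_L2, phaseMul_phaseMul, add_comm, ← phaseMul_phaseMul,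
        ← map_sub, LinearIsometry.norm_map]
      refine (h _ _ (SigmaSymm.modulation _)).trans (le_of_eq ?_)
      rw [abs_mul, abs_neg, abs_of_pos Real.two_pi_pos]
    calc 3 * B ^ 2 * ‖transl a V - V‖ ≤ 3 * B ^ 2 * (2 * Real.pi * |a| * K) := by gcongr
      _ = _ := by ring
  have hGw : eLpNorm (fun x : ℝ => (x : ℂ) * (𝓕 G : L2R) x) 2 volume
      ≤ ENNReal.ofReal (3 * B ^ 2 * K) := by
    refine (_root_.eLpNorm_id_mul_fourier_le hGt).trans (le_of_eq ?_)
    congr 1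
    field_simp
  obtain ⟨hwi, hwb⟩ := weighted_L1 (φ := 𝓕 G) (by rwa [norm_fourier_L2]) hGw
  have hFGi : Integrable (𝓕 G : L2R) := (L1_of_weight (by rwa [norm_fourier_L2]) hGw).1
  have hFg : (𝓕 G : L2R) =ᵐ[volume] 𝓕 g := by
    refine (coeFn_fourier_ae_eq G hGi).trans (Eventually.of_forall fun y => ?_)
    exact Real.fourier_congr_ae hGg y
  have hFgi : Integrable (𝓕 g) := hFGi.congr hFg
  have ht' : 1 / (4 * Real.pi ^ 2 * t) ≠ 0 := by positivity
  -- The conjugated kernel is that of a free evolution at the dual time `t'`, whose symbol has the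
  -- slow phase `-κ² / (2t)`. Removing this symbol costs another `|t|^{-1/8}`.
  set t' := 1 / (4 * Real.pi ^ 2 * t) with hT
  have hker := schrodinger_kernel hgi hFgi ht' k
  have hinv : g k = ∫ κ, Complex.exp (linPhase (2 * Real.pi * k) κ * Complex.I) * 𝓕 g κ := by
    rw [← fourierInv_eq_integral, hgc.fourierInv_fourier_eq hgi hFgi]
  have hlinm : ∀ {f : ℝ → ℂ} (θ : C(ℝ, ℝ)), Integrable f →
      Integrable fun κ => Complex.exp (θ κ * Complex.I) * f κ := fun θ hf =>
    hf.mono ((Continuous.aestronglyMeasurable (by fun_prop)).mul hf.1)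
      (Eventually.of_forall fun κ => by rw [norm_mul, Complex.norm_exp_ofReal_mul_I, one_mul])
  have hdiff : ‖kernelConst t' * (∫ y, Complex.exp (((k - y) ^ 2 / (2 * t') : ℝ) * Complex.I) * g y)
      - g k‖ ≤ 2 * |t| ^ (-(1 / 8) : ℝ) * (weightConst * (3 * B ^ 2 * K)) := by
    rw [← hker, hinv, ← integral_sub (hlinm _ (hlinm _ hFgi)) (hlinm _ hFgi)]
    have e : ∫ κ, Complex.exp (linPhase (2 * Real.pi * k) κ * Complex.I) *
          (Complex.exp (quadPhase t' κ * Complex.I) * 𝓕 g κ) -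
          Complex.exp (linPhase (2 * Real.pi * k) κ * Complex.I) * 𝓕 g κ
        = ∫ κ, Complex.exp (linPhase (2 * Real.pi * k) κ * Complex.I) *
          ((Complex.exp (quadPhase t' κ * Complex.I) - 1) * (𝓕 G : L2R) κ) := by
      refine integral_congr_ae ?_
      filter_upwards [hFg] with κ hκ
      rw [hκ]; ring
    rw [e, ← inv_abs_rpow]
    refine integral_phase_sub_one_le hwi hwb (by positivity) _ (fun κ => ?_) _
      fun κ => Complex.norm_exp_ofReal_mul_I _
    simp only [quadPhase, ContinuousMap.coe_mk]
    have e2 : -(t' * (2 * Real.pi * κ) ^ 2 / 2) = -(t⁻¹ * κ ^ 2 / 2) := by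
      rw [hT]; field_simp; ring
    rw [e2, abs_neg, abs_div, abs_mul, abs_inv, abs_of_nonneg (sq_nonneg κ), abs_two]
    have : 0 ≤ |t|⁻¹ * κ ^ 2 := by positivity
    linarith
  have hcub : ‖g k - ((‖𝓕 (φ : ℝ → ℂ) k‖ ^ 2 : ℝ) : ℂ) * 𝓕 (φ : ℝ → ℂ) k‖
      ≤ 3 * B ^ 2 * (2 * |t| ^ (-(1 / 8) : ℝ) * B) := by
    have h1 := norm_truncCubic_sub_le N (hvB k) (h.norm_fourier_le k)
    rw [truncCubic_of_le (M := N) (h.norm_fourier_le k)] at h1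
    refine h1.trans ?_
    gcongr
    exact h.fourier_chirp_sub_le t k
  have hmain : 𝓕 (nlsField M t φ : ℝ → ℂ) k = -Complex.I * (((2 * Real.pi * |t|)⁻¹ : ℝ) *
      (kernelConst t' * ∫ y, Complex.exp (((k - y) ^ 2 / (2 * t') : ℝ) * Complex.I) * g y)) := by
    rw [fourier_nlsField_eq h ht hM, kernelConst_dual t ht, ← hT, mul_assoc]
    simp_rw [hgeq]
    rfl
  set A := kernelConst t' * ∫ y, Complex.exp (((k - y) ^ 2 / (2 * t') : ℝ) * Complex.I) * g y
  have hfin : 𝓕 (nlsField M t φ : ℝ → ℂ) k + Complex.I * (((2 * Real.pi * |t|)⁻¹ *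
      ‖𝓕 (φ : ℝ → ℂ) k‖ ^ 2 : ℝ) : ℂ) * 𝓕 (φ : ℝ → ℂ) k = -Complex.I *
      (((2 * Real.pi * |t|)⁻¹ : ℝ) * ((A - g k) +
        (g k - ((‖𝓕 (φ : ℝ → ℂ) k‖ ^ 2 : ℝ) : ℂ) * 𝓕 (φ : ℝ → ℂ) k))) := by
    rw [hmain]
    push_cast
    ring
  rw [hfin, norm_mul, norm_neg, Complex.norm_I, one_mul, norm_mul, Complex.norm_real,
    Real.norm_of_nonneg (by positivity)]
  gcongr
  -- Removing the dual symbol and replacing `v` by the transform of `φ` each contribute `6 B³`,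
  -- whence the constant `12`.
  refine (norm_add_le _ _).trans ((add_le_add hdiff hcub).trans (le_of_eq ?_))
  rw [hB]
  ring

/-! ### Global existence and Gronwall for Lipschitz fields -/

theorem abs_integral_exp_abs_le {a : ℝ} (ha : 0 < a) (t₀ t : ℝ) :
    |∫ s in t₀..t, Real.exp (a * |s - t₀|)| ≤ Real.exp (a * |t - t₀|) / a := by
  rcases le_total t₀ t with h | h
  · have e : ∫ s in t₀..t, Real.exp (a * |s - t₀|) = ∫ s in t₀..t, Real.exp (a * (s - t₀)) := by
      refine intervalIntegral.integral_congr fun s hs => ?_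
      rw [Set.uIcc_of_le h] at hs
      rw [abs_of_nonneg (by linarith [hs.1])]
    have hd : ∀ s ∈ Set.uIcc t₀ t, HasDerivAt (fun s => Real.exp (a * (s - t₀)) / a)
        (Real.exp (a * (s - t₀))) s := fun s _ => by
      have h1 := ((((hasDerivAt_id s).sub_const t₀).const_mul a).exp).div_const a
      refine h1.congr_deriv ?_
      simp only [id]
      field_simp
    rw [e, intervalIntegral.integral_eq_sub_of_hasDerivAt hd
      (Continuous.intervalIntegrable (by fun_prop) _ _), abs_of_nonneg (sub_nonneg.2 h : 0 ≤ t - t₀)]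
    rw [sub_self, mul_zero, Real.exp_zero, ← sub_div, abs_of_nonneg]
    · gcongr; linarith
    · refine div_nonneg ?_ ha.le
      have : 0 ≤ a * (t - t₀) := mul_nonneg ha.le (by linarith)
      linarith [Real.one_le_exp this]
  · have e : ∫ s in t₀..t, Real.exp (a * |s - t₀|) = ∫ s in t₀..t, Real.exp (a * (t₀ - s)) := by
      refine intervalIntegral.integral_congr fun s hs => ?_
      rw [Set.uIcc_of_ge h] at hs
      rw [abs_of_nonpos (by linarith [hs.2]), neg_sub]
    have hd : ∀ s ∈ Set.uIcc t₀ t, HasDerivAt (fun s => -(Real.exp (a * (t₀ - s)) / a))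
        (Real.exp (a * (t₀ - s))) s := fun s _ => by
      have h1 := ((((hasDerivAt_id s).const_sub t₀).const_mul a).exp).div_const a |>.neg
      refine h1.congr_deriv ?_
      simp only [id]
      field_simp
    rw [e, intervalIntegral.integral_eq_sub_of_hasDerivAt hd
      (Continuous.intervalIntegrable (by fun_prop) _ _), abs_of_nonpos (sub_nonpos.2 h : t - t₀ ≤ 0),
      neg_sub t t₀]
    rw [sub_self, mul_zero, Real.exp_zero, neg_sub_neg, ← sub_div, abs_of_nonpos]
    · rw [← neg_div]
      gcongr; linarith
    · refine div_nonpos_of_nonpos_of_nonneg ?_ ha.le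
      have : 0 ≤ a * (t₀ - t) := mul_nonneg ha.le (by linarith)
      linarith [Real.one_le_exp this]

/-- Global existence for a globally Lipschitz vector field vanishing at the origin. -/
theorem exists_global_solution_of_lipschitz {E : Type*} [NormedAddCommGroup E] [NormedSpace ℝ E]
    [CompleteSpace E] (F : ℝ → E → E) (K : ℝ≥0) (hL : ∀ t, LipschitzWith K (F t))
    (hc : ∀ g : ℝ → E, Continuous g → Continuous fun t => F t (g t)) (h0 : ∀ t, F t 0 = 0)
    (t₀ : ℝ) (x₀ : E) : ∃ f : ℝ → E, f t₀ = x₀ ∧ ∀ t, HasDerivAt f (F t (f t)) t := by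
  -- A fixed point is sought for `e^{-a|t-t₀|}` times the solution in the sup norm. With `a = K + 1`
  -- the integral operator contracts by `K / (K + 1)` on the whole line at once.
  set a : ℝ := K + 1 with ha
  have ha0 : 0 < a := by positivity
  let lift : (BoundedContinuousFunction ℝ E) → ℝ → E := fun g t => Real.exp (a * |t - t₀|) • g t
  have hlift : ∀ g, Continuous (lift g) := fun g => by
    change Continuous fun t => Real.exp (a * |t - t₀|) • g t
    fun_prop
  let I : (BoundedContinuousFunction ℝ E) → ℝ → E := fun g t => ∫ s in t₀..t, F s (lift g s)
  have hI : ∀ g t, HasDerivAt (I g) (F t (lift g t)) t := fun g t =>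
    intervalIntegral.integral_hasDerivAt_right ((hc _ (hlift g)).intervalIntegrable _ _)
      (hc _ (hlift g)).aestronglyMeasurable.stronglyMeasurableAtFilter (hc _ (hlift g)).continuousAt
  have hIsub : ∀ g₁ g₂ : BoundedContinuousFunction ℝ E, ∀ t,
      ‖I g₁ t - I g₂ t‖ ≤ K * dist g₁ g₂ * (Real.exp (a * |t - t₀|) / a) := by
    intro g₁ g₂ t
    change ‖(∫ s in t₀..t, F s (lift g₁ s)) - ∫ s in t₀..t, F s (lift g₂ s)‖ ≤ _
    rw [← intervalIntegral.integral_sub ((hc _ (hlift g₁)).intervalIntegrable _ _)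
      ((hc _ (hlift g₂)).intervalIntegrable _ _)]
    have hb : ∀ s, ‖F s (lift g₁ s) - F s (lift g₂ s)‖ ≤ K * dist g₁ g₂ * Real.exp (a * |s - t₀|) := by
      intro s
      have h1 := (hL s).dist_le_mul (lift g₁ s) (lift g₂ s)
      rw [dist_eq_norm] at h1
      refine h1.trans ?_
      change (K : ℝ) * dist (Real.exp (a * |s - t₀|) • g₁ s) (Real.exp (a * |s - t₀|) • g₂ s) ≤ _
      rw [dist_eq_norm, ← smul_sub, norm_smul, Real.norm_of_nonneg (Real.exp_pos _).le, mul_assoc,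
        mul_comm (Real.exp _), ← dist_eq_norm]
      gcongr
      exact BoundedContinuousFunction.dist_coe_le_dist s
    refine (intervalIntegral.norm_integral_le_abs_of_norm_le
      (g := fun s => K * dist g₁ g₂ * Real.exp (a * |s - t₀|)) (Eventually.of_forall hb)
      (Continuous.intervalIntegrable (by fun_prop) _ _)).trans ?_
    rw [intervalIntegral.integral_const_mul, abs_mul, abs_of_nonneg (by positivity)]
    gcongr
    exact abs_integral_exp_abs_le ha0 t₀ t
  -- Vanishing at the origin allows comparison with the zero function, which keeps the image of a
  -- bounded function bounded.
  have hIzero : ∀ t, I 0 t = 0 := fun t => by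
    change ∫ s in t₀..t, F s (Real.exp (a * |s - t₀|) • (0 : E)) = 0
    simp [h0]
  let T : (BoundedContinuousFunction ℝ E) → (BoundedContinuousFunction ℝ E) := fun g =>
    BoundedContinuousFunction.ofNormedAddCommGroup
      (fun t => Real.exp (-(a * |t - t₀|)) • (x₀ + I g t))
      (by
        have : Continuous (I g) := continuous_iff_continuousAt.2 fun t => (hI g t).continuousAt
        fun_prop)
      (‖x₀‖ + K * dist g 0 / a) (by
        intro t
        rw [norm_smul, Real.norm_of_nonneg (Real.exp_pos _).le]
        have h1 := hIsub g 0 t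
        rw [hIzero, sub_zero] at h1
        have h2 : Real.exp (-(a * |t - t₀|)) ≤ 1 := Real.exp_le_one_iff.2 (by
          have := abs_nonneg (t - t₀); nlinarith)
        have h3 : Real.exp (-(a * |t - t₀|)) * Real.exp (a * |t - t₀|) = 1 := by
          rw [← Real.exp_add]; simp
        calc Real.exp (-(a * |t - t₀|)) * ‖x₀ + I g t‖
            ≤ Real.exp (-(a * |t - t₀|)) * (‖x₀‖ + K * dist g 0 * (Real.exp (a * |t - t₀|) / a)) := by
              gcongr
              exact (norm_add_le _ _).trans (by gcongr)
          _ = Real.exp (-(a * |t - t₀|)) * ‖x₀‖ + (Real.exp (-(a * |t - t₀|)) * Real.exp (a * |t - t₀|))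
              * (K * dist g 0 / a) := by ring
          _ ≤ _ := by
              rw [h3, one_mul]
              gcongr
              exact mul_le_of_le_one_left (norm_nonneg _) h2)
  have hT : ContractingWith (K / (K + 1)) T := by
    refine ⟨?_, LipschitzWith.of_dist_le_mul fun g₁ g₂ => ?_⟩
    · rw [← NNReal.coe_lt_coe]
      push_cast
      rw [div_lt_one (by positivity)]
      linarith
    · refine (BoundedContinuousFunction.dist_le (by positivity)).2 fun t => ?_
      change dist (Real.exp (-(a * |t - t₀|)) • (x₀ + I g₁ t)) (Real.exp (-(a * |t - t₀|)) • (x₀ + I g₂ t)) ≤ _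
      rw [dist_eq_norm, ← smul_sub, add_sub_add_left_eq_sub, norm_smul,
        Real.norm_of_nonneg (Real.exp_pos _).le]
      have h3 : Real.exp (-(a * |t - t₀|)) * Real.exp (a * |t - t₀|) = 1 := by
        rw [← Real.exp_add]; simp
      calc Real.exp (-(a * |t - t₀|)) * ‖I g₁ t - I g₂ t‖
          ≤ Real.exp (-(a * |t - t₀|)) * (K * dist g₁ g₂ * (Real.exp (a * |t - t₀|) / a)) := by
            gcongr; exact hIsub _ _ _
        _ = (Real.exp (-(a * |t - t₀|)) * Real.exp (a * |t - t₀|)) * (K / a * dist g₁ g₂) := by ring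
        _ = _ := by rw [h3, one_mul]; push_cast; rfl
  set g := hT.fixedPoint T with hg
  have hfix : ∀ t, lift g t = x₀ + I g t := fun t => by
    have h1 : T g = g := hT.fixedPoint_isFixedPt
    have h2 : Real.exp (-(a * |t - t₀|)) • (x₀ + I g t) = g t := by
      conv_rhs => rw [← h1]
      rfl
    change Real.exp (a * |t - t₀|) • g t = _
    rw [← h2, smul_smul, ← Real.exp_add, add_neg_cancel, Real.exp_zero, one_smul]
  refine ⟨lift g, ?_, fun t => ?_⟩
  · rw [hfix]
    change x₀ + (∫ s in t₀..t₀, F s (lift g s)) = x₀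
    simp
  · have h1 := (hI g t).const_add x₀
    exact h1.congr_of_eventuallyEq (Eventually.of_forall hfix)

theorem norm_le_exp_of_norm_deriv_le {E : Type*} [NormedAddCommGroup E] [NormedSpace ℝ E]
    {g g' : ℝ → E} {k : ℝ} (hg : ∀ t, HasDerivAt g (g' t) t) (hb : ∀ t, ‖g' t‖ ≤ k * ‖g t‖)
    (t₀ t : ℝ) : ‖g t‖ ≤ ‖g t₀‖ * Real.exp (k * |t - t₀|) := by
  rcases le_total t₀ t with h | h
  · have := norm_le_gronwallBound_of_norm_deriv_right_le (f := g) (f' := g') (δ := ‖g t₀‖) (K := k)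
      (ε := 0) (a := t₀) (b := t) (fun s _ => (hg s).continuousAt.continuousWithinAt)
      (fun s _ => (hg s).hasDerivWithinAt) le_rfl (fun s _ => by simpa using hb s) t ⟨h, le_rfl⟩
    rwa [gronwallBound_ε0, ← abs_of_nonneg (sub_nonneg.2 h)] at this
  · have hd : ∀ s, HasDerivAt (fun s => g (-s)) (-g' (-s)) s := fun s => by
      have := (hg (-s)).scomp s (hasDerivAt_neg s)
      rwa [neg_one_smul] at this
    have := norm_le_gronwallBound_of_norm_deriv_right_le (f := fun s => g (-s))
      (f' := fun s => -g' (-s)) (δ := ‖g t₀‖) (K := k)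
      (ε := 0) (a := -t₀) (b := -t) (fun s _ => (hd s).continuousAt.continuousWithinAt)
      (fun s _ => (hd s).hasDerivWithinAt) (by simp) (fun s _ => by simpa using hb (-s)) (-t)
      ⟨by linarith, le_rfl⟩
    rw [gronwallBound_ε0, neg_neg] at this
    rwa [abs_of_nonpos (sub_nonpos.2 h), neg_sub, show t₀ - t = -t - -t₀ by ring]

/-! ### The flow in the interaction picture -/

/-- Solutions of the nonlinear Schrödinger flow in the interaction picture. -/
def IsFlow (M : ℝ≥0) (f : ℝ → L2R) : Prop := ∀ t, HasDerivAt f (nlsField M t (f t)) t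

theorem exists_isFlow (M : ℝ≥0) (φ : L2R) : ∃ f, f 1 = φ ∧ IsFlow M f :=
  exists_global_solution_of_lipschitz (nlsField M) (3 * M ^ 2) (nlsField_lipschitz M)
    (fun _ hg => continuous_nlsField M hg) (nlsField_zero M) 1 φ

theorem IsFlow.continuous {M : ℝ≥0} {f : ℝ → L2R} (hf : IsFlow M f) : Continuous f :=
  continuous_iff_continuousAt.2 fun t => (hf t).continuousAt

theorem IsFlow.hasDerivAt_symm {M : ℝ≥0} {f : ℝ → L2R} (hf : IsFlow M f) (R : L2R →ₗᵢ[ℂ] L2R)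
    (t : ℝ) : HasDerivAt (fun s => R (f s) - f s)
      (R (nlsField M t (f t)) - nlsField M t (f t)) t :=
  ((R.toContinuousLinearMap.restrictScalars ℝ).hasFDerivAt.comp_hasDerivAt t (hf t)).sub (hf t)

/-- By symmetry the derivative of `R f - f` is the difference of the field at `R f` and at `f`, so
Gronwall applies for each `R` separately, with a rate independent of `R`. -/
theorem IsFlow.sigmaBound {M : ℝ≥0} {f : ℝ → L2R} (hf : IsFlow M f) {t₀ K : ℝ}
    (h : SigmaBound (f t₀) K) (t : ℝ) :
    SigmaBound (f t) (K * Real.exp (3 * M ^ 2 * |t - t₀|)) := by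
  intro R w hR
  have h1 := norm_le_exp_of_norm_deriv_le (hf.hasDerivAt_symm R)
    (fun s => norm_nlsField_symm_sub_le' hR.isSymm M s (f s)) t₀ t
  refine h1.trans ?_
  rw [← mul_assoc]
  gcongr
  exact h R w hR

/-! ### Continuity in time with values in `H^{1,0} ∩ H^{0,1}` -/

theorem SigmaBound.of_sub {φ ψ : L2R} {K : ℝ}
    (h : ∀ R w, SigmaSymm R w → ‖(R φ - φ) - (R ψ - ψ)‖ ≤ w * K) : SigmaBound (φ - ψ) K := by
  intro R w hR
  rw [map_sub, sub_sub_sub_comm]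
  exact h R w hR

theorem SigmaBound.add {φ ψ : L2R} {K K' : ℝ} (h : SigmaBound φ K) (h' : SigmaBound ψ K') :
    SigmaBound (φ + ψ) (K + K') := by
  intro R w hR
  rw [map_add, add_sub_add_comm, mul_add]
  exact (norm_add_le _ _).trans (add_le_add (h R w hR) (h' R w hR))

theorem SigmaBound.neg {φ : L2R} {K : ℝ} (h : SigmaBound φ K) : SigmaBound (-φ) K := by
  intro R w hR
  rw [map_neg, ← neg_sub', norm_neg]
  exact h R w hR

theorem SigmaBound.sub {φ ψ : L2R} {K K' : ℝ} (h : SigmaBound φ K) (h' : SigmaBound ψ K') :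
    SigmaBound (φ - ψ) (K + K') := by
  rw [sub_eq_add_neg]
  exact h.add h'.neg

theorem SigmaBound.smul {φ : L2R} {K : ℝ} (h : SigmaBound φ K) (c : ℝ) :
    SigmaBound (c • φ) (|c| * K) := by
  intro R w hR
  have e : R (c • φ) = c • R φ := (R.toLinearMap.restrictScalars ℝ).map_smul c φ
  rw [e, ← smul_sub, norm_smul, Real.norm_eq_abs]
  calc |c| * ‖R φ - φ‖ ≤ |c| * (w * K) := by gcongr; exact h R w hR
    _ = _ := by ring

/-- The flow is Lipschitz in time with values in `H^{1,0} ∩ H^{0,1}`. -/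
theorem IsFlow.sigmaBound_sub {M : ℝ≥0} {f : ℝ → L2R} (hf : IsFlow M f) {s t K : ℝ}
    (h : ∀ r ∈ Set.uIcc s t, SigmaBound (f r) K) :
    SigmaBound (f t - f s) (3 * M ^ 2 * K * |t - s|) := by
  refine SigmaBound.of_sub fun R w hR => ?_
  have h1 := (convex_uIcc s t).norm_image_sub_le_of_norm_hasDerivWithin_le
    (f := fun r => R (f r) - f r) (C := 3 * M ^ 2 * (w * K))
    (fun r _ => (hf.hasDerivAt_symm R r).hasDerivWithinAt) (fun r hr => by
      refine (norm_nlsField_symm_sub_le' hR.isSymm M r (f r)).trans ?_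
      gcongr
      exact h r hr R w hR) Set.left_mem_uIcc Set.right_mem_uIcc
  refine h1.trans (le_of_eq ?_)
  rw [Real.norm_eq_abs]
  ring

/-- The Weyl form of conjugating `x` into `x - it∂ₓ`: splitting the modulation into two equal halves
around the translation absorbs the constant phase of the Galilean relation. -/
theorem freeGroup_modulation_conj (t h : ℝ) (φ : L2R) :
    phaseMul (linPhase h) (freeGroup t φ) = freeGroup t (phaseMul (linPhase (h / 2))
      (transl (t * h) (phaseMul (linPhase (h / 2)) φ))) := by
  have h1 := freeGroup_modulation (-t) h (freeGroup t φ)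
  rw [freeGroup_neg_apply] at h1
  rw [← freeGroup_apply_neg t (phaseMul (linPhase h) (freeGroup t φ)), h1, transl_phaseMul,
    transl_phaseMul, phaseMul_phaseMul, phaseMul_phaseMul]
  have e : -(-t * h) = t * h := by ring
  rw [e]
  congr 3
  ext x
  simp [linPhase]
  ring

/-- The free group preserves `H^{1,0} ∩ H^{0,1}`. -/
theorem sigmaBound_freeGroup {φ : L2R} {K : ℝ} (h : SigmaBound φ K) (t : ℝ) :
    SigmaBound (freeGroup t φ) ((1 + |t|) * K) := by
  have hK := h.nonneg
  intro R w hR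
  have hw := hR.nonneg
  have hle : w * K ≤ w * ((1 + |t|) * K) := by
    gcongr
    nlinarith [abs_nonneg t]
  cases hR with
  | neg =>
    refine le_trans ?_ hle
    have := h _ _ SigmaSymm.neg
    rwa [negIsom_apply, ← map_neg, ← map_sub, LinearIsometry.norm_map]
  | transl a =>
    refine le_trans ?_ hle
    rw [← freeGroup_transl, ← map_sub, LinearIsometry.norm_map]
    exact h _ _ (SigmaSymm.transl a)
  | modulation a =>
    rw [freeGroup_modulation_conj, ← map_sub, LinearIsometry.norm_map]
    have h1 := h _ _ (SigmaSymm.modulation (a / 2))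
    have h2 := h _ _ (SigmaSymm.transl (t * a))
    set E := phaseMul (linPhase (a / 2))
    have e : E (transl (t * a) (E φ)) - φ
        = E (transl (t * a) (E φ - φ)) + E (transl (t * a) φ - φ) + (E φ - φ) := by
      simp only [map_sub]; abel
    rw [e]
    refine (norm_add_le _ _).trans ((add_le_add_left (norm_add_le _ _) _).trans ?_)
    rw [LinearIsometry.norm_map, LinearIsometry.norm_map, LinearIsometry.norm_map]
    rw [abs_div, abs_two] at h1
    rw [abs_mul] at h2
    linarith

theorem norm_phaseMul_const_sub_le (c : ℝ) (φ : L2R) :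
    ‖phaseMul (ContinuousMap.const ℝ c) φ - φ‖ ≤ |c| * ‖φ‖ := by
  refine Lp.norm_le_mul_norm_of_ae_le_mul ?_
  filter_upwards [Lp.coeFn_sub (phaseMul (ContinuousMap.const ℝ c) φ) φ,
    coeFn_phaseMul (ContinuousMap.const ℝ c) φ] with x h1 h2
  rw [h1, Pi.sub_apply, h2, ContinuousMap.const_apply, ← sub_one_mul, norm_mul]
  gcongr
  exact norm_exp_mul_I_sub_one_le c

theorem memLp_id_mul {φ : L2R} {K : ℝ}
    (h : eLpNorm (fun x : ℝ => (x : ℂ) * φ x) 2 volume ≤ ENNReal.ofReal K) :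
    MemLp (fun x : ℝ => (x : ℂ) * φ x) 2 volume :=
  ⟨(Continuous.aestronglyMeasurable (by fun_prop)).mul (Lp.aestronglyMeasurable φ),
    h.trans_lt ENNReal.ofReal_lt_top⟩

theorem tendsto_inv_smul_modulation_sub {φ X : L2R} (hX : X =ᵐ[volume] fun x : ℝ => (x : ℂ) * φ x)
    {h : ℕ → ℝ} (hl : Tendsto h atTop (𝓝[≠] 0)) :
    Tendsto (fun n => ((h n : ℝ) : ℂ)⁻¹ • (phaseMul (linPhase (h n)) φ - φ)) atTop
      (𝓝 (Complex.I • X)) := by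
  refine L2R_tendsto_of_dominated
    (fun n x => (((h n : ℝ) : ℂ)⁻¹ * (Complex.exp (linPhase (h n) x * Complex.I) - 1)) * φ x)
    (fun x => (Complex.I * x) * φ x) (fun x => (2 * ‖X x‖) ^ 2) ?_ ?_ ?_ ?_ ?_
  · simp_rw [mul_pow]
    exact (L2R_integrable_sq X).const_mul _
  · intro n
    filter_upwards [Lp.coeFn_smul ((h n : ℝ) : ℂ)⁻¹ (phaseMul (linPhase (h n)) φ - φ),
      Lp.coeFn_sub (phaseMul (linPhase (h n)) φ) φ, coeFn_phaseMul (linPhase (h n)) φ]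
      with x h1 h2 h3
    rw [h1, Pi.smul_apply, h2, Pi.sub_apply, h3, smul_eq_mul]
    ring
  · filter_upwards [Lp.coeFn_smul Complex.I X, hX] with x h1 h2
    rw [h1, Pi.smul_apply, h2, smul_eq_mul, mul_assoc]
  · refine Eventually.of_forall fun n => ?_
    filter_upwards [hX] with x hx
    rw [hx]
    gcongr
    refine (norm_sub_le _ _).trans ?_
    rw [norm_mul, norm_mul, norm_mul, norm_mul, norm_mul, Complex.norm_I, one_mul, norm_inv,
      Complex.norm_real, Complex.norm_real, two_mul]
    gcongr
    rcases eq_or_ne (h n) 0 with h0 | h0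
    · rw [h0]; simp
    rw [inv_mul_le_iff₀ (norm_pos_iff.2 h0), ← norm_mul]
    exact norm_exp_mul_I_sub_one_le _
  · exact Eventually.of_forall fun x => (tendsto_modulation_quotient x hl).mul_const _

/-- Strong continuity of the free group on `H^{1,0} ∩ H^{0,1}` at time zero. -/
theorem SigmaBound.tendsto_freeGroup_sub {φ : L2R} {K : ℝ} (h : SigmaBound φ K) :
    ∃ κ : ℝ → ℝ, Tendsto κ (𝓝 0) (𝓝 0) ∧ ∀ t, SigmaBound (freeGroup t φ - φ) (κ t) := by
  have hK := h.nonneg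
  set P : L2R := (memLp_id_mul h.eLpNorm_id_mul_fourier_le).toLp _ with hP
  have hPe : P =ᵐ[volume] fun k : ℝ => (k : ℂ) * (𝓕 φ : L2R) k := MemLp.coeFn_toLp _
  set X : L2R := (memLp_id_mul h.eLpNorm_id_mul_le).toLp _ with hX
  have hXe : X =ᵐ[volume] fun x : ℝ => (x : ℂ) * φ x := MemLp.coeFn_toLp _
  -- The three contributions bound the `L²`, derivative and weight parts. In the last one `|t| K`
  -- comes from the commutator of `x` with the free group.
  refine ⟨fun t => ‖freeGroup t φ - φ‖ + 2 * Real.pi * ‖phaseMul (quadPhase t) P - P‖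
    + (|t| * K + ‖freeGroup t X - X‖), ?_, fun t => ?_⟩
  · have h1 : ∀ ψ : L2R, Tendsto (fun t => ‖freeGroup t ψ - ψ‖) (𝓝 0) (𝓝 0) := fun ψ => by
      have := tendsto_freeGroup 0 ψ
      rw [freeGroup_zero] at this
      exact tendsto_iff_norm_sub_tendsto_zero.1 this
    have h2 : Tendsto (fun t => ‖phaseMul (quadPhase t) P - P‖) (𝓝 0) (𝓝 0) := by
      have : Tendsto (fun t => phaseMul (quadPhase t) P) (𝓝 0) (𝓝 (phaseMul 0 P)) := by
        refine tendsto_phaseMul (fun x => ?_) P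
        have : Continuous fun s : ℝ => -(s * (2 * Real.pi * x) ^ 2 / 2) := by fun_prop
        simpa [quadPhase] using this.tendsto 0
      rw [phaseMul_zero] at this
      exact tendsto_iff_norm_sub_tendsto_zero.1 this
    have h3 : Tendsto (fun t : ℝ => |t| * K) (𝓝 0) (𝓝 0) := by
      have : Continuous fun t : ℝ => |t| * K := by fun_prop
      simpa using this.tendsto 0
    simpa using ((h1 φ).add (h2.const_mul (2 * Real.pi))).add (h3.add (h1 X))
  · have hn1 := norm_nonneg (freeGroup t φ - φ)
    have hn2 : 0 ≤ 2 * Real.pi * ‖phaseMul (quadPhase t) P - P‖ := by positivity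
    have hn3 : 0 ≤ |t| * K + ‖freeGroup t X - X‖ := by positivity
    refine SigmaBound.of_eLpNorm (by linarith) ?_ ?_
    · set s : ℕ → ℝ := fun n => 1 / ((n : ℝ) + 1) with hs
      have hs0 : ∀ n, 0 < s n := fun n => by positivity
      have hsl : Tendsto s atTop (𝓝[≠] 0) :=
        tendsto_nhdsWithin_iff.2 ⟨tendsto_one_div_add_atTop_nhds_zero_nat,
          Eventually.of_forall fun n => (hs0 n).ne'⟩
      have hq := tendsto_inv_smul_modulation_sub hXe hsl
      set D : ℕ → L2R := fun n => ((s n : ℝ) : ℂ)⁻¹ • (phaseMul (linPhase (s n)) φ - φ) with hD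
      have hDn : Tendsto (fun n => |t| * K + ‖freeGroup t (D n) - D n‖) atTop
          (𝓝 (|t| * K + ‖freeGroup t X - X‖)) := by
        have h1 := ((freeGroup_tendsto (tendsto_const_nhds (x := t)) hq).sub hq).norm
        rw [map_smul, ← smul_sub, norm_smul, Complex.norm_I, one_mul] at h1
        exact h1.const_add _
      -- The extra term `2 s |t| K` covers the constant phase of second order in `s`. It disappears
      -- in the limit.
      have hDn2 : Tendsto (fun n => |t| * K + ‖freeGroup t (D n) - D n‖ + 2 * s n * |t| * K) atTop
          (𝓝 (|t| * K + ‖freeGroup t X - X‖)) := by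
        have h0 : Tendsto s atTop (𝓝 0) := hsl.mono_right nhdsWithin_le_nhds
        simpa using hDn.add (((h0.const_mul 2).mul_const |t|).mul_const K)
      refine (eLpNorm_id_mul_le_of_tendsto hDn2 fun n => ?_).trans
        (ENNReal.ofReal_le_ofReal (by linarith))
      change ‖phaseMul (linPhase (s n)) _ - _‖ ≤ s n * _
      have hsn := hs0 n
      have hinv : phaseMul (linPhase (s n)) φ - φ = ((s n : ℝ) : ℂ) • D n := by
        rw [hD]
        simp only
        rw [smul_smul, mul_inv_cancel₀ (Complex.ofReal_ne_zero.2 hsn.ne'), one_smul]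
      set E := phaseMul (linPhase (s n / 2)) with hE
      have hEE : phaseMul (linPhase (s n)) φ = E (E φ) := by
        rw [hE, phaseMul_phaseMul]
        congr 2
        ext x
        simp [linPhase]
        ring
      have htr : transl (t * s n) (E φ)
          = E (phaseMul (ContinuousMap.const ℝ (t * s n ^ 2 / 2)) (transl (t * s n) φ)) := by
        rw [hE, transl_phaseMul, phaseMul_phaseMul]
        congr 2
        ext x
        simp [linPhase]
        ring
      -- The first term is the commutator, essentially a translation by `t s`. The second, divided
      -- by `s`, tends in norm to `‖freeGroup t X - X‖`.
      have hsplit : phaseMul (linPhase (s n)) (freeGroup t φ - φ) - (freeGroup t φ - φ)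
          = freeGroup t (E (transl (t * s n) (E φ) - E φ))
            + (freeGroup t (phaseMul (linPhase (s n)) φ - φ) - (phaseMul (linPhase (s n)) φ - φ)) := by
        rw [map_sub, freeGroup_modulation_conj, ← hE, hEE]
        simp only [map_sub]
        abel
      have hfst : ‖transl (t * s n) (E φ) - E φ‖ ≤ s n * (|t| * K + 2 * s n * |t| * K) := by
        rw [htr, ← map_sub, LinearIsometry.norm_map]
        have h1 := norm_phaseMul_const_sub_le (t * s n ^ 2 / 2) (transl (t * s n) φ)
        have h2 := h _ _ (SigmaSymm.transl (t * s n))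
        rw [LinearIsometry.norm_map, abs_div, abs_mul, abs_two, abs_of_nonneg (sq_nonneg (s n))] at h1
        rw [abs_mul, abs_of_pos hsn] at h2
        have h3 := norm_add_le (phaseMul (ContinuousMap.const ℝ (t * s n ^ 2 / 2))
          (transl (t * s n) φ) - transl (t * s n) φ) (transl (t * s n) φ - φ)
        rw [sub_add_sub_cancel] at h3
        have h4 : |t| * s n ^ 2 / 2 * ‖φ‖ ≤ |t| * s n ^ 2 / 2 * K := by gcongr; exact h.norm_le
        have h5 : 0 ≤ |t| * s n ^ 2 * K := by positivity
        nlinarith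
      rw [hsplit]
      refine (norm_add_le _ _).trans ?_
      rw [LinearIsometry.norm_map, LinearIsometry.norm_map, hinv, map_smul, ← smul_sub, norm_smul,
        Complex.norm_real, Real.norm_of_nonneg hsn.le]
      linarith
    · have e : eLpNorm (fun x : ℝ => (x : ℂ) * (𝓕 (freeGroup t φ - φ) : L2R) x) 2 volume
          = eLpNorm (phaseMul (quadPhase t) P - P : L2R) 2 volume := by
        refine eLpNorm_congr_ae ?_
        rw [fourier_L2_sub, fourier_freeGroup]
        filter_upwards [Lp.coeFn_sub (phaseMul (quadPhase t) (𝓕 φ)) (𝓕 φ),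
          coeFn_phaseMul (quadPhase t) (𝓕 φ), Lp.coeFn_sub (phaseMul (quadPhase t) P) P,
          coeFn_phaseMul (quadPhase t) P, hPe] with k h1 h2 h3 h4 h5
        rw [h1, h3, Pi.sub_apply, Pi.sub_apply, h2, h4, h5]
        ring
      rw [e, L2R_eLpNorm]
      apply ENNReal.ofReal_le_ofReal
      rw [le_div_iff₀ Real.two_pi_pos]
      linarith

theorem IsFlow.exists_sigmaBound_Icc {M : ℝ≥0} {f : ℝ → L2R} (hf : IsFlow M f) {t₀ K : ℝ}
    (h : SigmaBound (f t₀) K) (T : ℝ) : ∃ K', ∀ r, |r| ≤ T → SigmaBound (f r) K' := by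
  have hK := h.nonneg
  refine ⟨K * Real.exp (3 * M ^ 2 * (T + |t₀|)), fun r hr => (hf.sigmaBound h r).mono ?_⟩
  gcongr
  exact (abs_sub r t₀).trans (by linarith)

theorem abs_le_of_mem_uIcc {s t r T : ℝ} (hs : |s| ≤ T) (ht : |t| ≤ T) (hr : r ∈ Set.uIcc s t) :
    |r| ≤ T := by
  rw [abs_le] at *
  rcases Set.mem_uIcc.1 hr with h | h <;> constructor <;> linarith

/-- Local Lipschitz continuity of the flow in `H^{1,0} ∩ H^{0,1}`. -/
theorem IsFlow.exists_sigmaBound_sub {M : ℝ≥0} {f : ℝ → L2R} (hf : IsFlow M f) {t₀ K : ℝ}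
    (h : SigmaBound (f t₀) K) (T : ℝ) :
    ∃ C, ∀ s t, |s| ≤ T → |t| ≤ T → SigmaBound (f t - f s) (C * |t - s|) := by
  obtain ⟨K', hK'⟩ := hf.exists_sigmaBound_Icc h T
  exact ⟨3 * M ^ 2 * K', fun s t hs ht => hf.sigmaBound_sub fun r hr =>
    hK' r (abs_le_of_mem_uIcc hs ht hr)⟩

/-- The solution is continuous with values in `H^{1,0} ∩ H^{0,1}`. -/
theorem IsFlow.tendsto_sigma {M : ℝ≥0} {f : ℝ → L2R} (hf : IsFlow M f) {t₀ K : ℝ}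
    (h : SigmaBound (f t₀) K) (t : ℝ) : ∃ κ : ℝ → ℝ, Tendsto κ (𝓝 t) (𝓝 0) ∧
      ∀ᶠ s in 𝓝 t, SigmaBound (freeGroup s (f s) - freeGroup t (f t)) (κ s) := by
  obtain ⟨C, hC⟩ := hf.exists_sigmaBound_sub h (|t| + 1)
  obtain ⟨κ, hκ, hb⟩ := (hf.sigmaBound h t).tendsto_freeGroup_sub
  refine ⟨fun s => (1 + |s|) * (C * |s - t|) + (1 + |t|) * κ (s - t), ?_, ?_⟩
  · have h1 : Tendsto (fun s => (1 + |s|) * (C * |s - t|)) (𝓝 t) (𝓝 0) := by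
      have : Continuous fun s => (1 + |s|) * (C * |s - t|) := by fun_prop
      simpa using this.tendsto t
    have h2 : Tendsto (fun s => κ (s - t)) (𝓝 t) (𝓝 0) := by
      refine hκ.comp ?_
      have : Continuous fun s : ℝ => s - t := by fun_prop
      simpa using this.tendsto t
    simpa using h1.add (h2.const_mul (1 + |t|))
  · have hev : ∀ᶠ s in 𝓝 t, |s| ≤ |t| + 1 := by
      have : ∀ᶠ s in 𝓝 t, |s| < |t| + 1 :=
        (continuous_abs.tendsto t).eventually (eventually_lt_nhds (by linarith))
      exact this.mono fun s hs => hs.le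
    filter_upwards [hev] with s hs
    have e : freeGroup s (f s) - freeGroup t (f t)
        = freeGroup s (f s - f t) + freeGroup t (freeGroup (s - t) (f t) - f t) := by
      rw [map_sub, map_sub, freeGroup_freeGroup, add_sub_cancel]
      abel
    rw [e]
    exact (sigmaBound_freeGroup (hC t s (by linarith) hs) s).add (sigmaBound_freeGroup (hb _) t)

/-! ### Differentiating the Fourier integral at a fixed frequency -/

theorem integral_norm_le_split {φ : L2R} {K : ℝ} (h : SigmaBound φ K) {R δ : ℝ} (hR : 0 < R)
    (hδ : 0 < δ) : ∫ x, ‖φ x‖ ≤ δ * R + ‖φ‖ ^ 2 / (2 * δ) + (R ^ (1 / 4 : ℝ))⁻¹ * (weightConst * K) := by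
  obtain ⟨hi, hb⟩ := weighted_L1 h.norm_le h.eLpNorm_id_mul_le
  have h1 : Integrable ((Set.Icc (-R) R).indicator fun _ : ℝ => δ / 2) :=
    (integrable_indicator_iff measurableSet_Icc).2 (by simp [integrableOn_const_iff])
  have h2 : Integrable fun x => ‖φ x‖ ^ 2 / (2 * δ) := (L2R_integrable_sq φ).div_const _
  have h3 := hi.const_mul (R ^ (1 / 4 : ℝ))⁻¹
  -- On `[-R, R]` Young's inequality trades the modulus for its square; outside, the spare weight is
  -- at least `R^{1/4}`.
  have hpt : ∀ x, ‖φ x‖ ≤ ((Set.Icc (-R) R).indicator (fun _ : ℝ => δ / 2) x + ‖φ x‖ ^ 2 / (2 * δ))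
      + (R ^ (1 / 4 : ℝ))⁻¹ * ((1 + x ^ 2 : ℝ) ^ (1 / 8 : ℝ) * ‖φ x‖) := fun x => by
    by_cases hx : x ∈ Set.Icc (-R) R
    · rw [Set.indicator_of_mem hx]
      have e1 : ‖φ x‖ ≤ δ / 2 + ‖φ x‖ ^ 2 / (2 * δ) := by
        have : 0 ≤ (δ - ‖φ x‖) ^ 2 / (2 * δ) := by positivity
        have e : (δ - ‖φ x‖) ^ 2 / (2 * δ) = δ / 2 + ‖φ x‖ ^ 2 / (2 * δ) - ‖φ x‖ := by
          field_simp; ring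
        linarith
      have e2 : 0 ≤ (R ^ (1 / 4 : ℝ))⁻¹ * ((1 + x ^ 2 : ℝ) ^ (1 / 8 : ℝ) * ‖φ x‖) := by positivity
      linarith
    · rw [Set.indicator_of_notMem hx]
      have hx' : R < |x| := by
        by_contra hcon
        exact hx (abs_le.1 (not_lt.1 hcon))
      have e1 : R ^ (1 / 4 : ℝ) ≤ (1 + x ^ 2 : ℝ) ^ (1 / 8 : ℝ) := by
        have : R ^ (1 / 4 : ℝ) = (R ^ 2) ^ (1 / 8 : ℝ) := by
          rw [← Real.rpow_natCast_mul hR.le]; norm_num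
        rw [this]
        gcongr
        nlinarith [sq_abs x]
      have e2 : ‖φ x‖ ≤ (R ^ (1 / 4 : ℝ))⁻¹ * ((1 + x ^ 2 : ℝ) ^ (1 / 8 : ℝ) * ‖φ x‖) := by
        rw [← mul_assoc]
        refine le_mul_of_one_le_left (norm_nonneg _) ?_
        rw [← div_eq_inv_mul, one_le_div (by positivity)]
        exact e1
      have e3 : 0 ≤ ‖φ x‖ ^ 2 / (2 * δ) := by positivity
      linarith
  refine (integral_mono h.weight.1.norm ((h1.add h2).add h3) hpt).trans ?_
  rw [integral_add' (h1.add h2) h3, integral_add' h1 h2, integral_indicator measurableSet_Icc,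
    integral_const_mul]
  have e' : ∫ x, ‖φ x‖ ^ 2 / (2 * δ) = ‖φ‖ ^ 2 / (2 * δ) := by
    rw [integral_div, ← L2R_norm_sq]
  have e : ∫ _ in Set.Icc (-R) R, δ / 2 = δ * R := by
    rw [setIntegral_const, smul_eq_mul, Real.volume_real_Icc_of_le (by linarith)]
    ring
  rw [e, e']
  gcongr

/-- Smallness in `L²` together with a uniform weight bound gives smallness in `L¹`: choose `R` to
control the tail, then `δ` with `δR = e/3`, then use the `L²` limit. It upgrades an `L²` derivative
to a derivative at each frequency. -/
theorem tendsto_fourier_of_sigmaBound {ι : Type*} {l : Filter ι} {D : ι → L2R} {C : ℝ}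
    (h0 : Tendsto D l (𝓝 0)) (hC : ∀ᶠ i in l, SigmaBound (D i) C) (k : ℝ) :
    Tendsto (fun i => 𝓕 (D i : ℝ → ℂ) k) l (𝓝 0) := by
  rw [Metric.tendsto_nhds]
  intro e he
  have hlim : Tendsto (fun R : ℝ => (R ^ (1 / 4 : ℝ))⁻¹ * (weightConst * C)) atTop (𝓝 0) := by
    have := (tendsto_rpow_atTop (show (0 : ℝ) < 1 / 4 by norm_num)).inv_tendsto_atTop
    simpa using this.mul_const (weightConst * C)
  obtain ⟨R, hRe, hR⟩ := ((hlim.eventually (eventually_lt_nhds (show (0 : ℝ) < e / 3 by positivity))).and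
    (eventually_gt_atTop 0)).exists
  set δ := e / (3 * R) with hδ
  have hδ0 : 0 < δ := by positivity
  have hδR : δ * R = e / 3 := by rw [hδ]; field_simp
  have hn : Tendsto (fun i => ‖D i‖ ^ 2 / (2 * δ)) l (𝓝 0) := by
    simpa using (h0.norm.pow 2).div_const (2 * δ)
  filter_upwards [hC, hn.eventually (eventually_lt_nhds (show (0 : ℝ) < e / 3 by positivity))] with i h1 h2
  rw [dist_zero_right]
  have h3 := (norm_fourier_le_integral (D i) k).trans (integral_norm_le_split h1 hR hδ0)
  linarith

theorem fourier_integral_sub {φ ψ : L2R} (h1 : Integrable φ) (h2 : Integrable ψ) (k : ℝ) :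
    𝓕 ((φ - ψ : L2R) : ℝ → ℂ) k = 𝓕 (φ : ℝ → ℂ) k - 𝓕 (ψ : ℝ → ℂ) k := by
  rw [Real.fourier_congr_ae (Lp.coeFn_sub φ ψ), fourier_eq_integral, fourier_eq_integral,
    fourier_eq_integral, ← integral_sub]
  · congr 1
    ext x
    rw [Pi.sub_apply]
    ring
  · exact (integrable_phaseMul (linPhase _) h1).congr (coeFn_phaseMul _ _)
  · exact (integrable_phaseMul (linPhase _) h2).congr (coeFn_phaseMul _ _)

/-- The Fourier transform of the profile at a fixed frequency is differentiable in time. -/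
theorem IsFlow.hasDerivAt_fourier {M : ℝ≥0} {f : ℝ → L2R} (hf : IsFlow M f) {t₀ K : ℝ}
    (h : SigmaBound (f t₀) K) (t k : ℝ) :
    HasDerivAt (fun s => 𝓕 (f s : ℝ → ℂ) k) (𝓕 (nlsField M t (f t) : ℝ → ℂ) k) t := by
  have hS : ∀ s, Integrable (f s) := fun s => (hf.sigmaBound h s).weight.1
  obtain ⟨C, hC⟩ := hf.exists_sigmaBound_sub h (|t| + 1)
  have hF := nlsField_sigmaBound' (hf.sigmaBound h t) M t
  set F := nlsField M t (f t) with hFdef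
  rw [hasDerivAt_iff_tendsto_slope]
  have hslope := hasDerivAt_iff_tendsto_slope.1 (hf t)
  have h0 : Tendsto (fun s => slope f t s - F) (𝓝[≠] t) (𝓝 0) := by
    have h := hslope.sub_const F
    rwa [show nlsField M t (f t) - F = 0 from sub_self _] at h
  have hev : ∀ᶠ s in 𝓝[≠] t, |s| ≤ |t| + 1 := by
    have : ∀ᶠ s in 𝓝 t, |s| < |t| + 1 :=
      (continuous_abs.tendsto t).eventually (eventually_lt_nhds (by linarith))
    exact (this.filter_mono nhdsWithin_le_nhds).mono fun s hs => hs.le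
  -- The local Lipschitz bound makes the difference quotients uniformly bounded in the weighted
  -- space.
  have hsb : ∀ᶠ s in 𝓝[≠] t, SigmaBound (slope f t s) C := by
    filter_upwards [hev, self_mem_nhdsWithin] with s hs hne
    have h1 := (hC t s (by linarith) hs).smul (s - t)⁻¹
    rw [slope_def_module]
    refine h1.mono (le_of_eq ?_)
    have : |s - t| ≠ 0 := abs_ne_zero.2 (sub_ne_zero.2 hne)
    rw [abs_inv]
    field_simp
  have h1 := tendsto_fourier_of_sigmaBound h0 (hsb.mono fun s hs => hs.sub hF) k
  have h2 := h1.add_const (𝓕 (F : ℝ → ℂ) k)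
  rw [zero_add] at h2
  refine h2.congr' ?_
  filter_upwards [hsb] with s hs
  rw [fourier_integral_sub hs.weight.1 hF.weight.1, sub_add_cancel, slope_def_module,
    slope_def_module]
  have e : (s - t)⁻¹ • (f s - f t) = (((s - t)⁻¹ : ℝ) : ℂ) • (f s - f t) :=
    (Complex.coe_smul _ _).symm
  rw [e, fourier_integral_smul, fourier_integral_sub (hS s) (hS t), Complex.real_smul]

/-! ### Phase correction of the asymptotic equation -/

/-- Solutions of `y' = -iσ|y|²y/(2πs) + O(s^{-17/16})` converge after a phase correction. -/
theorem norm_phase_corrected_sub_le {y y' : ℝ → ℂ} {σ A T : ℝ}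
    (hy : ∀ s, HasDerivAt y (y' s) s)
    (hb : ∀ s, 1 ≤ s → s ≤ T → ‖y' s + Complex.I * σ * (((2 * Real.pi * s)⁻¹ * ‖y s‖ ^ 2 : ℝ) : ℂ) * y s‖
      ≤ A * s ^ (-(17 / 16) : ℝ)) {s t : ℝ} (hs : 1 ≤ s) (hst : s ≤ t) (ht : t ≤ T) :
    ‖y t * Complex.exp (Complex.I * σ * ((∫ r in (1 : ℝ)..t, (2 * Real.pi * r)⁻¹ * ‖y r‖ ^ 2 : ℝ) : ℂ))
      - y s * Complex.exp (Complex.I * σ * ((∫ r in (1 : ℝ)..s, (2 * Real.pi * r)⁻¹ * ‖y r‖ ^ 2 : ℝ) : ℂ))‖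
      ≤ 16 * A * (s ^ (-(1 / 16) : ℝ) - t ^ (-(1 / 16) : ℝ)) := by
  set p : ℝ → ℝ := fun r => (2 * Real.pi * r)⁻¹ * ‖y r‖ ^ 2 with hp
  have hyc : Continuous y := continuous_iff_continuousAt.2 fun r => (hy r).continuousAt
  have hpc : ContinuousOn p (Set.Ioi 0) := by
    refine ContinuousOn.mul (ContinuousOn.inv₀ (by fun_prop) fun r hr => ?_) (by fun_prop)
    exact mul_ne_zero Real.two_pi_pos.ne' (ne_of_gt hr)
  have hP : ∀ r, 1 ≤ r → HasDerivAt (fun r => ∫ q in (1 : ℝ)..r, p q) (p r) r := fun r hr => by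
    have hr0 : (0 : ℝ) < r := by linarith
    refine intervalIntegral.integral_hasDerivAt_right ?_ ?_ (hpc.continuousAt (Ioi_mem_nhds hr0))
    · refine (hpc.mono fun q hq => ?_).intervalIntegrable
      rw [Set.uIcc_of_le hr] at hq
      exact lt_of_lt_of_le one_pos hq.1
    · exact hpc.stronglyMeasurableAtFilter isOpen_Ioi r hr0
  set E : ℝ → ℂ := fun r => Complex.exp (Complex.I * σ * ((∫ q in (1 : ℝ)..r, p q : ℝ) : ℂ)) with hE
  have hEn : ∀ r, ‖E r‖ = 1 := fun r => by
    have : Complex.I * σ * ((∫ q in (1 : ℝ)..r, p q : ℝ) : ℂ)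
        = ((σ * ∫ q in (1 : ℝ)..r, p q : ℝ) : ℂ) * Complex.I := by push_cast; ring
    rw [hE]
    simp only
    rw [this, Complex.norm_exp_ofReal_mul_I]
  have hEd : ∀ r, 1 ≤ r → HasDerivAt E (E r * (Complex.I * σ * (p r : ℂ))) r := fun r hr =>
    (((hP r hr).ofReal_comp).const_mul (Complex.I * σ)).cexp
  set z : ℝ → ℂ := fun r => y r * E r with hz
  -- The derivative of the phase supplies exactly the resonant cubic term, so only the integrable
  -- error remains.
  have hzd : ∀ r, 1 ≤ r → HasDerivAt z ((y' r + Complex.I * σ * (p r : ℂ) * y r) * E r) r :=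
    fun r hr => ((hy r).mul (hEd r hr)).congr_deriv (by ring)
  have hfence := image_norm_le_of_norm_deriv_right_le_deriv_boundary'
    (f := fun r => z r - z s) (f' := fun r => (y' r + Complex.I * σ * (p r : ℂ) * y r) * E r)
    (a := s) (b := t)
    -- The barrier is the integral of `A r^{-17/16}` from `s`.
    (B := fun r => 16 * A * (s ^ (-(1 / 16) : ℝ) - r ^ (-(1 / 16) : ℝ)))
    (B' := fun r => A * r ^ (-(17 / 16) : ℝ))
    (fun r hr => ((hzd r (hs.trans hr.1)).sub_const _).continuousAt.continuousWithinAt)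
    (fun r hr => ((hzd r (hs.trans hr.1)).sub_const _).hasDerivWithinAt)
    (by simp)
    (by
      intro r hr
      have hr0 : (0 : ℝ) < r := by linarith [hr.1]
      have : ContinuousAt (fun r : ℝ => r ^ (-(1 / 16) : ℝ)) r :=
        Real.continuousAt_rpow_const _ _ (Or.inl hr0.ne')
      exact (continuousAt_const.mul (continuousAt_const.sub this)).continuousWithinAt)
    (by
      intro r hr
      have hr0 : (0 : ℝ) < r := by linarith [hr.1]
      have h1 := ((Real.hasDerivAt_rpow_const (x := r) (p := -(1 / 16)) (Or.inl hr0.ne')).const_sub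
        (s ^ (-(1 / 16) : ℝ))).const_mul (16 * A)
      refine (h1.congr_deriv ?_).hasDerivWithinAt
      norm_num
      ring)
    (by
      intro r hr
      rw [norm_mul, hEn, mul_one]
      exact hb r (hs.trans hr.1) (hr.2.le.trans ht))
  exact hfence ⟨hst, le_rfl⟩

/-! ### The sup norm, the bootstrap and dispersive decay -/

/-- The essential supremum of `|φ|` as a real number. -/
def supNorm (φ : L2R) : ℝ := (eLpNorm φ ∞ volume).toReal

theorem eLpNorm_top_le_of_ae_bound {φ : ℝ → ℂ} {c : ℝ} (h : ∀ᵐ x, ‖φ x‖ ≤ c) :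
    eLpNorm φ ∞ volume ≤ ENNReal.ofReal c := by
  rw [eLpNorm_exponent_top]
  exact eLpNormEssSup_le_of_ae_bound h

theorem SigmaBound.ae_bound {φ : L2R} {K : ℝ} (h : SigmaBound φ K) :
    ∀ᵐ x, ‖φ x‖ ≤ weightConst * K := by
  simpa only [freeGroup_zero] using h.ae_bound_freeGroup 0

theorem SigmaBound.ae_bound_supNorm {φ : L2R} {K : ℝ} (h : SigmaBound φ K) :
    ∀ᵐ x, ‖φ x‖ ≤ supNorm φ := by
  have hfin : eLpNorm φ ∞ volume ≠ ∞ :=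
    ((eLpNorm_top_le_of_ae_bound h.ae_bound).trans_lt ENNReal.ofReal_lt_top).ne
  have h1 : ∀ᵐ x, ‖φ x‖ₑ ≤ eLpNorm φ ∞ volume := by
    rw [eLpNorm_exponent_top]
    exact ae_le_eLpNormEssSup
  filter_upwards [h1] with x hx
  rw [← toReal_enorm]
  exact ENNReal.toReal_mono hfin hx

theorem supNorm_le {φ : L2R} {c : ℝ} (hc : 0 ≤ c) (h : ∀ᵐ x, ‖φ x‖ ≤ c) : supNorm φ ≤ c :=
  ENNReal.toReal_le_of_le_ofReal hc (eLpNorm_top_le_of_ae_bound h)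

theorem supNorm_nonneg (φ : L2R) : 0 ≤ supNorm φ := ENNReal.toReal_nonneg

theorem weightConst_pos : 0 < weightConst := one_pos.trans_le one_le_weightConst

theorem supNorm_le_add {φ ψ : L2R} {K κ : ℝ} (h : SigmaBound φ K) (h' : SigmaBound (ψ - φ) κ) :
    supNorm ψ ≤ supNorm φ + weightConst * κ := by
  have := mul_nonneg weightConst_pos.le h'.nonneg
  refine supNorm_le (add_nonneg (supNorm_nonneg _) this) ?_
  filter_upwards [h.ae_bound_supNorm, h'.ae_bound, Lp.coeFn_sub ψ φ] with x h1 h2 h3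
  rw [h3, Pi.sub_apply] at h2
  have := norm_add_le (φ x) (ψ x - φ x)
  rw [add_sub_cancel] at this
  linarith

theorem IsFlow.continuous_supNorm {M : ℝ≥0} {f : ℝ → L2R} (hf : IsFlow M f) {t₀ K : ℝ}
    (h : SigmaBound (f t₀) K) : Continuous fun t => supNorm (freeGroup t (f t)) := by
  refine continuous_iff_continuousAt.2 fun t => ?_
  obtain ⟨κ, hκ, hb⟩ := hf.tendsto_sigma h t
  refine tendsto_iff_norm_sub_tendsto_zero.2 ?_
  refine squeeze_zero' (Eventually.of_forall fun _ => norm_nonneg _) ?_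
    (by simpa using hκ.const_mul weightConst)
  filter_upwards [hb] with s hs
  have h1 := supNorm_le_add (sigmaBound_freeGroup (hf.sigmaBound h t) t) hs
  have h2 := hs.neg
  rw [neg_sub] at h2
  have h3 := supNorm_le_add (sigmaBound_freeGroup (hf.sigmaBound h s) s) h2
  rw [Real.norm_eq_abs, abs_le]
  constructor <;> linarith

/-- The continuity method on `[1, ∞)`. -/
theorem le_of_continuity_method {φ : ℝ → ℝ} {c : ℝ} (hφ : ContinuousOn φ (Set.Ici 1))
    (h1 : φ 1 < c) (hstep : ∀ T, 1 ≤ T → (∀ s ∈ Set.Icc 1 T, φ s ≤ c) → φ T < c)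
    {T : ℝ} (hT : 1 ≤ T) : φ T ≤ c := by
  by_contra hcon
  push Not at hcon
  set S := Set.Icc 1 T ∩ φ ⁻¹' Set.Ici c with hS
  have hScl : IsClosed S :=
    (hφ.mono fun s hs => hs.1).preimage_isClosed_of_isClosed isClosed_Icc isClosed_Ici
  have hne : S.Nonempty := ⟨T, ⟨hT, le_rfl⟩, hcon.le⟩
  have hbd : BddBelow S := ⟨1, fun s hs => hs.1.1⟩
  have hmem := hScl.csInf_mem hne hbd
  set r := sInf S with hr
  have hlt : ∀ s, 1 ≤ s → s < r → φ s < c := fun s hs hsr => by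
    by_contra hc
    exact absurd (csInf_le hbd ⟨⟨hs, hsr.le.trans hmem.1.2⟩, not_lt.1 hc⟩) (not_le.2 hsr)
  have hr1 : 1 < r := lt_of_le_of_ne hmem.1.1 fun e => by
    have := hmem.2
    rw [← e] at this
    exact absurd h1 (not_lt.2 this)
  have hle : φ r ≤ c := by
    have hc : Tendsto φ (𝓝[<] r) (𝓝 (φ r)) :=
      (hφ.continuousAt (Ici_mem_nhds hr1)).tendsto.mono_left nhdsWithin_le_nhds
    refine le_of_tendsto hc ?_
    filter_upwards [Ioo_mem_nhdsLT hr1] with s hs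
    exact (hlt s hs.1.le hs.2).le
  have := hstep r hr1.le fun s hs => by
    rcases eq_or_lt_of_le hs.2 with e | e
    · rw [e]; exact hle
    · exact (hlt s hs.1 e).le
  exact absurd this (not_lt.2 hmem.2)

/-- Parametrizing by `σ s` lets one argument on `s ≥ 1` serve both time directions. -/
theorem IsFlow.hasDerivAt_comp_mul {M : ℝ≥0} {f : ℝ → L2R} (hf : IsFlow M f)
    (R : L2R →ₗᵢ[ℂ] L2R) (σ s : ℝ) : HasDerivAt (fun s => R (f (σ * s)) - f (σ * s))
      (σ • (R (nlsField M (σ * s) (f (σ * s))) - nlsField M (σ * s) (f (σ * s)))) s := by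
  have := (hf.hasDerivAt_symm R (σ * s)).scomp s ((hasDerivAt_id s).const_mul σ)
  rwa [mul_one] at this

/-- Slow growth of the `H^{1,0} ∩ H^{0,1}` bound under the dispersive decay. -/
theorem IsFlow.sigmaBound_growth {M : ℝ≥0} {f : ℝ → L2R} (hf : IsFlow M f) {σ ε q T : ℝ}
    (hσ : |σ| = 1) (h : SigmaBound (f σ) ε) (hε : 0 < ε) (hq : 3 * q ^ 2 < 1 / 48)
    (hu : ∀ s ∈ Set.Icc 1 T, ∀ᵐ x, ‖freeGroup (σ * s) (f (σ * s)) x‖ ≤ q * s ^ (-(1 / 2) : ℝ))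
    {s : ℝ} (hs : s ∈ Set.Icc 1 T) : SigmaBound (f (σ * s)) (ε * s ^ (1 / 48 : ℝ)) := by
  intro R w hR
  -- The barrier argument needs a strict inequality, which fails for size zero. There the
  -- exponential bound already gives zero.
  rcases hR.nonneg.eq_or_lt with hw | hw
  · have := hf.sigmaBound h (σ * s) R w hR
    rw [← hw, zero_mul] at this ⊢
    exact this
  refine image_norm_le_of_norm_deriv_right_lt_deriv_boundary'
    (f := fun s => R (f (σ * s)) - f (σ * s)) (a := 1) (b := T)
    (f' := fun s => σ • (R (nlsField M (σ * s) (f (σ * s))) - nlsField M (σ * s) (f (σ * s))))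
    (B := fun s => w * (ε * s ^ (1 / 48 : ℝ)))
    (B' := fun s => w * (ε * (1 / 48 * s ^ (1 / 48 - 1 : ℝ))))
    (fun r _ => (hf.hasDerivAt_comp_mul R σ r).continuousAt.continuousWithinAt)
    (fun r _ => (hf.hasDerivAt_comp_mul R σ r).hasDerivWithinAt) ?_ ?_ ?_ ?_ hs
  · simpa using h R w hR
  · intro r hr
    have hr0 : (0 : ℝ) < r := by linarith [hr.1]
    exact (continuousAt_const.mul (continuousAt_const.mul
      (Real.continuousAt_rpow_const _ _ (Or.inl hr0.ne')))).continuousWithinAt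
  · intro r hr
    have hr0 : (0 : ℝ) < r := by linarith [hr.1]
    exact (((Real.hasDerivAt_rpow_const (Or.inl hr0.ne')).const_mul ε).const_mul w).hasDerivWithinAt
  · intro r hr he
    have hr0 : (0 : ℝ) < r := by linarith [hr.1]
    rw [norm_smul, Real.norm_eq_abs, hσ, one_mul]
    refine (norm_nlsField_symm_sub_le hR.isSymm M (σ * r) (hu r ⟨hr.1, hr.2.le⟩)).trans_lt ?_
    -- At a contact point the norm equals the barrier, so the derivative is at most `3q² / r` times
    -- the barrier. The barrier's own slope is `1 / (48 r)` times itself, which is larger.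
    rw [he]
    have e1 : (r ^ (-(1 / 2) : ℝ)) ^ 2 = r ^ (-1 : ℝ) := by
      rw [← Real.rpow_mul_natCast hr0.le]; norm_num
    have e2 : r ^ (1 / 48 - 1 : ℝ) = r ^ (-1 : ℝ) * r ^ (1 / 48 : ℝ) := by
      rw [← Real.rpow_add hr0]; norm_num
    rw [mul_pow, e1, e2]
    have hpos : 0 < w * ε * (r ^ (-1 : ℝ) * r ^ (1 / 48 : ℝ)) := by positivity
    nlinarith

/-- The phase-corrected Fourier transform of the profile along the ray `σ s`, `s ≥ 1`. -/
def phaseCorrected (f : ℝ → L2R) (σ k s : ℝ) : ℂ :=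
  𝓕 (f (σ * s) : ℝ → ℂ) k * Complex.exp (Complex.I * σ *
    ((∫ r in (1 : ℝ)..s, (2 * Real.pi * r)⁻¹ * ‖𝓕 (f (σ * r) : ℝ → ℂ) k‖ ^ 2 : ℝ) : ℂ))

theorem norm_phaseCorrected (f : ℝ → L2R) (σ k s : ℝ) :
    ‖phaseCorrected f σ k s‖ = ‖𝓕 (f (σ * s) : ℝ → ℂ) k‖ := by
  rw [phaseCorrected, norm_mul]
  have : ∀ a : ℝ, ‖Complex.exp (Complex.I * σ * (a : ℂ))‖ = 1 := fun a => by
    rw [show Complex.I * σ * (a : ℂ) = ((σ * a : ℝ) : ℂ) * Complex.I by push_cast; ring,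
      Complex.norm_exp_ofReal_mul_I]
  rw [this, mul_one]

/-- Cubing the growth `r^{1/48}` gives `r^{1/16}`, half of the gain `r^{-1/8}`, so the error is
`r^{-17/16}`. Since `12 / (2π) ≤ 2`, its coefficient is at most `2 (weightConst ε)³`, and
integration multiplies it by `16`. -/
theorem IsFlow.norm_phaseCorrected_sub_le {f : ℝ → L2R} (hf : IsFlow 1 f) {σ ε q T : ℝ}
    (hσ : |σ| = 1) (h : SigmaBound (f σ) ε) (hε : 0 < ε) (hq1 : q ≤ 1)
    (hq : 3 * q ^ 2 < 1 / 48)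
    (hu : ∀ s ∈ Set.Icc 1 T, ∀ᵐ x, ‖freeGroup (σ * s) (f (σ * s)) x‖ ≤ q * s ^ (-(1 / 2) : ℝ))
    (k : ℝ) {s t : ℝ} (hs : 1 ≤ s) (hst : s ≤ t) (ht : t ≤ T) :
    ‖phaseCorrected f σ k t - phaseCorrected f σ k s‖
      ≤ 32 * (weightConst * ε) ^ 3 * (s ^ (-(1 / 16) : ℝ) - t ^ (-(1 / 16) : ℝ)) := by
  have hmain := norm_phase_corrected_sub_le (σ := σ) (A := 2 * (weightConst * ε) ^ 3) (T := T)
    (y := fun s => 𝓕 (f (σ * s) : ℝ → ℂ) k)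
    (y' := fun s => σ * 𝓕 (nlsField 1 (σ * s) (f (σ * s)) : ℝ → ℂ) k) ?_ ?_ hs hst ht
  · refine hmain.trans (le_of_eq ?_)
    ring
  · intro r
    have := (hf.hasDerivAt_fourier h (σ * r) k).scomp r ((hasDerivAt_id r).const_mul σ)
    rwa [mul_one, Complex.real_smul] at this
  · intro r hr1 hrT
    have hr0 : (0 : ℝ) < r := by linarith
    have hσ0 : σ ≠ 0 := fun e => by simp [e] at hσ
    have habs : |σ * r| = r := by rw [abs_mul, hσ, one_mul, abs_of_pos hr0]
    have hsb := hf.sigmaBound_growth hσ h hε hq hu ⟨hr1, hrT⟩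
    have hM : ∀ᵐ x, ‖freeGroup (σ * r) (f (σ * r)) x‖ ≤ ((1 : ℝ≥0) : ℝ) := by
      filter_upwards [hu r ⟨hr1, hrT⟩] with x hx
      refine hx.trans ?_
      rw [NNReal.coe_one]
      exact mul_le_one₀ hq1 (by positivity) (Real.rpow_le_one_of_one_le_of_nonpos hr1 (by norm_num))
    have h1 := hsb.fourier_nlsField (mul_ne_zero hσ0 hr0.ne') hM k
    rw [habs] at h1
    have e1 : (σ * 𝓕 (nlsField 1 (σ * r) (f (σ * r)) : ℝ → ℂ) k
        + Complex.I * σ * (((2 * Real.pi * r)⁻¹ * ‖𝓕 (f (σ * r) : ℝ → ℂ) k‖ ^ 2 : ℝ) : ℂ)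
          * 𝓕 (f (σ * r) : ℝ → ℂ) k)
        = σ * (𝓕 (nlsField 1 (σ * r) (f (σ * r)) : ℝ → ℂ) k
        + Complex.I * (((2 * Real.pi * r)⁻¹ * ‖𝓕 (f (σ * r) : ℝ → ℂ) k‖ ^ 2 : ℝ) : ℂ)
          * 𝓕 (f (σ * r) : ℝ → ℂ) k) := by ring
    rw [e1, norm_mul, Complex.norm_real, Real.norm_eq_abs, hσ, one_mul]
    refine h1.trans ?_
    have e2 : (weightConst * (ε * r ^ (1 / 48 : ℝ))) ^ 3 = (weightConst * ε) ^ 3 * r ^ (1 / 16 : ℝ) := by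
      rw [← mul_assoc, mul_pow _ _ 3, ← Real.rpow_mul_natCast hr0.le]
      norm_num
    have e3 : r ^ (-(17 / 16) : ℝ) = r⁻¹ * (r ^ (1 / 16 : ℝ) * r ^ (-(1 / 8) : ℝ)) := by
      rw [← Real.rpow_neg_one, ← Real.rpow_add hr0, ← Real.rpow_add hr0]
      norm_num
    have hw := weightConst_pos
    rw [e2, e3, mul_inv]
    have hpi : 12 * (2 * Real.pi)⁻¹ ≤ 2 := by
      rw [← div_eq_mul_inv, div_le_iff₀ Real.two_pi_pos]
      linarith [Real.pi_gt_three]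
    calc _ = 12 * (2 * Real.pi)⁻¹ * ((weightConst * ε) ^ 3 * (r⁻¹ * (r ^ (1 / 16 : ℝ) * r ^ (-(1 / 8) : ℝ)))) := by
          ring
      _ ≤ 2 * ((weightConst * ε) ^ 3 * (r⁻¹ * (r ^ (1 / 16 : ℝ) * r ^ (-(1 / 8) : ℝ)))) := by gcongr
      _ = _ := by ring

/-- Global dispersive decay along the ray `σ s`, `s ≥ 1`. -/
theorem IsFlow.decay {f : ℝ → L2R} (hf : IsFlow 1 f) {σ ε : ℝ}
    (hσ : |σ| = 1) (h : SigmaBound (f σ) ε) (hε : 0 < ε) (hB : weightConst * ε ≤ 1 / 100) {s : ℝ}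
    (hs : 1 ≤ s) : ∀ᵐ x, ‖freeGroup (σ * s) (f (σ * s)) x‖
      ≤ 8 * (weightConst * ε) * s ^ (-(1 / 2) : ℝ) := by
  set B := weightConst * ε with hBdef
  have hB0 : 0 < B := mul_pos weightConst_pos hε
  have hσ0 : σ ≠ 0 := fun e => by simp [e] at hσ
  have hsig : ∀ s, SigmaBound (freeGroup (σ * s) (f (σ * s))) _ := fun s =>
    sigmaBound_freeGroup (hf.sigmaBound h (σ * s)) (σ * s)
  -- Bootstrap: a bound `8B` on the rescaled sup norm up to time `T` is improved to `4B` at `T`.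
  have key : ∀ T, 1 ≤ T → T ^ (1 / 2 : ℝ) * supNorm (freeGroup (σ * T) (f (σ * T))) ≤ 8 * B := by
    intro T hT
    refine le_of_continuity_method (φ := fun s => s ^ (1 / 2 : ℝ) *
      supNorm (freeGroup (σ * s) (f (σ * s)))) ?_ ?_ ?_ hT
    · refine ContinuousOn.mul (fun r hr => ?_) ?_
      · exact (Real.continuousAt_rpow_const _ _ (Or.inr (by norm_num))).continuousWithinAt
      · exact ((hf.continuous_supNorm h).comp (continuous_const.mul continuous_id)).continuousOn
    · have : supNorm (freeGroup (σ * 1) (f (σ * 1))) ≤ B := by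
        rw [mul_one]
        exact supNorm_le hB0.le (h.ae_bound_freeGroup σ)
      simp only [Real.one_rpow, one_mul]
      linarith
    · intro T hT hboot
      have hT0 : (0 : ℝ) < T := by linarith
      have hu : ∀ s ∈ Set.Icc 1 T, ∀ᵐ x, ‖freeGroup (σ * s) (f (σ * s)) x‖
          ≤ 8 * B * s ^ (-(1 / 2) : ℝ) := by
        intro s hs
        have hs0 : (0 : ℝ) < s := by linarith [hs.1]
        filter_upwards [(hsig s).ae_bound_supNorm] with x hx
        refine hx.trans ?_
        rw [Real.rpow_neg hs0.le, ← div_eq_mul_inv, le_div_iff₀ (by positivity), mul_comm]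
        exact hboot s hs
      -- The smallness `B ≤ 1/100` is calibrated here: `3 · 64 · 10⁻⁴ = 0.0192 < 1/48`.
      have hq : 3 * (8 * B) ^ 2 < 1 / 48 := by nlinarith
      have hsT := hf.sigmaBound_growth hσ h hε hq hu ⟨hT, le_rfl⟩
      -- The phase correction preserves the modulus, so the convergence estimate from time `1` to
      -- `T` bounds the transform itself, with no growth in `T`.
      have hy : ∀ k, ‖𝓕 (f (σ * T) : ℝ → ℂ) k‖ ≤ B + 32 * B ^ 3 := by
        intro k
        have h1 := hf.norm_phaseCorrected_sub_le hσ h hε (by linarith) hq hu k le_rfl hT le_rfl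
        have h2 := norm_le_norm_add_norm_sub' (phaseCorrected f σ k T) (phaseCorrected f σ k 1)
        rw [norm_phaseCorrected, norm_phaseCorrected, mul_one] at h2
        have h3 := h.norm_fourier_le k
        rw [Real.one_rpow] at h1
        have h4 : 32 * B ^ 3 * (1 - T ^ (-(1 / 16) : ℝ)) ≤ 32 * B ^ 3 :=
          mul_le_of_le_one_right (by positivity) (sub_le_self _ (by positivity))
        linarith
      have hdec := hsT.freeGroup_decay (mul_ne_zero hσ0 hT0.ne') hy
      have habs : |σ * T| = T := by rw [abs_mul, hσ, one_mul, abs_of_pos hT0]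
      rw [habs] at hdec
      have hT1 : T ^ (-(1 / 8) : ℝ) * T ^ (1 / 48 : ℝ) ≤ 1 := by
        rw [← Real.rpow_add hT0]
        exact Real.rpow_le_one_of_one_le_of_nonpos hT (by norm_num)
      have hB3 : 32 * B ^ 3 ≤ B := by nlinarith [sq_nonneg B]
      -- The norm growth `T^{1/48}` is beaten by `T^{-1/8}`; the three terms are at most `B`, `B`
      -- and `2B`.
      have hc : B + 32 * B ^ 3 + 2 * T ^ (-(1 / 8) : ℝ) * (weightConst * (ε * T ^ (1 / 48 : ℝ)))
          ≤ 4 * B := by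
        have : 2 * T ^ (-(1 / 8) : ℝ) * (weightConst * (ε * T ^ (1 / 48 : ℝ)))
            = 2 * B * (T ^ (-(1 / 8) : ℝ) * T ^ (1 / 48 : ℝ)) := by rw [hBdef]; ring
        rw [this]
        nlinarith
      have hsup : supNorm (freeGroup (σ * T) (f (σ * T))) ≤ T ^ (-(1 / 2) : ℝ) * (4 * B) := by
        refine supNorm_le (by positivity) ?_
        filter_upwards [hdec] with x hx
        exact hx.trans (by gcongr)
      have e : T ^ (1 / 2 : ℝ) * T ^ (-(1 / 2) : ℝ) = 1 := by
        rw [← Real.rpow_add hT0]; norm_num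
      calc T ^ (1 / 2 : ℝ) * supNorm (freeGroup (σ * T) (f (σ * T)))
          ≤ T ^ (1 / 2 : ℝ) * (T ^ (-(1 / 2) : ℝ) * (4 * B)) := by gcongr
        _ = 4 * B := by rw [← mul_assoc, e, one_mul]
        _ < 8 * B := by linarith
  have hs0 : (0 : ℝ) < s := by linarith
  filter_upwards [(hsig s).ae_bound_supNorm] with x hx
  refine hx.trans ?_
  rw [Real.rpow_neg hs0.le, ← div_eq_mul_inv, le_div_iff₀ (by positivity), mul_comm]
  exact key s hs

/-- Convergence rate of the phase-corrected Fourier transform of the profile. -/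
theorem IsFlow.norm_phaseCorrected_sub_le_rate {f : ℝ → L2R} (hf : IsFlow 1 f) {σ ε : ℝ}
    (hσ : |σ| = 1) (h : SigmaBound (f σ) ε) (hε : 0 < ε) (hB : weightConst * ε ≤ 1 / 100)
    (k : ℝ) {s t : ℝ} (hs : 1 ≤ s) (hst : s ≤ t) :
    ‖phaseCorrected f σ k t - phaseCorrected f σ k s‖ ≤ s ^ (-(1 / 16) : ℝ) := by
  have hB0 : 0 < weightConst * ε := mul_pos weightConst_pos hε
  refine (hf.norm_phaseCorrected_sub_le hσ h hε (q := 8 * (weightConst * ε)) (by linarith)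
    (by nlinarith) (fun r hr => hf.decay hσ h hε hB hr.1) k hs hst le_rfl).trans ?_
  have hs0 : (0 : ℝ) < s := by linarith
  have ht0 : (0 : ℝ) < t := by linarith
  have h1 : 32 * (weightConst * ε) ^ 3 ≤ 1 := by
    have : (weightConst * ε) ^ 3 ≤ (1 / 100) ^ 3 := by gcongr
    linarith
  have h2 : 0 ≤ s ^ (-(1 / 16) : ℝ) - t ^ (-(1 / 16) : ℝ) :=
    sub_nonneg.2 (Real.rpow_le_rpow_of_nonpos hs0 hst (by norm_num))
  calc _ ≤ 1 * (s ^ (-(1 / 16) : ℝ) - t ^ (-(1 / 16) : ℝ)) := by gcongr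
    _ ≤ _ := by rw [one_mul]; exact sub_le_self _ (by positivity)

/-! ### From the truncated flow to the integral equation, and uniqueness -/

/-- The cubic nonlinearity agrees with its truncation on small functions. -/
theorem cubic_eq_nl {φ : L2R} {M : ℝ≥0} (h : ∀ᵐ x, ‖φ x‖ ≤ M) : cubic φ = nl M φ := by
  have he : (nl M φ : ℝ → ℂ) =ᵐ[volume] fun x : ℝ => ((‖φ x‖ ^ 2 : ℝ) : ℂ) * φ x := by
    filter_upwards [coeFn_nl M φ, h] with x h1 h2
    rw [h1, truncCubic_of_le h2]
  have hm : MemLp (fun x : ℝ => ((‖φ x‖ ^ 2 : ℝ) : ℂ) * φ x) 2 volume :=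
    (Lp.memLp (nl M φ)).ae_eq he
  rw [cubic, dif_pos hm]
  exact Lp.ext (hm.coeFn_toLp.trans he.symm)

theorem freeGroup_intervalIntegral (r : ℝ) {F : ℝ → L2R} (hF : Continuous F) (a b : ℝ) :
    freeGroup r (∫ s in a..b, F s) = ∫ s in a..b, freeGroup r (F s) :=
  ((freeGroup r).toContinuousLinearMap.intervalIntegral_comp_comm (hF.intervalIntegrable a b)).symm

theorem IsFlow.isGlobalSolution {M : ℝ≥0} {f : ℝ → L2R} (hf : IsFlow M f) {K : ℝ}
    (h : SigmaBound (f 1) K) (hM : ∀ t, ∀ᵐ x, ‖freeGroup t (f t) x‖ ≤ M) :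
    IsGlobalSolution (f 1) fun t => freeGroup t (f t) where
  mem t := (sigmaBound_freeGroup (hf.sigmaBound h t) t).normSigma_le.trans_lt ENNReal.ofReal_lt_top
  continuous t := by
    obtain ⟨κ, hκ, hb⟩ := hf.tendsto_sigma h t
    have hlim : Tendsto (fun s => ENNReal.ofReal (4 * κ s)) (𝓝 t) (𝓝 0) := by
      simpa using ENNReal.tendsto_ofReal (hκ.const_mul 4)
    exact tendsto_of_tendsto_of_tendsto_of_le_of_le' tendsto_const_nhds hlim
      (Eventually.of_forall fun _ => zero_le) (hb.mono fun s hs => hs.normSigma_le)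
  init := by rw [schrodinger_eq_freeGroup]
  duhamel t := by
    have hc := continuous_nlsField M hf.continuous
    have hF : ∫ s in (1 : ℝ)..t, nlsField M s (f s) = f t - f 1 :=
      intervalIntegral.integral_eq_sub_of_hasDerivAt (fun s _ => hf s) (hc.intervalIntegrable _ _)
    have e : ∀ s, schrodinger (t - s) (cubic (freeGroup s (f s)))
        = Complex.I • freeGroup t (nlsField M s (f s)) := fun s => by
      rw [cubic_eq_nl (hM s), schrodinger_eq_freeGroup, nlsField, map_smul, freeGroup_freeGroup,
        smul_smul, ← sub_eq_add_neg]
      simp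
    simp_rw [e]
    rw [intervalIntegral.integral_smul, ← freeGroup_intervalIntegral t hc, hF, smul_smul,
      Complex.I_mul_I, schrodinger_eq_freeGroup, freeGroup_freeGroup, map_sub]
    simp

theorem IsGlobalSolution.continuous_L2 {φ : L2R} {v : ℝ → L2R} (hv : IsGlobalSolution φ v) :
    Continuous v := by
  refine continuous_iff_continuousAt.2 fun t => tendsto_iff_norm_sub_tendsto_zero.2 ?_
  have h : Tendsto (fun s => ENNReal.ofReal ‖v s - v t‖) (𝓝 t) (𝓝 0) :=
    tendsto_of_tendsto_of_tendsto_of_le_of_le tendsto_const_nhds (hv.continuous t)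
      (fun _ => zero_le) fun s => by
        rw [← L2R_eLpNorm]
        exact (eLpNorm_le_normH01 _).trans le_add_self
  have h2 := (ENNReal.tendsto_toReal ENNReal.zero_ne_top).comp h
  simpa [Function.comp_def, ENNReal.toReal_ofReal] using h2

/-- Continuity gives local bounds and compactness makes them uniform. Through the Sobolev bound this
provides one truncation level for a whole time interval. -/
theorem IsGlobalSolution.exists_sigmaBound_Icc {φ : L2R} {v : ℝ → L2R} (hv : IsGlobalSolution φ v)
    (a b : ℝ) : ∃ K, ∀ r ∈ Set.Icc a b, SigmaBound (v r) K := by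
  refine (isCompact_Icc (a := a) (b := b)).induction_on (p := fun s => ∃ K, ∀ r ∈ s, SigmaBound (v r) K)
    ⟨0, by simp⟩ (fun s t hst ⟨K, hK⟩ => ⟨K, fun r hr => hK r (hst hr)⟩) ?_ ?_
  · rintro s t ⟨K, hK⟩ ⟨K', hK'⟩
    refine ⟨max K K', fun r hr => ?_⟩
    rcases hr with hr | hr
    · exact (hK r hr).mono (le_max_left _ _)
    · exact (hK' r hr).mono (le_max_right _ _)
  · intro t _
    have h0 : SigmaBound (v t) (normSigma (v t)).toReal :=
      SigmaBound.of_normSigma ENNReal.toReal_nonneg (ENNReal.ofReal_toReal (hv.mem t).ne).ge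
    refine ⟨{s | normSigma (v s - v t) < 1}, mem_nhdsWithin_of_mem_nhds
      ((hv.continuous t).eventually (eventually_lt_nhds one_pos)), 1 + (normSigma (v t)).toReal,
      fun r hr => ?_⟩
    have h1 : SigmaBound (v r - v t) 1 :=
      SigmaBound.of_normSigma zero_le_one (by rw [ENNReal.ofReal_one]; exact hr.le)
    simpa using h1.add h0

/-- In the interaction picture a solution satisfies the truncated differential equation on every
bounded interval on which it is bounded by the truncation level. -/
theorem IsGlobalSolution.hasDerivAt {φ : L2R} {v : ℝ → L2R} (hv : IsGlobalSolution φ v) {M : ℝ≥0}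
    {a b : ℝ} (h1 : (1 : ℝ) ∈ Set.Ioo a b) (hM : ∀ s ∈ Set.Ioo a b, ∀ᵐ x, ‖v s x‖ ≤ M) {t : ℝ}
    (ht : t ∈ Set.Ioo a b) : HasDerivAt (fun s => freeGroup (-s) (v s))
      (nlsField M t (freeGroup (-t) (v t))) t := by
  have hg : Continuous fun s => freeGroup (-s) (v s) :=
    continuous_freeGroup continuous_neg hv.continuous_L2
  have hc := continuous_nlsField M hg
  have hd : HasDerivAt (fun r => φ + ∫ s in (1 : ℝ)..r, nlsField M s (freeGroup (-s) (v s)))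
      (nlsField M t (freeGroup (-t) (v t))) t :=
    (intervalIntegral.integral_hasDerivAt_right (hc.intervalIntegrable _ _)
      hc.aestronglyMeasurable.stronglyMeasurableAtFilter hc.continuousAt).const_add φ
  refine hd.congr_of_eventuallyEq ?_
  filter_upwards [Ioo_mem_nhds ht.1 ht.2] with r hr
  have hint : ∫ s in (1 : ℝ)..r, schrodinger (r - s) (cubic (v s))
      = Complex.I • freeGroup r (∫ s in (1 : ℝ)..r, nlsField M s (freeGroup (-s) (v s))) := by
    rw [freeGroup_intervalIntegral r hc, ← intervalIntegral.integral_smul]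
    refine intervalIntegral.integral_congr fun s hs => ?_
    have hs' : s ∈ Set.Ioo a b := Set.OrdConnected.uIcc_subset inferInstance h1 hr hs
    rw [cubic_eq_nl (hM s hs'), schrodinger_eq_freeGroup, nlsField, freeGroup_apply_neg, map_smul,
      freeGroup_freeGroup, smul_smul, ← sub_eq_add_neg]
    simp
  rw [hv.duhamel r, hint, hv.init, schrodinger_eq_freeGroup, schrodinger_eq_freeGroup, smul_smul,
    Complex.I_mul_I, map_sub, freeGroup_freeGroup, freeGroup_freeGroup, map_smul, freeGroup_neg_apply]
  have : -r + (r - 1) + 1 = 0 := by ring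
  rw [this, freeGroup_zero, neg_one_smul, sub_neg_eq_add]

/-- Unconditional uniqueness of global solutions. -/
theorem IsGlobalSolution.unique {φ : L2R} {v w : ℝ → L2R} (hv : IsGlobalSolution φ v)
    (hw : IsGlobalSolution φ w) : v = w := by
  ext1 t
  set a := min 1 t - 1
  set b := max 1 t + 1
  obtain ⟨K, hK⟩ := hv.exists_sigmaBound_Icc a b
  obtain ⟨K', hK'⟩ := hw.exists_sigmaBound_Icc a b
  -- The level depends on the interval and on both solutions, so no smallness enters the uniqueness.
  set M : ℝ≥0 := Real.toNNReal (weightConst * K) + Real.toNNReal (weightConst * K')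
  have h1 : (1 : ℝ) ∈ Set.Ioo a b :=
    ⟨by have := min_le_left 1 t; linarith, by have := le_max_left 1 t; linarith⟩
  have ht : t ∈ Set.Ioo a b :=
    ⟨by have := min_le_right 1 t; linarith, by have := le_max_right 1 t; linarith⟩
  have hMv : ∀ s ∈ Set.Ioo a b, ∀ᵐ x, ‖v s x‖ ≤ M := fun s hs => by
    filter_upwards [(hK s (Set.Ioo_subset_Icc_self hs)).ae_bound] with x hx
    refine hx.trans ((Real.le_coe_toNNReal _).trans ?_)
    exact NNReal.coe_le_coe.2 le_self_add
  have hMw : ∀ s ∈ Set.Ioo a b, ∀ᵐ x, ‖w s x‖ ≤ M := fun s hs => by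
    filter_upwards [(hK' s (Set.Ioo_subset_Icc_self hs)).ae_bound] with x hx
    refine hx.trans ((Real.le_coe_toNNReal _).trans ?_)
    exact NNReal.coe_le_coe.2 le_add_self
  have heq := ODE_solution_unique_of_mem_Ioo (v := nlsField M) (s := fun _ => Set.univ)
    (f := fun s => freeGroup (-s) (v s)) (g := fun s => freeGroup (-s) (w s))
    (fun s _ => (nlsField_lipschitz M s).lipschitzOnWith) h1
    (fun s hs => ⟨hv.hasDerivAt h1 hMv hs, Set.mem_univ _⟩)
    (fun s hs => ⟨hw.hasDerivAt h1 hMw hs, Set.mem_univ _⟩)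
    (by simp only [hv.init, hw.init]) ht
  exact (freeGroup (-t)).injective heq

/-! ### Decay in both time directions -/

theorem rpow_neg_half_le {a b : ℝ} (ha : 0 < a) (hb : 0 < b) (h : b ≤ 4 * a) :
    a ^ (-(1 / 2) : ℝ) ≤ 2 * b ^ (-(1 / 2) : ℝ) := by
  have h4 : (4 : ℝ) ^ (-(1 / 2) : ℝ) = 1 / 2 := by
    rw [show (4 : ℝ) = 2 ^ (2 : ℝ) by norm_num, ← Real.rpow_mul (by norm_num)]
    norm_num
  have h1 := Real.rpow_le_rpow_of_nonpos hb h (show (-(1 / 2) : ℝ) ≤ 0 by norm_num)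
  rw [Real.mul_rpow (by norm_num) ha.le, h4] at h1
  linarith

/-- Dispersive decay in both time directions. -/
theorem IsFlow.decay_abs {f : ℝ → L2R} (hf : IsFlow 1 f) {ε : ℝ} (h : SigmaBound (f 1) ε)
    (hε : 0 < ε) (hB : weightConst * (ε * Real.exp 6) ≤ 1 / 100) (t : ℝ) :
    ∀ᵐ x, ‖freeGroup t (f t) x‖
      ≤ 16 * (weightConst * (ε * Real.exp 6)) * (1 + |t|) ^ (-(1 / 2) : ℝ) := by
  -- Gronwall with rate `3` over a time span of at most `2` gives the factor `e⁶`. It covers `[-1,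
  -- 1]`, in particular the starting point `-1` of the backward ray.
  have hloc : ∀ r, |r| ≤ 1 → SigmaBound (f r) (ε * Real.exp 6) := fun r hr => by
    refine (hf.sigmaBound h r).mono ?_
    gcongr
    have : |r - 1| ≤ 2 := by
      rw [abs_le] at hr ⊢
      constructor <;> linarith
    rw [NNReal.coe_one]
    linarith
  have hB0 : 0 < weightConst * (ε * Real.exp 6) := mul_pos weightConst_pos (by positivity)
  have ht0 := abs_nonneg t
  rcases le_total |t| 1 with ht | ht
  · filter_upwards [(hloc t ht).ae_bound_freeGroup t] with x hx
    have h1 := rpow_neg_half_le one_pos (show 0 < 1 + |t| by positivity) (by linarith)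
    rw [Real.one_rpow] at h1
    nlinarith
  · have hray : ∀ σ : ℝ, |σ| = 1 → ∀ᵐ x, ‖freeGroup (σ * |t|) (f (σ * |t|)) x‖
        ≤ 16 * (weightConst * (ε * Real.exp 6)) * (1 + |t|) ^ (-(1 / 2) : ℝ) := fun σ hσ => by
      filter_upwards [hf.decay hσ (hloc σ hσ.le) (by positivity) hB ht] with x hx
      have h1 := rpow_neg_half_le (one_pos.trans_le ht) (show 0 < 1 + |t| by positivity) (by linarith)
      nlinarith
    rcases abs_choice t with e | e
    · simpa [e, abs_neg] using hray 1 abs_one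
    · simpa [e, abs_neg] using hray (-1) (by simp)

/-! ### The asymptotic profile in the normalization of the theorem -/

theorem fourierInt_eq (g : ℝ → ℂ) (ξ : ℝ) :
    fourierInt g ξ = ((Real.sqrt (2 * Real.pi))⁻¹ : ℂ) * 𝓕 g (ξ / (2 * Real.pi)) := by
  rw [fourierInt, fourier_eq_integral]
  congr 2
  ext x
  congr 2
  have e : -(2 * Real.pi * (ξ / (2 * Real.pi))) = -ξ := by
    rw [mul_div_cancel₀ _ Real.two_pi_pos.ne']
  rw [e]
  simp [linPhase]
  ring

theorem norm_inv_sqrt_two_pi : ‖((Real.sqrt (2 * Real.pi))⁻¹ : ℂ)‖ ≤ 1 := by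
  rw [norm_inv, Complex.norm_real, Real.norm_of_nonneg (Real.sqrt_nonneg _)]
  refine inv_le_one_of_one_le₀ (Real.one_le_sqrt.2 ?_)
  linarith [Real.pi_gt_three]

theorem norm_fourierInt_sq_div (g : ℝ → ℂ) (ξ s : ℝ) : ‖fourierInt g ξ‖ ^ 2 / s
    = (2 * Real.pi * s)⁻¹ * ‖𝓕 g (ξ / (2 * Real.pi))‖ ^ 2 := by
  rw [fourierInt_eq, norm_mul, mul_pow, norm_inv, Complex.norm_real,
    Real.norm_of_nonneg (Real.sqrt_nonneg _), inv_pow, Real.sq_sqrt Real.two_pi_pos.le, mul_inv]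
  ring

/-- The free group only rotates the transform, so `|û| = |f̂|` at every frequency. The squared
normalization `(2π)⁻¹` supplies the factor `(2πr)⁻¹` of the asymptotic equation. -/
theorem IsFlow.correctedProfile_eq {M : ℝ≥0} {f : ℝ → L2R} (hf : IsFlow M f) {t₀ K : ℝ}
    (h : SigmaBound (f t₀) K) (t ξ : ℝ) : correctedProfile (fun t => freeGroup t (f t)) t ξ
      = ((Real.sqrt (2 * Real.pi))⁻¹ : ℂ) * phaseCorrected f 1 (ξ / (2 * Real.pi)) t := by
  have hn : ∀ s, ‖𝓕 (freeGroup s (f s) : ℝ → ℂ) (ξ / (2 * Real.pi))‖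
      = ‖𝓕 (f s : ℝ → ℂ) (ξ / (2 * Real.pi))‖ := fun s => by
    rw [fourier_freeGroup_apply (hf.sigmaBound h s).weight.1
      (sigmaBound_freeGroup (hf.sigmaBound h s) s).weight.1, norm_mul, Complex.norm_exp_ofReal_mul_I,
      one_mul]
  rw [correctedProfile, profile, schrodinger_eq_freeGroup, freeGroup_neg_apply, fourierInt_eq,
    phaseCorrected]
  simp_rw [norm_fourierInt_sq_div, hn, one_mul]
  rw [Complex.ofReal_one, mul_one]
  ring

/-- Continuity in the frequency provides the measurability of the limit profile and of the corrected
profiles compared with it. -/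
theorem IsFlow.continuous_phaseCorrected {M : ℝ≥0} {f : ℝ → L2R} (hf : IsFlow M f) {t₀ K : ℝ}
    (h : SigmaBound (f t₀) K) {σ : ℝ} (hσ : |σ| = 1) {s : ℝ} (hs : 1 ≤ s) :
    Continuous fun k => phaseCorrected f σ k s := by
  have hcont : ∀ r, Continuous fun k => 𝓕 (f r : ℝ → ℂ) k := fun r =>
    continuous_fourierIntegral (hf.sigmaBound h r).weight.1
  obtain ⟨K', hK'⟩ := hf.exists_sigmaBound_Icc h s
  have hint : Continuous fun k => ∫ r in (1 : ℝ)..s, (2 * Real.pi * r)⁻¹ * ‖𝓕 (f (σ * r) : ℝ → ℂ) k‖ ^ 2 := by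
    refine intervalIntegral.continuous_of_dominated_interval
      (bound := fun _ => (weightConst * K') ^ 2) ?_ ?_ intervalIntegrable_const ?_
    · intro k
      refine (Measurable.aestronglyMeasurable (by fun_prop)).mul ?_
      have hc : Continuous fun r => 𝓕 (f r : ℝ → ℂ) k :=
        continuous_iff_continuousAt.2 fun r => (hf.hasDerivAt_fourier h r k).continuousAt
      exact (((hc.comp (continuous_const.mul continuous_id)).norm).pow 2).aestronglyMeasurable
    · refine fun k => Eventually.of_forall fun r hr => ?_
      rw [Set.uIoc_of_le hs] at hr
      have hr0 : (0 : ℝ) < r := by linarith [hr.1]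
      have h1 := (hK' (σ * r) (by rw [abs_mul, hσ, one_mul, abs_of_pos hr0]; exact hr.2)).norm_fourier_le k
      rw [Real.norm_of_nonneg (by positivity)]
      refine (mul_le_of_le_one_left (by positivity) (inv_le_one_of_one_le₀ ?_)).trans (by gcongr)
      nlinarith [Real.pi_gt_three, hr.1]
    · exact Eventually.of_forall fun r _ => continuous_const.mul ((hcont _).norm.pow 2)
  exact (hcont _).mul (Complex.continuous_exp.comp
    (continuous_const.mul (Complex.continuous_ofReal.comp hint)))

/-- At each frequency the values at integer times are Cauchy with a uniform rate, and the estimate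
passes to the limit. The bound `2` comes from time `1`, where the profile is at most `1/100` and the
rate equals `1`. -/
theorem IsFlow.exists_limit {f : ℝ → L2R} (hf : IsFlow 1 f) {ε : ℝ} (h : SigmaBound (f 1) ε)
    (hε : 0 < ε) (hB : weightConst * ε ≤ 1 / 100) :
    ∃ w : ℝ → ℂ, Measurable w ∧ (∀ k, ‖w k‖ ≤ 2) ∧
      ∀ k t, 1 ≤ t → ‖phaseCorrected f 1 k t - w k‖ ≤ t ^ (-(1 / 16) : ℝ) := by
  have hrate := fun k s t => hf.norm_phaseCorrected_sub_le_rate abs_one h hε hB k (s := s) (t := t)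
  have hlim0 : Tendsto (fun n : ℕ => ((n : ℝ) + 1) ^ (-(1 / 16) : ℝ)) atTop (𝓝 0) :=
    (tendsto_rpow_neg_atTop (show (0 : ℝ) < 1 / 16 by norm_num)).comp
      (tendsto_atTop_add_const_right _ _ tendsto_natCast_atTop_atTop)
  have hex : ∀ k, ∃ w, Tendsto (fun n : ℕ => phaseCorrected f 1 k (n + 1)) atTop (𝓝 w) := fun k => by
    refine cauchySeq_tendsto_of_complete (cauchySeq_of_le_tendsto_0
      (fun n : ℕ => 2 * ((n : ℝ) + 1) ^ (-(1 / 16) : ℝ)) ?_ (by simpa using hlim0.const_mul 2))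
    intro n m N hn hm
    have hN : (1 : ℝ) ≤ N + 1 := by linarith [Nat.cast_nonneg (α := ℝ) N]
    have h1 := hrate k (N + 1) (n + 1) hN (by gcongr)
    have h2 := hrate k (N + 1) (m + 1) hN (by gcongr)
    rw [← dist_eq_norm] at h1 h2
    rw [dist_comm] at h2
    linarith [dist_triangle (phaseCorrected f 1 k (n + 1)) (phaseCorrected f 1 k (N + 1))
      (phaseCorrected f 1 k (m + 1)), h1, h2]
  choose w hw using hex
  have hb : ∀ k t, 1 ≤ t → ‖phaseCorrected f 1 k t - w k‖ ≤ t ^ (-(1 / 16) : ℝ) := fun k t ht => by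
    rw [norm_sub_rev]
    refine le_of_tendsto ((hw k).sub_const _).norm ?_
    obtain ⟨N, hN⟩ := exists_nat_ge t
    filter_upwards [eventually_ge_atTop N] with n hn
    refine hrate k t (n + 1) ht (hN.trans ?_)
    have : (N : ℝ) ≤ n := Nat.cast_le.2 hn
    linarith
  refine ⟨w, ?_, fun k => ?_, hb⟩
  · refine measurable_of_tendsto_metrizable (f := fun (n : ℕ) k => phaseCorrected f 1 k (n + 1))
      (fun n => (hf.continuous_phaseCorrected h abs_one ?_).measurable) (tendsto_pi_nhds.2 hw)
    linarith [Nat.cast_nonneg (α := ℝ) n]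
  · have h1 := hb k 1 le_rfl
    have h2 := norm_le_norm_add_norm_sub (phaseCorrected f 1 k 1) (w k)
    have h3 := h.norm_fourier_le k
    rw [norm_phaseCorrected, mul_one] at h2
    rw [Real.one_rpow] at h1
    linarith

/-- The asymptotic profile is determined by the convergence. -/
theorem ConvergesAtRate.unique {u : ℝ → L2R} {W W' : Lp ℂ ∞ (volume : Measure ℝ)} {C C' δ δ' : ℝ}
    (hm : ∀ t, 1 ≤ t → AEStronglyMeasurable (correctedProfile u t) volume)
    (hδ : 0 < δ) (hδ' : 0 < δ') (h : ConvergesAtRate u W C δ) (h' : ConvergesAtRate u W' C' δ') :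
    W' = W := by
  have hlim : ∀ C δ : ℝ, 0 < δ → Tendsto (fun t : ℝ => ENNReal.ofReal (C * t ^ (-δ))) atTop (𝓝 0) :=
    fun C δ hδ => by
      simpa using ENNReal.tendsto_ofReal ((tendsto_rpow_neg_atTop hδ).const_mul C)
  have hle : ∀ᶠ t : ℝ in atTop, eLpNorm (fun ξ => W' ξ - W ξ) ∞ volume
      ≤ ENNReal.ofReal (C * t ^ (-δ)) + ENNReal.ofReal (C' * t ^ (-δ')) := by
    filter_upwards [eventually_ge_atTop 1] with t ht
    have e : (fun ξ => W' ξ - W ξ) = (fun ξ => correctedProfile u t ξ - W ξ)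
        - fun ξ => correctedProfile u t ξ - W' ξ := by
      ext ξ
      simp
    rw [e]
    exact (eLpNorm_sub_le ((hm t ht).sub (Lp.aestronglyMeasurable W))
      ((hm t ht).sub (Lp.aestronglyMeasurable W')) le_top).trans (add_le_add (h t ht) (h' t ht))
  have hz : eLpNorm (fun ξ => W' ξ - W ξ) ∞ volume = 0 := by
    refine le_antisymm (ge_of_tendsto ?_ hle) zero_le
    simpa using (hlim C δ hδ).add (hlim C' δ' hδ')
  have hz' := (eLpNorm_eq_zero_iff ((Lp.aestronglyMeasurable W').sub (Lp.aestronglyMeasurable W))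
    ENNReal.top_ne_zero).1 hz
  refine Lp.ext ?_
  filter_upwards [hz'] with ξ hξ
  exact sub_eq_zero.1 hξ

theorem IsFlow.exists_convergesAtRate {f : ℝ → L2R} (hf : IsFlow 1 f) {ε C : ℝ}
    (h : SigmaBound (f 1) ε) (hε : 0 < ε) (hB : weightConst * ε ≤ 1 / 100) (hC : 1 ≤ C) :
    ∃ W : Lp ℂ ∞ (volume : Measure ℝ),
      ConvergesAtRate (fun t => freeGroup t (f t)) W C (1 / 16) := by
  obtain ⟨w, hwm, hwb, hw⟩ := hf.exists_limit h hε hB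
  set g : ℝ → ℂ := fun ξ => ((Real.sqrt (2 * Real.pi))⁻¹ : ℂ) * w (ξ / (2 * Real.pi)) with hg
  have hgm : AEStronglyMeasurable g volume :=
    ((hwm.comp (measurable_id.div_const _)).const_mul _).aestronglyMeasurable
  have hgb : ∀ ξ, ‖g ξ‖ ≤ 2 := fun ξ => by
    rw [hg]
    simp only
    rw [norm_mul]
    exact (mul_le_of_le_one_left (norm_nonneg _) norm_inv_sqrt_two_pi).trans (hwb _)
  have hmem := memLp_top_of_bound hgm 2 (Eventually.of_forall hgb)
  refine ⟨hmem.toLp g, fun t ht => eLpNorm_top_le_of_ae_bound ?_⟩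
  filter_upwards [hmem.coeFn_toLp] with ξ hξ
  rw [hξ, hf.correctedProfile_eq h, hg]
  simp only
  rw [← mul_sub, norm_mul]
  have ht0 : (0 : ℝ) < t := by linarith
  refine (mul_le_of_le_one_left (norm_nonneg _) norm_inv_sqrt_two_pi).trans ((hw _ t ht).trans ?_)
  exact le_mul_of_one_le_left (by positivity) hC

theorem theorem1p1 :
    ∃ ε₀ C δ : ℝ, 0 < ε₀ ∧ 0 < C ∧ 0 < δ ∧ δ < 1 / 2 ∧
      ∀ ε : ℝ, 0 < ε → ε ≤ ε₀ →
      ∀ uStar : L2R, normH10 uStar + normH01 uStar ≤ ENNReal.ofReal ε →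
      ∃ u : ℝ → L2R,
        IsGlobalSolution uStar u ∧
        (∀ v : ℝ → L2R, IsGlobalSolution uStar v → v = u) ∧
        (∀ t : ℝ, eLpNorm (u t) ∞ volume
          ≤ ENNReal.ofReal (C * ε * (1 + |t|) ^ (-(1 / 2) : ℝ))) ∧
        ∃ W : Lp ℂ ∞ (volume : Measure ℝ),
          ConvergesAtRate u W C δ ∧
          ∀ W' : Lp ℂ ∞ (volume : Measure ℝ),
            (∃ C' δ' : ℝ, 0 < δ' ∧ ConvergesAtRate u W' C' δ') → W' = W := by
  have hw := one_le_weightConst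
  have he : 1 ≤ Real.exp 6 := Real.one_le_exp (by norm_num)
  have hwe : 1 ≤ weightConst * Real.exp 6 := one_le_mul_of_one_le_of_one_le hw he
  -- The threshold keeps the norm below `1/100` even after the loss `e⁶` on `[-1, 1]`. The constant
  -- `C` is that of the decay estimate and exceeds `1`, which suffices for the convergence rate.
  refine ⟨1 / (100 * (weightConst * Real.exp 6)), 16 * (weightConst * Real.exp 6), 1 / 16,
    by positivity, by positivity, by norm_num, by norm_num, ?_⟩
  intro ε hε hε₀ uStar hu
  -- Since `u(1) = e^{i∂²/2} u_*`, the profile at time `1` is exactly `u_*`.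
  obtain ⟨f, rfl, hf⟩ := exists_isFlow 1 uStar
  have h : SigmaBound (f 1) ε := SigmaBound.of_normSigma hε.le hu
  have hB : weightConst * (ε * Real.exp 6) ≤ 1 / 100 := by
    rw [le_div_iff₀ (by positivity)] at hε₀
    linarith
  have hB1 : weightConst * ε ≤ 1 / 100 := by
    refine le_trans ?_ hB
    gcongr
    exact le_mul_of_one_le_right hε.le he
  have hdecay := hf.decay_abs h hε hB
  have hsol : IsGlobalSolution (f 1) fun t => freeGroup t (f t) := hf.isGlobalSolution h fun t => by
    filter_upwards [hdecay t] with x hx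
    refine hx.trans ?_
    have h1 : (1 + |t|) ^ (-(1 / 2) : ℝ) ≤ 1 :=
      Real.rpow_le_one_of_one_le_of_nonpos (by linarith [abs_nonneg t]) (by norm_num)
    rw [NNReal.coe_one]
    exact mul_le_one₀ (by linarith) (by positivity) h1
  obtain ⟨W, hW⟩ := hf.exists_convergesAtRate h hε hB1
    (show 1 ≤ 16 * (weightConst * Real.exp 6) by linarith)
  refine ⟨fun t => freeGroup t (f t), hsol, fun v hv => hv.unique hsol, fun t => ?_, W, hW, ?_⟩
  · refine eLpNorm_top_le_of_ae_bound ?_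
    filter_upwards [hdecay t] with x hx
    refine hx.trans (le_of_eq ?_)
    ring
  · rintro W' ⟨C', δ', hδ', hW'⟩
    refine ConvergesAtRate.unique (fun t ht => ?_) (by norm_num) hδ' hW hW'
    have e : correctedProfile (fun t => freeGroup t (f t)) t
        = fun ξ => ((Real.sqrt (2 * Real.pi))⁻¹ : ℂ) * phaseCorrected f 1 (ξ / (2 * Real.pi)) t :=
      funext fun ξ => hf.correctedProfile_eq h t ξ
    rw [e]
    exact (continuous_const.mul ((hf.continuous_phaseCorrected h abs_one ht).comp
      (continuous_id.div_const _))).aestronglyMeasurable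

end
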